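/- **Definitions.** Let $\eta\in(0,1)$ and $\rho\in[0,1)$. A sequence $X=(x_1,\dots,x_n)$ of unit vectors in $\mathbb{R}^d$ is $(\eta,\rho)$-clusterable with $k$ centers if there are distinct unit vectors $c_1,\dots,c_k\in\mathbb{R}^d$ with $|\langle c_s,c_t\rangle|\le\rho$ for $s\ne t$ and a surjective assignment $r:\{1,\dots,n\}\to\{1,\dots,k\}$ with $\langle x_i,c_{r(i)}\rangle\ge 1-\eta/2$ for all $i$. For weights $w_1,\dots,w_m\in\mathbb{R}^d$ put $S(X)=\frac1m\sum_{j=1}^m\max_{1\le i\le n}\langle w_j,x_i\rangle$. **Theorem.** There are absolute constants $c_\rho,c_\eta,C>0$, polynomials $P$ (in three variables) and $T$, and a deterministic algorithm on a real random-access machine (unit-cost field operations and comparisons on exact real numbers, unit-cost addition, truncated subtraction and comparison of integers, indirect addressing, integer constants) such that the following holds for all integers $n\ge 2$, $d\ge 1$, all $\varepsilon\in(0,1/2]$, $\delta\in(0,1)$, and all integers $$m\ \ge\ C\,\frac{\ln n\cdot\ln\!\big(\frac{\ln n}{\varepsilon\delta}\big)}{\varepsilon^2},\qquad N\ \ge\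 P\big(\ln n,\ 1/\varepsilon,\ \ln(1/\delta)\big).$$ 1. Given $n,d,m,N,\varepsilon,\delta$, any weights $w=(w_1,\dots,w_m)$ in $\mathbb{R}^d$ and any $N$ labelled sequences $(X_1,k_1),\dots,(X_N,k_N)$ (each $X_i$ a sequence of $n$ vectors of $\mathbb{R}^d$, each $k_i\in\mathbb{N}$), the algorithm halts within $T(s)$ steps, where $s$ is the number of numbers in this input, and outputs (as the list of the breakpoints and values of a step function) a nondecreasing function $f:\mathbb{R}\to\mathbb{R}$. 2. Let $0<\eta<1$ and $0\le\rho<1$ with $\rho\le c_\rho\,\varepsilon/\ln n$ and $\eta\le c_\eta\,\varepsilon^2/(\ln n)^2$, and let $\mathcal D$ be any probability distribution on pairs $(X,k)$ such that almost surely $k\ge 2$ and $X$ is an $(\eta,\rho)$-clusterable sequence of length $n$ in $\mathbb{R}^d$ with $k$ centers. Let $w_1,\dots,w_m\sim\mathcal N(0,I_d)$, the training samples $(X_1,k_1),\dots,(X_N,k_N)\sim\mathcal D$ and the test sample $(X,k)\sim\mathcal D$ all be independent, and let $f$ be the output of the algorithm on the weights and the training samples. Then $$k\ \le\ f(S(X))\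 \le\ (1+\varepsilon)\,k$$ with probability at least $1-\delta$ over the weights, the training samples and the test sample jointly. Moreover, with probability at least $1-\delta$ over the weights and the training samples, the function $f$ satisfies these inequalities with probability at least $1-\delta$ over the test sample $(X,k)\sim\mathcal D$ alone. -/

import Mathlib

open MeasureTheory ProbabilityTheory

namespace MaxSketch

noncomputable section

/-! ### Clusterable sequences and the sketch -/

/-- A sequence of `n` vectors of `ℝ^d`. -/
abbrev Seq (n d : ℕ) : Type := Fin n → EuclideanSpace ℝ (Fin d)

/-- `X` is an `(η, ρ)`-clusterable sequence of unit vectors with (exactly) `k` centers: `r` assigns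
to each observation its center. Every center is the center of some observation, so that `k` is
the number of distinct objects that occur in the sequence. -/
def Clusterable {n d : ℕ} (η ρ : ℝ) (k : ℕ) (X : Seq n d) : Prop :=
  (∀ i, ‖X i‖ = 1) ∧
  ∃ (c : Fin k → EuclideanSpace ℝ (Fin d)) (r : Fin n → Fin k),
    Function.Injective c ∧ (∀ s, ‖c s‖ = 1) ∧ Function.Surjective r ∧
    (∀ i, 1 - η / 2 ≤ inner ℝ (X i) (c (r i))) ∧
    (∀ s t, s ≠ t → |inner ℝ (c s) (c t)| ≤ ρ)

/-- The sketch `S(X) = (1/m) ∑_j max_i ⟪w_j, x_i⟫` with weights `w_1, …, w_m`. -/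
def sketch {n d m : ℕ} (w : Fin m → EuclideanSpace ℝ (Fin d)) (X : Seq n d) : ℝ :=
  (1 / (m : ℝ)) * ∑ j, ⨆ i, inner ℝ (w j) (X i)

/-- The law of `m` independent standard Gaussian vectors of `ℝ^d`. -/
def gaussianWeights (m d : ℕ) : Measure (Fin m → EuclideanSpace ℝ (Fin d)) :=
  Measure.pi fun _ => stdGaussian (EuclideanSpace ℝ (Fin d))

/-! ### A real random-access machine

The machine has a read-only input (a list of natural numbers and a list of real numbers), an
integer memory, a real memory and a write-only output list of reals. The integer operations are
addition and truncated subtraction; the real ones are the four field operations on exact reals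
(with `x / 0 = 0`) and the conversion of an integer into a real; reals can be compared, but not
rounded. Both memories are addressed by integers (indirect addressing). One program serves inputs
of all sizes, and its only constants are integers. -/

/-- The input of the machine. -/
structure Input where
  ints : List ℕ
  reals : List ℝ

/-- The size of an input: how many numbers it consists of. -/
def Input.size (I : Input) : ℕ := I.ints.length + I.reals.length

/-- The memory contents of the machine and its output so far. -/
structure State where
  ints : ℕ → ℕ
  reals : ℕ → ℝ
  out : List ℝ

/-- Integer expressions: constants, memory cells, input cells, sums, truncated differences. -/
inductive NExp where
  | const (c : ℕ)
  | mem (a : NExp)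
  | input (a : NExp)
  | add (a b : NExp)
  | sub (a b : NExp)

/-- Real expressions: integer constants, memory cells, input cells, conversions of integers,
and the field operations. -/
inductive RExp where
  | const (c : ℤ)
  | mem (a : NExp)
  | input (a : NExp)
  | ofInt (a : NExp)
  | add (a b : RExp)
  | sub (a b : RExp)
  | mul (a b : RExp)
  | div (a b : RExp)

/-- Tests: strict comparisons of integers and of reals. -/
inductive Test where
  | intLt (a b : NExp)
  | realLt (a b : RExp)

/-- Commands; `setInt a e` and `setReal a e` store the value of `e` at the address `a`, and
`emit e` appends the value of `e` to the output. -/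
inductive Com where
  | skip
  | setInt (a : NExp) (e : NExp)
  | setReal (a : NExp) (e : RExp)
  | emit (e : RExp)
  | seq (p q : Com)
  | ite (b : Test) (p q : Com)
  | while (b : Test) (p : Com)

def NExp.eval (I : Input) (σ : State) : NExp → ℕ
  | .const c => c
  | .mem a => σ.ints (a.eval I σ)
  | .input a => I.ints.getD (a.eval I σ) 0
  | .add a b => a.eval I σ + b.eval I σ
  | .sub a b => a.eval I σ - b.eval I σ

def RExp.eval (I : Input) (σ : State) : RExp → ℝ
  | .const c => c
  | .mem a => σ.reals (a.eval I σ)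
  | .input a => I.reals.getD (a.eval I σ) 0
  | .ofInt a => (a.eval I σ : ℝ)
  | .add a b => a.eval I σ + b.eval I σ
  | .sub a b => a.eval I σ - b.eval I σ
  | .mul a b => a.eval I σ * b.eval I σ
  | .div a b => a.eval I σ / b.eval I σ

def Test.Holds (I : Input) (σ : State) : Test → Prop
  | .intLt a b => a.eval I σ < b.eval I σ
  | .realLt a b => a.eval I σ < b.eval I σ

/-- A configuration: the commands that remain to be executed, and the state. -/
abbrev Config : Type := List Com × State

open Classical in
/-- One step of the machine. The expressions in a command have a bounded size that depends only on
the program, so that counting steps is counting elementary operations up to a constant factor. -/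
def step (I : Input) : Config → Config
  | ([], σ) => ([], σ)
  | (.skip :: K, σ) => (K, σ)
  | (.setInt a e :: K, σ) =>
      (K, { σ with ints := Function.update σ.ints (a.eval I σ) (e.eval I σ) })
  | (.setReal a e :: K, σ) =>
      (K, { σ with reals := Function.update σ.reals (a.eval I σ) (e.eval I σ) })
  | (.emit e :: K, σ) => (K, { σ with out := σ.out ++ [e.eval I σ] })
  | (.seq p q :: K, σ) => (p :: q :: K, σ)
  | (.ite b p q :: K, σ) => if b.Holds I σ then (p :: K, σ) else (q :: K, σ)
  | (.while b p :: K, σ) => if b.Holds I σ then (p :: .while b p :: K, σ) else (K, σ)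

/-- The configuration after `t` steps of the program `p`, started with empty output and with all
memory cells equal to zero. -/
def run (p : Com) (I : Input) (t : ℕ) : Config :=
  (step I)^[t] ([p], { ints := fun _ => 0, reals := fun _ => 0, out := [] })

/-- The program `p` halts on the input `I` after at most `t` steps. A configuration without
remaining commands never changes, so that the output is then the one after `t` steps. -/
def HaltsWithin (p : Com) (I : Input) (t : ℕ) : Prop := (run p I t).1 = []

/-! ### Readouts and learning algorithms -/

/-- Auxiliary to `readout`: `v` is the value to the left of the first breakpoint in the list. -/
def stepValue (s : ℝ) : ℝ → List ℝ → ℝ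
  | v, τ :: v' :: L => if τ ≤ s then stepValue s v' L else v
  | v, _ => v

/-- The step function that a list `[v₀, τ₁, v₁, τ₂, v₂, …]` describes: starting from the value
`v₀`, it jumps to the value `v_i` at the breakpoint `τ_i`. -/
def readout (L : List ℝ) (s : ℝ) : ℝ :=
  match L with
  | [] => 0
  | v :: L => stepValue s v L

/-- The input of a learning algorithm: `n`, `d`, `m`, `N`, the accuracy `ε`, the confidence `δ`,
the weights of the sketch, and `N` labelled sequences. -/
def learnerInput {n d m N : ℕ} (ε δ : ℝ) (w : Fin m → EuclideanSpace ℝ (Fin d))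
    (train : Fin N → Seq n d × ℕ) : Input where
  ints := [n, d, m, N] ++ List.ofFn fun i => (train i).2
  reals := [ε, δ] ++ (List.ofFn fun j => List.ofFn fun l => w j l).flatten ++
    (List.ofFn fun i => (List.ofFn fun a => List.ofFn fun l => (train i).1 a l).flatten).flatten

/-- The number of steps that the time bound `T` (a polynomial in the input size) allows. -/
def allowedTime {n d m N : ℕ} (T : Polynomial ℕ) (ε δ : ℝ)
    (w : Fin m → EuclideanSpace ℝ (Fin d)) (train : Fin N → Seq n d × ℕ) : ℕ :=
  T.eval (learnerInput ε δ w train).size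

/-- The function `f : ℝ → ℝ` that the learning algorithm `p` outputs within the time bound `T`. -/
def learned {n d m N : ℕ} (p : Com) (T : Polynomial ℕ) (ε δ : ℝ)
    (w : Fin m → EuclideanSpace ℝ (Fin d)) (train : Fin N → Seq n d × ℕ) : ℝ → ℝ :=
  readout (run p (learnerInput ε δ w train) (allowedTime T ε δ w train)).2.out

/-- The readout `f` is correct on the labelled sequence `z = (X, k)`:
`k ≤ f (S(X)) ≤ (1 + ε) k`. -/
def Correct {n d m : ℕ} (ε : ℝ) (w : Fin m → EuclideanSpace ℝ (Fin d)) (f : ℝ → ℝ)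
    (z : Seq n d × ℕ) : Prop :=
  (z.2 : ℝ) ≤ f (sketch w z.1) ∧ f (sketch w z.1) ≤ (1 + ε) * z.2

end

end MaxSketch

/-! The sketch is an average of `m` independent copies of a maximum of Gaussian variables, so it
concentrates around its mean `gaussianMax X`, and for a clusterable sequence this mean nearly
depends on `k` alone. It therefore suffices to tabulate the ideal mean for every `k ≤ n` and to
invert the table. The algorithm does this from `n`, `N` and `ε` only; it takes nothing from the
weights or the samples, and `N` merely sets the accuracy of the table.

Concentration (`gaussianWeights_sketch_le`): the maximum is replaced by log-sum-exp at inverse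
temperature `β`, a smooth 1-Lipschitz function within `ln n / β` of it, to which the Maurey–Pisier
rotation argument applies. The resulting deviation bound does not depend on `d`.

Ideal mean (`abs_gaussianMax_sub_binomMax_le_of_clusterable`): moving each observation to its center
costs at most `2 √η √(ln n)` by a maximal inequality, and surjectivity of the assignment leaves the
maximum over all `k` centers. These are nearly orthonormal. A Gaussian vector is the endpoint of a
random walk with Gaussian steps, and Lindeberg's replacement compares this walk with one whose
coordinates are independent sign walks. The second-order term of log-sum-exp is monotone in the
variances of the differences of coordinates, as in the Sudakov–Fernique inequality, so scaling the
sign walk by `√(1 ± ρ)` brackets the Gaussian maximum. The comparison value `binomMax R k` is a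
finite binomial sum, which field operations compute exactly.

Separation (`gaussianMax_firstBasis_gap`): passing from `k` to at least `(1 + ε) k` independent
normal variables raises the expected maximum by at least a constant times `ε / √(ln n)`. With
constant probability the first `k` stay below their `1 - 1/k` quantile `b`; with probability of
order `ε` some further variable exceeds `b` by a constant times `1 / √(ln n)`.

Conclusion: place the breakpoint for `k` at `binomMax R k - t`, with `t` a small multiple of `ε /
√(ln n)`. If the sketch is within `t / 2` of its ideal value, every breakpoint up to `k` has been
passed and none beyond `(1 + ε) k` has (`correct_learnerOutput`). For each fixed test sample this
closeness fails with probability at most `δ²` over the weights; Fubini and Markov give both forms of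
the conclusion (`measure_bad_le`). -/

namespace MaxSketch

/-! ### Log-sum-exp and its third-order expansion -/

section LogSumExp

variable {ι : Type*} [Fintype ι]

/-- The log-sum-exp function, a smooth approximation of the maximum. -/
noncomputable def logSumExp (x : ι → ℝ) : ℝ := Real.log (∑ i, Real.exp (x i))

/-- The Gibbs weights, which form the gradient of `logSumExp`. -/
noncomputable def gibbs (a : ι → ℝ) (i : ι) : ℝ := Real.exp (a i) / ∑ j, Real.exp (a j)

lemma measurable_logSumExp : Measurable (logSumExp : (ι → ℝ) → ℝ) := by
  unfold logSumExp; fun_prop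

variable [Nonempty ι]

lemma sum_exp_pos (x : ι → ℝ) : 0 < ∑ i, Real.exp (x i) :=
  Finset.sum_pos (fun _ _ => Real.exp_pos _) Finset.univ_nonempty

lemma gibbs_nonneg (a : ι → ℝ) (i : ι) : 0 ≤ gibbs a i :=
  div_nonneg (Real.exp_pos _).le (sum_exp_pos a).le

lemma sum_gibbs (a : ι → ℝ) : ∑ i, gibbs a i = 1 := by
  simp only [gibbs, ← Finset.sum_div]
  exact div_self (sum_exp_pos a).ne'

lemma le_logSumExp (x : ι → ℝ) (i : ι) : x i ≤ logSumExp x := by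
  rw [logSumExp, Real.le_log_iff_exp_le (sum_exp_pos x)]
  exact Finset.single_le_sum (f := fun i => Real.exp (x i)) (fun _ _ => (Real.exp_pos _).le)
    (Finset.mem_univ i)

lemma logSumExp_le {x : ι → ℝ} {b : ℝ} (h : ∀ i, x i ≤ b) :
    logSumExp x ≤ b + Real.log (Fintype.card ι) := by
  have hc : (0 : ℝ) < Fintype.card ι := by exact_mod_cast Fintype.card_pos
  rw [logSumExp, Real.log_le_iff_le_exp (sum_exp_pos x), Real.exp_add, Real.exp_log hc]
  calc ∑ i, Real.exp (x i) ≤ ∑ _i : ι, Real.exp b :=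
        Finset.sum_le_sum fun i _ => Real.exp_le_exp.2 (h i)
    _ = Real.exp b * Fintype.card ι := by simp [mul_comm]

lemma ciSup_le_logSumExp (x : ι → ℝ) : ⨆ i, x i ≤ logSumExp x := ciSup_le (le_logSumExp x)

lemma logSumExp_le_ciSup (x : ι → ℝ) :
    logSumExp x ≤ (⨆ i, x i) + Real.log (Fintype.card ι) :=
  logSumExp_le fun i => le_ciSup (Finite.bddAbove_range x) i

lemma abs_logSumExp_le (x : ι → ℝ) :
    |logSumExp x| ≤ ∑ i, |x i| + Real.log (Fintype.card ι) := by
  have hc : (1 : ℝ) ≤ Fintype.card ι := by exact_mod_cast Fintype.card_pos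
  have hs : ∀ i, |x i| ≤ ∑ j, |x j| := fun i =>
    Finset.single_le_sum (f := fun i => |x i|) (fun _ _ => abs_nonneg _) (Finset.mem_univ i)
  rw [abs_le]
  constructor
  · obtain ⟨i⟩ := ‹Nonempty ι›
    have := le_logSumExp x i
    have := neg_abs_le (x i)
    linarith [hs i, Real.log_nonneg hc]
  · exact logSumExp_le fun i => (le_abs_self _).trans (hs i)

/-- Exponential tilting: the increment is the cumulant generating function of `u` under the Gibbs
weights at `a`, so its expansion is that of a finite distribution. -/
lemma logSumExp_add (a u : ι → ℝ) :
    logSumExp (a + u) = logSumExp a + Real.log (∑ i, gibbs a i * Real.exp (u i)) := by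
  have h : ∑ i, gibbs a i * Real.exp (u i)
      = (∑ i, Real.exp ((a + u) i)) / ∑ j, Real.exp (a j) := by
    rw [Finset.sum_div]
    refine Finset.sum_congr rfl fun i _ => ?_
    rw [gibbs, Pi.add_apply, Real.exp_add]; ring
  rw [h, Real.log_div (sum_exp_pos _).ne' (sum_exp_pos _).ne', logSumExp, logSumExp]
  ring

/-- Third-order expansion of the cumulant generating function of a finite distribution. -/
lemma abs_log_sum_mul_exp_sub_le {p u : ι → ℝ} (hp : ∀ i, 0 ≤ p i) (hp1 : ∑ i, p i = 1) :
    |Real.log (∑ i, p i * Real.exp (u i)) - ∑ i, p i * u i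
      - (∑ i, p i * u i ^ 2 - (∑ i, p i * u i) ^ 2) / 2| ≤ 40 * ∑ i, |u i| ^ 3 := by
  obtain ⟨i₀, hi₀⟩ := Finite.exists_max fun i => |u i|
  set U := |u i₀| with hU
  have hU0 : 0 ≤ U := abs_nonneg _
  have hsum : U ^ 3 ≤ ∑ i, |u i| ^ 3 :=
    Finset.single_le_sum (f := fun i => |u i| ^ 3) (fun _ _ => by positivity) (Finset.mem_univ i₀)
  -- The maximum `U` of the `|u i|` controls everything; the sum of cubes appears in the statement
  -- only because it is easy to integrate.
  suffices h : |Real.log (∑ i, p i * Real.exp (u i)) - ∑ i, p i * u i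
      - (∑ i, p i * u i ^ 2 - (∑ i, p i * u i) ^ 2) / 2| ≤ 40 * U ^ 3 by linarith
  have hub : ∀ i, u i ≤ U := fun i => (le_abs_self _).trans (hi₀ i)
  have hlb : ∀ i, -U ≤ u i := fun i => by linarith [neg_abs_le (u i), hi₀ i]
  have avg : ∀ {f : ι → ℝ} {b : ℝ}, (∀ i, |f i| ≤ b) → |∑ i, p i * f i| ≤ b := by
    intro f b h
    calc |∑ i, p i * f i| ≤ ∑ i, |p i * f i| := Finset.abs_sum_le_sum_abs _ _
      _ ≤ ∑ i, p i * b := by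
          refine Finset.sum_le_sum fun i _ => ?_
          rw [abs_mul, abs_of_nonneg (hp i)]
          exact mul_le_mul_of_nonneg_left (h i) (hp i)
      _ = b := by rw [← Finset.sum_mul, hp1, one_mul]
  set A := ∑ i, p i * u i with hA
  set B := ∑ i, p i * u i ^ 2 with hB
  set Z := ∑ i, p i * Real.exp (u i) with hZ
  have hAU : |A| ≤ U := avg hi₀
  have hBU : |B| ≤ U ^ 2 := avg fun i => by
    rw [abs_pow]; exact pow_le_pow_left₀ (abs_nonneg _) (hi₀ i) 2
  have hB0 : 0 ≤ B := Finset.sum_nonneg fun i _ => mul_nonneg (hp i) (sq_nonneg _)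
  have hBle : B ≤ U ^ 2 := (le_abs_self _).trans hBU
  have hA2 : A ^ 2 ≤ U ^ 2 := by rw [← sq_abs A]; exact pow_le_pow_left₀ (abs_nonneg _) hAU 2
  obtain ⟨hA_l, hA_u⟩ := abs_le.1 hAU
  -- For `U ≥ 1/4` each term separately is at most a multiple of `U ^ 3`; for smaller `U`, the
  -- Taylor expansions of `exp` at `0` and of `log` at `1` are composed.
  rcases le_total (1 / 4) U with hU4 | hU4
  · have hZl : Real.exp (-U) ≤ Z := by
      calc Real.exp (-U) = ∑ i, p i * Real.exp (-U) := by rw [← Finset.sum_mul, hp1, one_mul]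
        _ ≤ Z := Finset.sum_le_sum fun i _ =>
          mul_le_mul_of_nonneg_left (Real.exp_le_exp.2 (hlb i)) (hp i)
    have hZu : Z ≤ Real.exp U := by
      calc Z ≤ ∑ i, p i * Real.exp U := Finset.sum_le_sum fun i _ =>
            mul_le_mul_of_nonneg_left (Real.exp_le_exp.2 (hub i)) (hp i)
        _ = Real.exp U := by rw [← Finset.sum_mul, hp1, one_mul]
    have hZ0 : 0 < Z := (Real.exp_pos _).trans_le hZl
    have h1 : -U ≤ Real.log Z := (Real.le_log_iff_exp_le hZ0).2 hZl
    have h2 : Real.log Z ≤ U := (Real.log_le_iff_le_exp hZ0).2 hZu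
    have h3 : U ≤ 16 * U ^ 3 := by nlinarith [mul_nonneg hU0 (sub_nonneg.2 hU4)]
    have h4 : U ^ 2 ≤ 4 * U ^ 3 := by nlinarith [mul_nonneg (sq_nonneg U) (sub_nonneg.2 hU4)]
    have hA20 := sq_nonneg A
    rw [abs_le]; constructor <;> linarith
  · have hexp : ∀ i, |Real.exp (u i) - 1 - u i - u i ^ 2 / 2| ≤ 2 / 9 * U ^ 3 := by
      intro i
      have := Real.exp_bound (x := u i) (by linarith [hi₀ i]) (n := 3) (by norm_num)
      have h3 : |u i| ^ 3 ≤ U ^ 3 := pow_le_pow_left₀ (abs_nonneg _) (hi₀ i) 3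
      simp only [Finset.sum_range_succ, Finset.sum_range_zero] at this
      norm_num [Nat.factorial] at this
      rw [show Real.exp (u i) - 1 - u i - u i ^ 2 / 2 = Real.exp (u i) - (1 + u i + u i ^ 2 / 2)
        by ring]
      linarith
    have hW : |Z - 1 - A - B / 2| ≤ 2 / 9 * U ^ 3 := by
      have h := avg hexp
      rwa [show ∑ i, p i * (Real.exp (u i) - 1 - u i - u i ^ 2 / 2) = Z - 1 - A - B / 2 by
        simp only [mul_sub, Finset.sum_sub_distrib, mul_one, hp1, hZ, hA, hB, Finset.sum_div,
          mul_div_assoc]] at h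
    obtain ⟨hW_l, hW_u⟩ := abs_le.1 hW
    set W := Z - 1 with hWd
    have hU2 : U ^ 2 ≤ U / 4 := by nlinarith
    have hU3 : U ^ 3 ≤ U ^ 2 / 4 := by nlinarith [sq_nonneg U]
    have hWabs : |W| ≤ 6 / 5 * U := by rw [abs_le]; constructor <;> linarith
    have hW1 : |-W| < 1 := by rw [abs_neg]; linarith
    have hlog := Real.abs_log_sub_add_sum_range_le hW1 2
    simp only [Finset.sum_range_succ, Finset.sum_range_zero, abs_neg] at hlog
    norm_num at hlog
    rw [show 1 + W = Z by rw [hWd]; ring] at hlog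
    have hW3 : |W| ^ 3 / (1 - |W|) ≤ 5 / 2 * U ^ 3 := by
      rw [div_le_iff₀ (by linarith)]
      have h3 : |W| ^ 3 ≤ (6 / 5 * U) ^ 3 := pow_le_pow_left₀ (abs_nonneg _) hWabs 3
      have hU30 : 0 ≤ U ^ 3 := by positivity
      have h4 : 7 / 10 * U ^ 3 ≤ (1 - |W|) * U ^ 3 :=
        mul_le_mul_of_nonneg_right (by linarith) hU30
      rw [mul_pow] at h3
      linarith
    have hd : |W ^ 2 - A ^ 2| ≤ 2 * U ^ 3 := by
      have e : W ^ 2 - A ^ 2 = (W - A) * (W + A) := by ring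
      have h1 : |W - A| ≤ 3 / 5 * U ^ 2 := by rw [abs_le]; constructor <;> linarith
      have h2 : |W + A| ≤ 11 / 5 * U := (abs_add_le _ _).trans (by linarith)
      rw [e, abs_mul]
      calc _ ≤ (3 / 5 * U ^ 2) * (11 / 5 * U) :=
            mul_le_mul h1 h2 (abs_nonneg _) (by positivity)
        _ ≤ 2 * U ^ 3 := by nlinarith [pow_nonneg hU0 3]
    obtain ⟨hd_l, hd_u⟩ := abs_le.1 hd
    obtain ⟨hlog_l, hlog_u⟩ := abs_le.1 (hlog.trans hW3)
    have hU30 : 0 ≤ U ^ 3 := by positivity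
    rw [abs_le]; constructor <;> linarith

lemma abs_logSumExp_add_sub_le (a u : ι → ℝ) :
    |logSumExp (a + u) - (logSumExp a + ∑ i, gibbs a i * u i
      + (∑ i, gibbs a i * u i ^ 2 - (∑ i, gibbs a i * u i) ^ 2) / 2)| ≤ 40 * ∑ i, |u i| ^ 3 := by
  have h := abs_log_sum_mul_exp_sub_le (u := u) (gibbs_nonneg a) (sum_gibbs a)
  rw [logSumExp_add]
  convert h using 2
  ring

end LogSumExp

/-! ### Random walks as convolution powers -/

section ConvPow

variable {V : Type*} [AddMonoid V] [MeasurableSpace V]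

/-- The `l`-fold convolution power of a measure: the law of a random walk after `l` steps. -/
noncomputable def convPow (ν : Measure V) : ℕ → Measure V
  | 0 => Measure.dirac 0
  | l + 1 => convPow ν l ∗ ν

variable [MeasurableAdd₂ V]

instance isProbabilityMeasure_convPow (ν : Measure V) [IsProbabilityMeasure ν] (l : ℕ) :
    IsProbabilityMeasure (convPow ν l) := by
  induction l with
  | zero => unfold convPow; infer_instance
  | succ l ih => unfold convPow; infer_instance

/-- An affine image of a walk is a walk: the shift `c` enters once per step and accumulates to `l •
c`. This turns coin counts into centred sign walks. -/
lemma map_convPow {W : Type*} [AddCommMonoid W] [MeasurableSpace W] [MeasurableAdd₂ W]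
    (ν : Measure V) [IsProbabilityMeasure ν] (L : V →+ W) (hL : Measurable L) (c : W) (l : ℕ) :
    (convPow ν l).map (fun x => L x + l • c) = convPow (ν.map fun x => L x + c) l := by
  induction l with
  | zero => simp [convPow, Measure.map_dirac' hL]
  | succ l ih =>
    have h1 : Measurable fun x => L x + c := hL.add_const c
    have h2 : ∀ r : ℕ, Measurable fun x => L x + r • c := fun r => hL.add_const _
    have := Measure.isProbabilityMeasure_map (μ := ν) h1.aemeasurable
    rw [convPow, convPow, ← ih, Measure.conv, Measure.conv, Measure.map_map (h2 _) (by fun_prop),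
      Measure.map_prod_map _ _ (h2 _) h1,
      Measure.map_map (by fun_prop) ((h2 _).prodMap h1)]
    congr 1
    ext x
    simp only [Function.comp_apply, Prod.map, map_add, succ_nsmul]
    abel

end ConvPow

/-! ### Lindeberg replacement and Sudakov–Fernique comparison -/

section Lindeberg

variable {ι : Type*} [Fintype ι]

lemma integrable_eval_conv {μ ν : Measure (ι → ℝ)} [IsProbabilityMeasure μ]
    [IsProbabilityMeasure ν] (hμ : ∀ i, Integrable (fun u => u i) μ)
    (hν : ∀ i, Integrable (fun u => u i) ν) (i : ι) : Integrable (fun u => u i) (μ ∗ ν) := by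
  unfold Measure.conv
  rw [integrable_map_measure (f := fun x : (ι → ℝ) × (ι → ℝ) => x.1 + x.2)
    (g := fun u : ι → ℝ => u i) (measurable_pi_apply i).aestronglyMeasurable (by fun_prop)]
  exact ((hμ i).comp_fst ν).add ((hν i).comp_snd μ)

lemma integrable_eval_convPow {ν : Measure (ι → ℝ)} [IsProbabilityMeasure ν]
    (hν : ∀ i, Integrable (fun u => u i) ν) (l : ℕ) (i : ι) :
    Integrable (fun u => u i) (convPow ν l) := by
  induction l generalizing i with
  | zero => unfold convPow; exact integrable_dirac (by finiteness)
  | succ l ih => unfold convPow; exact integrable_eval_conv ih hν i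

/-- Writing the variance through pairwise differences gives nonnegative coefficients when `p` is
nonnegative. Hence only the variances of `u i - u j`, not the whole covariance, have to be compared.
-/
lemma sum_sq_sub_sq_sum {p : ι → ℝ} (hp : ∑ i, p i = 1) (u : ι → ℝ) :
    (∑ i, p i * u i ^ 2 - (∑ i, p i * u i) ^ 2) / 2
      = ∑ i, ∑ j, p i * p j * (u i - u j) ^ 2 / 4 := by
  have h : ∀ i j, p i * p j * (u i - u j) ^ 2 / 4
      = (p i * u i ^ 2) * p j / 4 + p i * (p j * u j ^ 2) / 4 - (p i * u i) * (p j * u j) / 2 :=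
    fun i j => by ring
  simp only [h, Finset.sum_sub_distrib, Finset.sum_add_distrib, ← Finset.sum_div,
    ← Finset.mul_sum, ← Finset.sum_mul, hp]
  ring

variable [Nonempty ι]

lemma integrable_logSumExp {ν : Measure (ι → ℝ)} [IsProbabilityMeasure ν]
    (hν : ∀ i, Integrable (fun u => u i) ν) (a : ι → ℝ) :
    Integrable (fun u => logSumExp (a + u)) ν := by
  refine Integrable.mono' (g := fun u => ∑ i, (|a i| + |u i|) + Real.log (Fintype.card ι))
    ?_ (measurable_logSumExp.comp (measurable_const_add a)).aestronglyMeasurable ?_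
  · exact (integrable_finsetSum _ fun i _ => (integrable_const _).add (hν i).abs).add
      (integrable_const _)
  · refine ae_of_all _ fun u => ?_
    rw [Real.norm_eq_abs]
    refine (abs_logSumExp_le _).trans ?_
    gcongr with i
    exact abs_add_le _ _

/-- Lindeberg's telescoping: the last step is exchanged first, at the price `e`; after Fubini the
remaining `l` steps are exchanged by induction. Both uses need the bound from every starting point,
which is why `h` and the induction are uniform in `a`. -/
lemma integral_logSumExp_convPow_le {ν ν' : Measure (ι → ℝ)} [IsProbabilityMeasure ν]
    [IsProbabilityMeasure ν'] (hν : ∀ i, Integrable (fun u => u i) ν)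
    (hν' : ∀ i, Integrable (fun u => u i) ν') {e : ℝ}
    (h : ∀ a, ∫ u, logSumExp (a + u) ∂ν ≤ ∫ u, logSumExp (a + u) ∂ν' + e) (l : ℕ) (a : ι → ℝ) :
    ∫ u, logSumExp (a + u) ∂convPow ν l ≤ ∫ u, logSumExp (a + u) ∂convPow ν' l + l * e := by
  induction l generalizing a with
  | zero => simp [convPow]
  | succ l ih =>
    have hl := integrable_eval_convPow hν l
    have hl' := integrable_eval_convPow hν' l
    have key : ∀ {μ₁ μ₂ : Measure (ι → ℝ)} [IsProbabilityMeasure μ₁] [IsProbabilityMeasure μ₂],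
        (∀ i, Integrable (fun u => u i) μ₁) → (∀ i, Integrable (fun u => u i) μ₂) →
        Integrable (fun z : (ι → ℝ) × (ι → ℝ) => logSumExp (a + (z.1 + z.2))) (μ₁.prod μ₂) := by
      intro μ₁ μ₂ _ _ h₁ h₂
      have := integrable_logSumExp (integrable_eval_conv h₁ h₂) a
      unfold Measure.conv at this
      rwa [integrable_map_measure this.1 (by fun_prop)] at this
    simp only [convPow]
    rw [integral_conv (integrable_logSumExp (integrable_eval_conv hl hν) a),
      integral_conv (integrable_logSumExp (integrable_eval_conv hl' hν') a)]
    have k1 := (key hl hν).integral_prod_left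
    have k2 := (key hl hν').integral_prod_left
    have k3 := (key hl hν').integral_prod_right
    have k4 := (key hl' hν').integral_prod_right
    calc ∫ x, ∫ y, logSumExp (a + (x + y)) ∂ν ∂convPow ν l
        ≤ ∫ x, (∫ y, logSumExp (a + (x + y)) ∂ν' + e) ∂convPow ν l := by
          refine integral_mono k1 (k2.add (integrable_const e)) fun x => ?_
          simpa only [add_assoc] using h (a + x)
      _ = ∫ x, ∫ y, logSumExp (a + (x + y)) ∂ν' ∂convPow ν l + e := by
          rw [integral_add k2 (integrable_const e)]; simp
      _ = ∫ y, ∫ x, logSumExp (a + (x + y)) ∂convPow ν l ∂ν' + e := by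
          rw [integral_integral_swap (key hl hν')]
      _ ≤ ∫ y, (∫ x, logSumExp (a + (x + y)) ∂convPow ν' l + l * e) ∂ν' + e := by
          gcongr ?_ + e
          refine integral_mono k3 (k4.add (integrable_const _)) fun y => ?_
          simpa only [add_assoc, add_comm y] using ih (a + y)
      _ = ∫ y, ∫ x, logSumExp (a + (x + y)) ∂convPow ν' l ∂ν' + l * e + e := by
          rw [integral_add k4 (integrable_const _)]; simp
      _ = _ := by
          rw [← integral_integral_swap (key hl' hν')]; push_cast; ring

/-- A step of a random walk changes the expectation of `logSumExp` to second order by a quantity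
that is monotone in the variances of the increments. -/
lemma abs_integral_logSumExp_sub_le {ν : Measure (ι → ℝ)} [IsProbabilityMeasure ν] {κ : ℝ}
    (h3 : ∀ i, MemLp (fun u : ι → ℝ => u i) 3 ν) (h0 : ∀ i, ∫ u, u i ∂ν = 0)
    (hκ : ∀ i, ∫ u, |u i| ^ 3 ∂ν ≤ κ) (a : ι → ℝ) :
    |∫ u, logSumExp (a + u) ∂ν - (logSumExp a
      + ∑ i, ∑ j, gibbs a i * gibbs a j * (∫ u, (u i - u j) ^ 2 ∂ν) / 4)|
      ≤ 40 * (Fintype.card ι * κ) := by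
  have h1 : ∀ i, Integrable (fun u : ι → ℝ => u i) ν := fun i =>
    (h3 i).integrable (by norm_num)
  have i3 : ∀ i, Integrable (fun u : ι → ℝ => |u i| ^ 3) ν := fun i =>
    (h3 i).integrable_norm_pow (p := 3) (by norm_num)
  have i2 : ∀ i j, Integrable (fun u : ι → ℝ => (u i - u j) ^ 2) ν := fun i j =>
    (((h3 i).sub (h3 j)).mono_exponent (by norm_num)).integrable_sq
  have hi := integrable_logSumExp h1 a
  have hi1 : Integrable (fun u : ι → ℝ => ∑ i, gibbs a i * u i) ν :=
    integrable_finsetSum _ fun i _ => (h1 i).const_mul _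
  have hi2 : Integrable (fun u : ι → ℝ => ∑ i, ∑ j, gibbs a i * gibbs a j * (u i - u j) ^ 2 / 4)
      ν := integrable_finsetSum _ fun i _ => integrable_finsetSum _ fun j _ =>
        ((i2 i j).const_mul _).div_const _
  have e1 : ∫ u : ι → ℝ, ∑ i, gibbs a i * u i ∂ν = 0 := by
    rw [integral_finsetSum _ fun i _ => (h1 i).const_mul _]
    simp [integral_const_mul, h0]
  have e2 : ∫ u : ι → ℝ, ∑ i, ∑ j, gibbs a i * gibbs a j * (u i - u j) ^ 2 / 4 ∂ν
      = ∑ i, ∑ j, gibbs a i * gibbs a j * (∫ u, (u i - u j) ^ 2 ∂ν) / 4 := by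
    rw [integral_finsetSum _ fun i _ => integrable_finsetSum _ fun j _ =>
        ((i2 i j).const_mul _).div_const _]
    refine Finset.sum_congr rfl fun i _ => ?_
    rw [integral_finsetSum _ fun j _ => ((i2 i j).const_mul _).div_const _]
    refine Finset.sum_congr rfl fun j _ => ?_
    rw [integral_div, integral_const_mul]
  have e : ∫ u, logSumExp (a + u) ∂ν - (logSumExp a
      + ∑ i, ∑ j, gibbs a i * gibbs a j * (∫ u, (u i - u j) ^ 2 ∂ν) / 4)
      = ∫ u, (logSumExp (a + u) - (logSumExp a + ∑ i, gibbs a i * u i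
        + ∑ i, ∑ j, gibbs a i * gibbs a j * (u i - u j) ^ 2 / 4)) ∂ν := by
    have hc : Integrable (fun u : ι → ℝ => logSumExp a + ∑ i, gibbs a i * u i) ν :=
      (integrable_const _).add hi1
    have hq : Integrable (fun u : ι → ℝ => logSumExp a + ∑ i, gibbs a i * u i
        + ∑ i, ∑ j, gibbs a i * gibbs a j * (u i - u j) ^ 2 / 4) ν := hc.add hi2
    rw [integral_sub hi hq, integral_add hc hi2,
      integral_add (integrable_const _) hi1, e1, e2]
    simp
  rw [e, ← Real.norm_eq_abs]
  calc _ ≤ ∫ u, 40 * ∑ i, |u i| ^ 3 ∂ν := by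
        refine norm_integral_le_of_norm_le
          ((integrable_finsetSum _ fun i _ => i3 i).const_mul 40) (ae_of_all _ fun u => ?_)
        rw [Real.norm_eq_abs, ← sum_sq_sub_sq_sum (sum_gibbs a)]
        exact abs_logSumExp_add_sub_le a u
    _ = 40 * ∑ i, ∫ u, |u i| ^ 3 ∂ν := by
        rw [integral_const_mul, integral_finsetSum _ fun i _ => i3 i]
    _ ≤ 40 * ∑ _i : ι, κ := by gcongr with i; exact hκ i
    _ = _ := by simp

/-- **Sudakov–Fernique comparison** for random walks, by Lindeberg's method: the walk whose
increments have the larger variances has the larger expected `logSumExp`, up to third moments. -/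
lemma integral_logSumExp_convPow_le_of_variance_le {ν ν' : Measure (ι → ℝ)}
    [IsProbabilityMeasure ν] [IsProbabilityMeasure ν'] {κ : ℝ}
    (h3 : ∀ i, MemLp (fun u : ι → ℝ => u i) 3 ν) (h3' : ∀ i, MemLp (fun u : ι → ℝ => u i) 3 ν')
    (h0 : ∀ i, ∫ u, u i ∂ν = 0) (h0' : ∀ i, ∫ u, u i ∂ν' = 0)
    (hκ : ∀ i, ∫ u, |u i| ^ 3 ∂ν ≤ κ) (hκ' : ∀ i, ∫ u, |u i| ^ 3 ∂ν' ≤ κ)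
    (hv : ∀ i j, ∫ u, (u i - u j) ^ 2 ∂ν ≤ ∫ u, (u i - u j) ^ 2 ∂ν') (l : ℕ) :
    ∫ u, logSumExp u ∂convPow ν l
      ≤ ∫ u, logSumExp u ∂convPow ν' l + l * (80 * (Fintype.card ι * κ)) := by
  -- The price `80` per step is twice the Taylor error `40`, once for each of the two laws.
  have := integral_logSumExp_convPow_le (fun i => (h3 i).integrable (by norm_num))
    (fun i => (h3' i).integrable (by norm_num)) (e := 80 * (Fintype.card ι * κ)) ?_ l 0
  · simpa using this
  intro a
  have k := (abs_le.1 (abs_integral_logSumExp_sub_le h3 h0 hκ a)).2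
  have k' := (abs_le.1 (abs_integral_logSumExp_sub_le h3' h0' hκ' a)).1
  have hs : ∑ i, ∑ j, gibbs a i * gibbs a j * (∫ u, (u i - u j) ^ 2 ∂ν) / 4
      ≤ ∑ i, ∑ j, gibbs a i * gibbs a j * (∫ u, (u i - u j) ^ 2 ∂ν') / 4 := by
    refine Finset.sum_le_sum fun i _ => Finset.sum_le_sum fun j _ => ?_
    exact div_le_div_of_nonneg_right (mul_le_mul_of_nonneg_left (hv i j)
      (mul_nonneg (gibbs_nonneg a i) (gibbs_nonneg a j))) (by norm_num)
  linarith

end Lindeberg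

/-! ### Coin walks and their expected maximum -/

section Coin

/-- The law of a fair coin with values `0` and `1`. -/
noncomputable def coin : Measure ℕ :=
  (2⁻¹ : ENNReal) • Measure.dirac 0 + (2⁻¹ : ENNReal) • Measure.dirac 1

instance isProbabilityMeasure_coin : IsProbabilityMeasure coin :=
  ⟨by simp [coin, ENNReal.inv_two_add_inv_two]⟩

lemma integral_coin (f : ℕ → ℝ) : ∫ x, f x ∂coin = (f 0 + f 1) / 2 := by
  have h : ∀ a : ℕ, Integrable f ((2⁻¹ : ENNReal) • Measure.dirac a) := fun a =>
    (integrable_dirac (by finiteness)).smul_measure (by simp)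
  rw [coin, integral_add_measure (h 0) (h 1), integral_smul_measure, integral_smul_measure]
  simp
  ring

/-- Conditioning on the last coin; at the level of point masses this is Pascal's rule. -/
lemma convPow_coin_succ (l : ℕ) :
    convPow coin (l + 1) = (2⁻¹ : ENNReal) • convPow coin l
      + (2⁻¹ : ENNReal) • (convPow coin l).map (· + 1) := by
  have hs : ∀ (μ ν : Measure ℕ) [SFinite μ] [SFinite ν] (s : ENNReal),
      μ ∗ (s • ν) = s • (μ ∗ ν) := fun μ ν _ _ s => by
    simp only [Measure.conv]
    rw [Measure.prod_smul_right, Measure.map_smul]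
  rw [convPow, coin, Measure.conv_add, hs, hs, Measure.conv_dirac, Measure.conv_dirac]
  simp

lemma convPow_coin_singleton (l j : ℕ) :
    (convPow coin l).real {j} = (l.choose j : ℝ) / 2 ^ l := by
  induction l generalizing j with
  | zero =>
    rcases j with _ | j <;> simp [convPow, measureReal_def]
  | succ l ih =>
    have hm : IsProbabilityMeasure ((convPow coin l).map (· + 1)) :=
      Measure.isProbabilityMeasure_map (by fun_prop)
    have ht : ∀ (μ : Measure ℕ) [IsProbabilityMeasure μ], (2⁻¹ : ENNReal) * μ {j} ≠ ⊤ :=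
      fun μ _ => ENNReal.mul_ne_top (by simp) (measure_ne_top _ _)
    rw [measureReal_def, convPow_coin_succ, Measure.add_apply, Measure.smul_apply,
      Measure.smul_apply, smul_eq_mul, smul_eq_mul, ENNReal.toReal_add (ht _) (ht _),
      ENNReal.toReal_mul, ENNReal.toReal_mul, ← measureReal_def, ← measureReal_def, ih,
      map_measureReal_apply (by fun_prop) (by simp)]
    rcases j with _ | j
    · have : (fun x : ℕ => x + 1) ⁻¹' {0} = ∅ := by ext x; simp
      rw [this]; simp; field_simp; ring
    · have : (fun x : ℕ => x + 1) ⁻¹' {j + 1} = {j} := by ext x; simp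
      rw [this, ih, Nat.choose_succ_succ]; simp; field_simp; ring

/-- The distribution function of the binomial distribution with parameters `l` and `1 / 2`. -/
noncomputable def binomCdf (l j : ℕ) : ℝ := ∑ i ∈ Finset.range (j + 1), (l.choose i : ℝ) / 2 ^ l

lemma convPow_coin_Iic (l j : ℕ) : (convPow coin l).real (Set.Iic j) = binomCdf l j := by
  have : Set.Iic j = ((Finset.range (j + 1) : Finset ℕ) : Set ℕ) := by
    ext x; simp
  rw [this, ← sum_measureReal_singleton, binomCdf]
  exact Finset.sum_congr rfl fun i _ => convPow_coin_singleton l i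

lemma binomCdf_self (l : ℕ) : binomCdf l l = 1 := by
  rw [binomCdf, ← Finset.sum_div, div_eq_one_iff_eq (by positivity)]
  exact_mod_cast Nat.sum_range_choose l

lemma convPow_coin_le (l : ℕ) : ∀ᵐ x ∂convPow coin l, x ≤ l := by
  have h : (convPow coin l).real (Set.Iic l)ᶜ = 0 := by
    rw [probReal_compl_eq_one_sub measurableSet_Iic, convPow_coin_Iic, binomCdf_self, sub_self]
  rw [measureReal_eq_zero_iff] at h
  exact h

variable {ι : Type*} [Fintype ι]

lemma pi_conv_pi {V : Type*} [AddMonoid V] [MeasurableSpace V] [MeasurableAdd₂ V]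
    (μ ν : Measure V) [IsProbabilityMeasure μ] [IsProbabilityMeasure ν] :
    (Measure.pi fun _ : ι => μ) ∗ (Measure.pi fun _ : ι => ν)
      = Measure.pi fun _ : ι => μ ∗ ν := by
  have h := (measurePreserving_arrowProdEquivProdArrow V V ι (fun _ => μ) (fun _ => ν)).map_eq
  rw [Measure.conv, ← h, Measure.map_map (by fun_prop) (MeasurableEquiv.measurable _)]
  have : ∀ _ : ι, IsProbabilityMeasure ((μ.prod ν).map fun x : V × V => x.1 + x.2) := fun _ =>
    Measure.isProbabilityMeasure_map (by fun_prop)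
  exact Measure.pi_map_pi (μ := fun _ : ι => μ.prod ν) (f := fun _ x => x.1 + x.2)
    fun _ => by fun_prop

/-- Walks with independent coordinates keep them independent, which makes the distribution function
of the maximum a power. -/
lemma convPow_pi {V : Type*} [AddMonoid V] [MeasurableSpace V] [MeasurableAdd₂ V]
    (ν : Measure V) [IsProbabilityMeasure ν] (l : ℕ) :
    convPow (Measure.pi fun _ : ι => ν) l = Measure.pi fun _ : ι => convPow ν l := by
  induction l with
  | zero =>
    refine (Measure.pi_eq fun s hs => ?_).symm
    simp only [convPow]
    rw [Measure.dirac_apply' _ (.univ_pi hs)]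
    simp_rw [Measure.dirac_apply' _ (hs _)]
    classical
    simp [Set.indicator_apply, Finset.prod_ite_zero]
  | succ l ih => rw [convPow, ih, pi_conv_pi]; rfl

/-- The expected maximum of `k` independent normalized sums of `R ^ 2` random signs. -/
noncomputable def binomMax (R k : ℕ) : ℝ :=
  R - 2 / R * ∑ j ∈ Finset.range (R ^ 2), binomCdf (R ^ 2) j ^ k

/-- Tail summation: if `J*` is the largest count, then `R ^ 2 - J*` is the number of `j < R ^ 2`
with `J* ≤ j`, and this event has probability `binomCdf (R ^ 2) j` to the power of the number of
coordinates. Taking a square number of steps makes the normalization rational. -/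
lemma integral_ciSup_convPow_coin [Nonempty ι] {R : ℕ} (hR : 0 < R) :
    ∫ J, ⨆ i, (2 * (J i : ℝ) - (R : ℝ) ^ 2) / R ∂(Measure.pi fun _ : ι => convPow coin (R ^ 2))
      = binomMax R (Fintype.card ι) := by
  set M := R ^ 2 with hM
  have hR0 : (0 : ℝ) < R := by exact_mod_cast hR
  have hM' : (M : ℝ) = (R : ℝ) ^ 2 := by rw [hM]; push_cast; ring
  have hle : ∀ᵐ J ∂(Measure.pi fun _ : ι => convPow coin M), ∀ i, J i ≤ M :=
    ae_all_iff.2 fun i => (measurePreserving_eval (fun _ : ι => convPow coin M) i).quasiMeasurePreserving.ae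
      (convPow_coin_le M)
  let S : ℕ → Set (ι → ℕ) := fun j => Set.univ.pi fun _ => Set.Iic j
  have hS : ∀ j, MeasurableSet (S j) := fun j => .univ_pi fun _ => measurableSet_Iic
  have hform : ∀ᵐ J ∂(Measure.pi fun _ : ι => convPow coin M),
      ⨆ i, (2 * (J i : ℝ) - (R : ℝ) ^ 2) / R
        = R - 2 / R * ∑ j ∈ Finset.range M, (S j).indicator (fun _ => (1 : ℝ)) J := by
    filter_upwards [hle] with J hJ
    obtain ⟨i₀, hi₀⟩ := Finite.exists_max J
    have h1 : ⨆ i, (2 * (J i : ℝ) - (R : ℝ) ^ 2) / R = (2 * (J i₀ : ℝ) - (R : ℝ) ^ 2) / R := by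
      refine le_antisymm (ciSup_le fun i => ?_)
        (le_ciSup (f := fun i => (2 * (J i : ℝ) - (R : ℝ) ^ 2) / R) (Finite.bddAbove_range _) i₀)
      have : (J i : ℝ) ≤ J i₀ := by exact_mod_cast hi₀ i
      gcongr
    have h2 : ∀ j, (S j).indicator (fun _ => (1 : ℝ)) J = if J i₀ ≤ j then 1 else 0 := fun j => by
      classical
      rw [Set.indicator_apply]
      congr 1
      simp only [S, Set.mem_pi, Set.mem_univ, true_imp_iff, Set.mem_Iic, eq_iff_iff]
      exact ⟨fun h => h i₀, fun h i => (hi₀ i).trans h⟩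
    have h3 : ∑ j ∈ Finset.range M, (if J i₀ ≤ j then (1 : ℝ) else 0) = M - J i₀ := by
      rw [← Finset.sum_filter, Finset.sum_const, nsmul_one]
      have : (Finset.range M).filter (fun j => J i₀ ≤ j) = Finset.Ico (J i₀) M := by
        ext j; simp [and_comm]
      rw [this, Nat.card_Ico, Nat.cast_sub (hJ i₀)]
    rw [h1, Finset.sum_congr rfl fun j _ => h2 j, h3, hM']
    field_simp
    ring
  rw [integral_congr_ae hform, integral_sub (integrable_const _), integral_const_mul,
    integral_finsetSum]
  · simp only [integral_indicator_const _ (hS _), integral_const, probReal_univ, one_smul]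
    rw [binomMax]
    congr 2
    refine Finset.sum_congr rfl fun j _ => ?_
    rw [measureReal_def, Measure.pi_pi, ENNReal.toReal_prod]
    simp only [← measureReal_def, convPow_coin_Iic]
    simp
    rfl
  · exact fun j _ => (integrable_const _).indicator (hS j)
  · exact (integrable_finsetSum _ fun j _ => (integrable_const _).indicator (hS j)).const_mul _

end Coin

/-! ### One-step moments of Gaussian and sign walks -/

section GaussianMax

variable {E : Type*} [NormedAddCommGroup E] [InnerProductSpace ℝ E] [FiniteDimensional ℝ E]
  [MeasurableSpace E] [BorelSpace E]

lemma map_inner_stdGaussian (v : E) :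
    (stdGaussian E).map (fun w => inner ℝ w v) = gaussianReal 0 (‖v‖₊ ^ 2) := by
  have h := IsGaussian.map_eq_gaussianReal (μ := stdGaussian E) (innerSL ℝ v)
  rw [integral_strongDual_stdGaussian, variance_dual_stdGaussian, innerSL_apply_norm] at h
  have e : (fun w => inner ℝ w v) = ⇑(innerSL ℝ v) := by
    ext w; rw [innerSL_apply_apply, real_inner_comm]
  rw [e, h]
  congr 1
  ext
  simp

lemma integral_comp_inner_stdGaussian (v : E) {f : ℝ → ℝ} (hf : Measurable f) :
    ∫ w, f (inner ℝ w v) ∂stdGaussian E = ∫ x, f x ∂gaussianReal 0 (‖v‖₊ ^ 2) := by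
  rw [← map_inner_stdGaussian, integral_map (by fun_prop) hf.aestronglyMeasurable]

lemma memLp_inner_stdGaussian (v : E) (p : ENNReal) (hp : p ≠ ⊤) :
    MemLp (fun w => inner ℝ w v) p (stdGaussian E) := by
  have h := memLp_id_gaussianReal' (μ := 0) (v := ‖v‖₊ ^ 2) p hp
  rw [← map_inner_stdGaussian, memLp_map_measure_iff (by fun_prop) (by fun_prop)] at h
  exact h

lemma integrable_inner_stdGaussian (v : E) :
    Integrable (fun w => inner ℝ w v) (stdGaussian E) :=
  (memLp_inner_stdGaussian v 1 (by simp)).integrable le_rfl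

lemma integral_inner_stdGaussian (v : E) : ∫ w, inner ℝ w v ∂stdGaussian E = 0 := by
  rw [integral_comp_inner_stdGaussian v (f := fun x => x) measurable_id, integral_id_gaussianReal]

lemma integral_inner_sq_stdGaussian (v : E) :
    ∫ w, inner ℝ w v ^ 2 ∂stdGaussian E = ‖v‖ ^ 2 := by
  rw [integral_comp_inner_stdGaussian v (f := fun x => x ^ 2) (by fun_prop)]
  have h := variance_fun_id_gaussianReal (μ := 0) (v := ‖v‖₊ ^ 2)
  rw [variance_of_integral_eq_zero (by fun_prop) integral_id_gaussianReal] at h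
  simpa using h

lemma integrable_exp_inner_stdGaussian (v : E) (t : ℝ) :
    Integrable (fun w => Real.exp (t * inner ℝ w v)) (stdGaussian E) := by
  have h := integrable_exp_mul_gaussianReal (μ := 0) (v := ‖v‖₊ ^ 2) t
  rw [← map_inner_stdGaussian, integrable_map_measure (by fun_prop) (by fun_prop)] at h
  exact h

lemma integral_exp_inner_stdGaussian (v : E) (t : ℝ) :
    ∫ w, Real.exp (t * inner ℝ w v) ∂stdGaussian E = Real.exp (‖v‖ ^ 2 * t ^ 2 / 2) := by
  have := mgf_gaussianReal (map_inner_stdGaussian v) t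
  rw [mgf] at this
  simpa using this

/-- From `|x| ^ 3 / 3! ≤ exp |x| ≤ exp x + exp (-x)` and the Gaussian moment generating function,
the third moment is at most `12 √e < 20`. -/
lemma integral_abs_inner_pow_three_le {v : E} (hv : ‖v‖ = 1) :
    ∫ w, |inner ℝ w v| ^ 3 ∂stdGaussian E ≤ 20 := by
  have h1 := integrable_exp_inner_stdGaussian v 1
  have h2 := integrable_exp_inner_stdGaussian v (-1)
  calc ∫ w, |inner ℝ w v| ^ 3 ∂stdGaussian E
      ≤ ∫ w, 6 * (Real.exp (1 * inner ℝ w v) + Real.exp (-1 * inner ℝ w v)) ∂stdGaussian E := by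
        refine integral_mono ((memLp_inner_stdGaussian v 3 (by simp)).integrable_norm_pow
          (p := 3) (by norm_num)) ((h1.add h2).const_mul 6) fun w => ?_
        simp only [one_mul, neg_mul]
        set x : ℝ := inner ℝ w v
        have h3 : |x| ^ 3 / (Nat.factorial 3 : ℝ) ≤ Real.exp |x| :=
          Real.pow_div_factorial_le_exp _ (abs_nonneg _) 3
        have h4 : Real.exp |x| ≤ Real.exp x + Real.exp (-x) := by
          rcases abs_cases x with ⟨h, _⟩ | ⟨h, _⟩ <;> rw [h] <;>
            linarith [Real.exp_pos x, Real.exp_pos (-x)]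
        norm_num [Nat.factorial] at h3
        linarith
    _ = 12 * Real.exp (1 / 2) := by
        rw [integral_const_mul, integral_add h1 h2, integral_exp_inner_stdGaussian,
          integral_exp_inner_stdGaussian, hv]
        norm_num
        ring
    _ ≤ 20 := by
        have h5 : Real.exp (1 / 2) ^ 2 = Real.exp 1 := by rw [← Real.exp_nat_mul]; norm_num
        have h6 := Real.exp_one_lt_d9
        nlinarith [Real.exp_pos (1 / 2)]

lemma charFun_convPow (ν : Measure E) [IsProbabilityMeasure ν] (l : ℕ) (t : E) :
    charFun (convPow ν l) t = charFun ν t ^ l := by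
  induction l with
  | zero => simp [convPow, charFun_dirac]
  | succ l ih => rw [convPow, charFun_conv, ih, pow_succ]

lemma convPow_map_smul_stdGaussian {r : ℝ} {M : ℕ} (h : M * r ^ 2 = 1) :
    convPow ((stdGaussian E).map (r • ·)) M = stdGaussian E := by
  have hp : IsProbabilityMeasure ((stdGaussian E).map (r • ·)) :=
    Measure.isProbabilityMeasure_map (by fun_prop)
  apply Measure.ext_of_charFun
  ext t
  rw [charFun_convPow, charFun_map_smul, charFun_stdGaussian, charFun_stdGaussian,
    ← Complex.exp_nat_mul, norm_smul]
  congr 1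
  push_cast
  have h' : (M : ℂ) * (r : ℂ) ^ 2 = 1 := by exact_mod_cast h
  have h2 : ((‖r‖ : ℝ) : ℂ) ^ 2 = (r : ℂ) ^ 2 := by
    rw [← Complex.ofReal_pow, Real.norm_eq_abs, sq_abs, Complex.ofReal_pow]
  rw [mul_pow, h2]
  linear_combination (-((‖t‖ : ℝ) : ℂ) ^ 2 / 2) * h'

variable {ι : Type*}

/-- The expected maximum of the Gaussian variables `⟪w, c i⟫`. -/
noncomputable def gaussianMax (c : ι → E) : ℝ := ∫ w, ⨆ i, inner ℝ w (c i) ∂stdGaussian E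

/-- The law of one step of a random walk that ends at the Gaussian vector `(β ⟪w, c i⟫)_i`. -/
noncomputable def gaussianStep (c : ι → E) (s : ℝ) : Measure (ι → ℝ) :=
  (stdGaussian E).map fun w i => s * inner ℝ w (c i)

lemma measurable_gaussianStep (c : ι → E) (s : ℝ) :
    Measurable fun (w : E) (i : ι) => s * inner ℝ w (c i) := by fun_prop

instance (c : ι → E) (s : ℝ) : IsProbabilityMeasure (gaussianStep c s) :=
  Measure.isProbabilityMeasure_map (measurable_gaussianStep c s).aemeasurable

/-- By stability the Gaussian vector is exactly the endpoint of a walk with `M` small Gaussian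
steps, so Lindeberg's method applies to it without a limit. -/
lemma convPow_gaussianStep (c : ι → E) {β r : ℝ} {M : ℕ} (h : M * r ^ 2 = 1) :
    convPow (gaussianStep c (β * r)) M = gaussianStep c β := by
  have hp : IsProbabilityMeasure ((stdGaussian E).map (r • ·)) :=
    Measure.isProbabilityMeasure_map (by fun_prop)
  let L : E →+ (ι → ℝ) :=
    { toFun := fun w i => β * inner ℝ w (c i)
      map_zero' := by ext; simp
      map_add' := fun x y => by ext i; simp [inner_add_left, mul_add] }
  have hL : Measurable L := measurable_gaussianStep c β
  have e := map_convPow ((stdGaussian E).map (r • ·)) L hL 0 M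
  rw [convPow_map_smul_stdGaussian h] at e
  simp only [smul_zero, add_zero] at e
  rw [Measure.map_map hL (by fun_prop)] at e
  have : (L ∘ fun w : E => r • w) = fun w i => β * r * inner ℝ w (c i) := by
    ext w i; simp [L, real_inner_smul_left, mul_assoc]
  rw [this] at e
  exact e.symm

lemma integral_gaussianStep (c : ι → E) (s : ℝ) {f : (ι → ℝ) → ℝ} (hf : Measurable f) :
    ∫ u, f u ∂gaussianStep c s = ∫ w, f (fun i => s * inner ℝ w (c i)) ∂stdGaussian E :=
  integral_map (measurable_gaussianStep c s).aemeasurable hf.aestronglyMeasurable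

lemma memLp_eval_gaussianStep (c : ι → E) (s : ℝ) (i : ι) :
    MemLp (fun u => u i) 3 (gaussianStep c s) :=
  (memLp_map_measure_iff (measurable_pi_apply i).aestronglyMeasurable
    (measurable_gaussianStep c s).aemeasurable).2
    ((memLp_inner_stdGaussian (c i) 3 (by simp)).const_mul s)

lemma integral_eval_gaussianStep (c : ι → E) (s : ℝ) (i : ι) :
    ∫ u, u i ∂gaussianStep c s = 0 := by
  rw [integral_gaussianStep c s (f := fun u => u i) (by fun_prop), integral_const_mul,
    integral_inner_stdGaussian, mul_zero]

lemma integral_sq_sub_gaussianStep (c : ι → E) (s : ℝ) (i j : ι) :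
    ∫ u, (u i - u j) ^ 2 ∂gaussianStep c s = s ^ 2 * ‖c i - c j‖ ^ 2 := by
  rw [integral_gaussianStep c s (f := fun u => (u i - u j) ^ 2) (by fun_prop),
    ← integral_inner_sq_stdGaussian, ← integral_const_mul]
  congr 1 with w
  rw [inner_sub_right]; ring

lemma integral_abs_pow_three_gaussianStep_le {c : ι → E} (hc : ∀ i, ‖c i‖ = 1) {s : ℝ}
    (hs : 0 ≤ s) (i : ι) : ∫ u, |u i| ^ 3 ∂gaussianStep c s ≤ 20 * s ^ 3 := by
  rw [integral_gaussianStep c s (f := fun u => |u i| ^ 3) (by fun_prop)]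
  simp only [abs_mul, mul_pow, abs_of_nonneg hs]
  rw [integral_const_mul]
  have := integral_abs_inner_pow_three_le (hc i)
  nlinarith [pow_nonneg hs 3]

variable [Fintype ι]

/-- The law of one step of a random walk with independent coordinates and steps of size `s`. -/
noncomputable def signStep (ι : Type*) [Fintype ι] (s : ℝ) : Measure (ι → ℝ) :=
  (Measure.pi fun _ : ι => coin).map fun J i => s * (2 * (J i : ℝ) - 1)

lemma measurable_signStep (s : ℝ) :
    Measurable fun (J : ι → ℕ) (i : ι) => s * (2 * (J i : ℝ) - 1) :=
  measurable_of_countable _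

instance (s : ℝ) : IsProbabilityMeasure (signStep ι s) :=
  Measure.isProbabilityMeasure_map (measurable_signStep s).aemeasurable

lemma convPow_signStep (s : ℝ) (l : ℕ) :
    convPow (signStep ι s) l
      = (Measure.pi fun _ : ι => convPow coin l).map fun J i => s * (2 * (J i : ℝ) - l) := by
  let L : (ι → ℕ) →+ (ι → ℝ) :=
    { toFun := fun J i => s * (2 * (J i : ℝ))
      map_zero' := by ext; simp
      map_add' := fun x y => by ext i; simp [mul_add] }
  have e := map_convPow (Measure.pi fun _ : ι => coin) L (measurable_of_countable _)
    (fun _ => -s) l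
  rw [convPow_pi] at e
  have h1 : (fun J => L J + l • fun _ : ι => -s) = fun J i => s * (2 * (J i : ℝ) - l) := by
    ext J i; simp [L]; ring
  have h2 : (fun J => L J + fun _ : ι => -s) = fun J i => s * (2 * (J i : ℝ) - 1) := by
    ext J i; simp [L]; ring
  rw [h1, h2] at e
  exact e.symm

lemma integral_signStep (s : ℝ) {f : (ι → ℝ) → ℝ} (hf : Measurable f) :
    ∫ u, f u ∂signStep ι s
      = ∫ J, f (fun i => s * (2 * (J i : ℝ) - 1)) ∂(Measure.pi fun _ : ι => coin) :=
  integral_map (measurable_signStep s).aemeasurable hf.aestronglyMeasurable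

lemma integral_comp_eval_coin (f : ℕ → ℝ) (i : ι) :
    ∫ J, f (J i) ∂(Measure.pi fun _ : ι => coin) = (f 0 + f 1) / 2 := by
  rw [← integral_coin]
  have h := (measurePreserving_eval (fun _ : ι => coin) i).map_eq
  conv_rhs => rw [← h]
  rw [integral_map (measurable_pi_apply i).aemeasurable
    (measurable_of_countable f).aestronglyMeasurable]

lemma coin_le_one : ∀ᵐ x ∂coin, x ≤ 1 := by
  rw [coin, ae_add_measure_iff]
  exact ⟨Measure.ae_smul_measure (by simp) _, Measure.ae_smul_measure (by simp) _⟩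

lemma signStep_abs_le (s : ℝ) : ∀ᵐ u ∂signStep ι s, ∀ i, |u i| ≤ |s| := by
  have hm : MeasurableSet {u : ι → ℝ | ∀ i, |u i| ≤ |s|} := by
    simp only [Set.ofPred_forall]
    exact .iInter fun i => measurableSet_le (by fun_prop) (by fun_prop)
  rw [signStep, ae_map_iff (measurable_signStep s).aemeasurable hm, ae_all_iff]
  intro i
  filter_upwards [(measurePreserving_eval (fun _ : ι => coin) i).quasiMeasurePreserving.ae
    coin_le_one] with J hJ
  have h : |2 * (J i : ℝ) - 1| ≤ 1 := by
    have h1 : (J i : ℝ) ≤ 1 := by exact_mod_cast hJ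
    rw [abs_le]; constructor <;> linarith [Nat.cast_nonneg (α := ℝ) (J i)]
  rw [abs_mul]
  exact mul_le_of_le_one_right (abs_nonneg s) h

lemma memLp_eval_signStep (s : ℝ) (i : ι) (p : ENNReal) :
    MemLp (fun u => u i) p (signStep ι s) :=
  MemLp.of_bound (measurable_pi_apply i).aestronglyMeasurable |s|
    ((signStep_abs_le s).mono fun _ hu => hu i)

lemma integral_eval_signStep (s : ℝ) (i : ι) : ∫ u, u i ∂signStep ι s = 0 := by
  rw [integral_signStep s (f := fun u => u i) (by fun_prop),
    integral_comp_eval_coin (fun x => s * (2 * (x : ℝ) - 1))]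
  simp; ring

lemma integral_abs_pow_three_signStep_le {s : ℝ} (hs : 0 ≤ s) (i : ι) :
    ∫ u, |u i| ^ 3 ∂signStep ι s ≤ s ^ 3 := by
  rw [integral_signStep s (f := fun u => |u i| ^ 3) (by fun_prop),
    integral_comp_eval_coin (fun x => |s * (2 * (x : ℝ) - 1)| ^ 3)]
  simp [abs_mul, abs_of_nonneg hs]
  norm_num

/-- Squared signs are constant and the cross term vanishes by independence. The value is the one
that orthonormal Gaussian directions of the same scale would give. -/
lemma integral_sq_sub_signStep (s : ℝ) {i j : ι} (hij : i ≠ j) :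
    ∫ u, (u i - u j) ^ 2 ∂signStep ι s = 2 * s ^ 2 := by
  rw [integral_signStep s (f := fun u => (u i - u j) ^ 2) (by fun_prop)]
  let g : ℕ → ℝ := fun x => s * (2 * (x : ℝ) - 1)
  let μ : Measure (ι → ℕ) := Measure.pi fun _ => coin
  have hg : Measurable g := measurable_of_countable _
  have hind := (iIndepFun_pi (μ := fun _ : ι => coin) (X := fun _ => g)
    (fun _ => hg.aemeasurable)).indepFun hij
  have hmul : ∫ J, g (J i) * g (J j) ∂μ = (∫ J, g (J i) ∂μ) * ∫ J, g (J j) ∂μ :=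
    hind.integral_fun_mul_eq_mul_integral (measurable_of_countable _).aestronglyMeasurable
      (measurable_of_countable _).aestronglyMeasurable
  have hb : ∀ᵐ J ∂μ, ∀ i, J i ≤ 1 := ae_all_iff.2 fun i =>
    (measurePreserving_eval (fun _ : ι => coin) i).quasiMeasurePreserving.ae coin_le_one
  have hsq : ∀ᵐ J ∂μ, (g (J i) - g (J j)) ^ 2 = 2 * s ^ 2 - 2 * (g (J i) * g (J j)) := by
    filter_upwards [hb] with J hJ
    have h1 : ∀ i, g (J i) ^ 2 = s ^ 2 := fun i => by
      rcases Nat.le_one_iff_eq_zero_or_eq_one.1 (hJ i) with h | h <;> (simp [g, h]; try ring)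
    nlinarith [h1 i, h1 j]
  have hz : ∀ i : ι, ∫ J, g (J i) ∂μ = 0 := fun i => by
    rw [integral_comp_eval_coin g i]; simp [g]; ring
  have hi : Integrable (fun J : ι → ℕ => g (J i) * g (J j)) μ := by
    refine Integrable.of_bound (measurable_of_countable _).aestronglyMeasurable (|s| * |s|) ?_
    filter_upwards [hb] with J hJ
    have h1 : ∀ i, |g (J i)| = |s| := fun i => by
      rcases Nat.le_one_iff_eq_zero_or_eq_one.1 (hJ i) with h | h <;> (simp [g, h]; try norm_num)
    rw [Real.norm_eq_abs, abs_mul, h1, h1]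
  calc ∫ J, (g (J i) - g (J j)) ^ 2 ∂μ = ∫ J, (2 * s ^ 2 - 2 * (g (J i) * g (J j))) ∂μ :=
        integral_congr_ae hsq
    _ = 2 * s ^ 2 := by
        rw [integral_sub (integrable_const _) (hi.const_mul 2), integral_const, integral_const_mul,
          hmul, hz, hz]
        simp

end GaussianMax

/-! ### Gaussian maxima against binomial maxima -/

section Comparison

variable {E : Type*} [NormedAddCommGroup E] [InnerProductSpace ℝ E] [FiniteDimensional ℝ E]
  [MeasurableSpace E] [BorelSpace E] {ι : Type*} [Fintype ι]

/-- The walk almost surely takes finitely many values, so any function of it is almost surely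
bounded. -/
lemma integrable_pi_convPow_coin (f : (ι → ℕ) → ℝ) (l : ℕ) :
    Integrable f (Measure.pi fun _ : ι => convPow coin l) := by
  classical
  have hle : ∀ᵐ J ∂(Measure.pi fun _ : ι => convPow coin l), ∀ i, J i ≤ l :=
    ae_all_iff.2 fun i =>
      (measurePreserving_eval (fun _ : ι => convPow coin l) i).quasiMeasurePreserving.ae
        (convPow_coin_le l)
  have hfin : (Set.Iic fun _ : ι => l).Finite := Set.finite_Iic _
  obtain ⟨C, hC⟩ := (hfin.image fun J => ‖f J‖).bddAbove
  refine Integrable.of_bound (measurable_of_countable _).aestronglyMeasurable C ?_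
  filter_upwards [hle] with J hJ
  exact hC ⟨J, hJ, rfl⟩

lemma measurable_ciSup_inner (c : ι → E) : Measurable fun w : E => ⨆ i, inner ℝ w (c i) :=
  .iSup fun i => by fun_prop

lemma abs_ciSup_le_sum [Nonempty ι] (x : ι → ℝ) : |⨆ i, x i| ≤ ∑ i, |x i| := by
  have hs : ∀ i, |x i| ≤ ∑ j, |x j| := fun i =>
    Finset.single_le_sum (f := fun i => |x i|) (fun _ _ => abs_nonneg _) (Finset.mem_univ i)
  rw [abs_le]
  constructor
  · obtain ⟨i⟩ := ‹Nonempty ι›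
    have := le_ciSup (Finite.bddAbove_range x) i
    linarith [neg_abs_le (x i), hs i]
  · exact ciSup_le fun i => (le_abs_self _).trans (hs i)

variable {R : ℕ} {β σ : ℝ}

lemma integral_logSumExp_signStep (s : ℝ) (l : ℕ) :
    ∫ u, logSumExp u ∂convPow (signStep ι s) l
      = ∫ J, logSumExp (fun i => s * (2 * (J i : ℝ) - l))
        ∂(Measure.pi fun _ : ι => convPow coin l) := by
  rw [convPow_signStep, integral_map (measurable_of_countable _).aemeasurable
    measurable_logSumExp.aestronglyMeasurable]

lemma signStep_ciSup {κ : Type*} (hσ : 0 ≤ σ) (hβ : 0 ≤ β) (J : κ → ℕ) :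
    ⨆ i, σ * (β * (R : ℝ)⁻¹) * (2 * (J i : ℝ) - (R ^ 2 : ℕ))
      = σ * β * ⨆ i, (2 * (J i : ℝ) - (R : ℝ) ^ 2) / R := by
  rw [Real.mul_iSup_of_nonneg (mul_nonneg hσ hβ)]
  congr 1 with i
  push_cast
  ring

/-- There are `R ^ 2` steps and each costs order `(β / R) ^ 3`, so the total error decays like `1 /
R`. -/
lemma lindeberg_error (hR : 0 < R) (k : ℝ) (β : ℝ) :
    ((R ^ 2 : ℕ) : ℝ) * (80 * (k * (20 * (β * (R : ℝ)⁻¹) ^ 3))) = β * (1600 * k * β ^ 2 / R) := by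
  have : (R : ℝ) ≠ 0 := by exact_mod_cast hR.ne'
  push_cast
  field_simp
  ring

lemma integral_logSumExp_gaussianStep (c : ι → E) (hR : 0 < R) :
    ∫ u, logSumExp u ∂convPow (gaussianStep c (β * (R : ℝ)⁻¹)) (R ^ 2)
      = ∫ w, logSumExp (fun i => β * inner ℝ w (c i)) ∂stdGaussian E := by
  have : (R : ℝ) ≠ 0 := by exact_mod_cast hR.ne'
  rw [convPow_gaussianStep c (by push_cast; field_simp),
    integral_gaussianStep c β measurable_logSumExp]

/-- The restriction `σ ≤ 2` gives `σ ^ 3 ≤ 8 ≤ 20`, so the Gaussian third-moment bound serves both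
walks. -/
lemma signStep_pow_three_le (hσ : 0 ≤ σ) (hσ2 : σ ≤ 2) (hβ : 0 < β) (hR : 0 < R) (i : ι) :
    ∫ u, |u i| ^ 3 ∂signStep ι (σ * (β * (R : ℝ)⁻¹)) ≤ 20 * (β * (R : ℝ)⁻¹) ^ 3 := by
  have hs : 0 ≤ β * (R : ℝ)⁻¹ := by positivity
  refine (integral_abs_pow_three_signStep_le (by positivity) i).trans ?_
  rw [mul_pow]
  have : σ ^ 3 ≤ 2 ^ 3 := pow_le_pow_left₀ hσ hσ2 3
  nlinarith [pow_nonneg hs 3]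

variable [Nonempty ι]

lemma integrable_ciSup_inner (c : ι → E) :
    Integrable (fun w => ⨆ i, inner ℝ w (c i)) (stdGaussian E) :=
  (integrable_finsetSum Finset.univ fun i _ => (integrable_inner_stdGaussian (c i)).abs).mono'
    (measurable_ciSup_inner c).aestronglyMeasurable (ae_of_all _ fun _ => abs_ciSup_le_sum _)

lemma integrable_logSumExp_inner (c : ι → E) (β : ℝ) :
    Integrable (fun w => logSumExp fun i => β * inner ℝ w (c i)) (stdGaussian E) := by
  refine Integrable.mono' (g := fun w => ∑ i, |β * inner ℝ w (c i)| + Real.log (Fintype.card ι))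
    ?_ (measurable_logSumExp.comp (measurable_gaussianStep c β)).aestronglyMeasurable
    (ae_of_all _ fun _ => abs_logSumExp_le _)
  exact (integrable_finsetSum _ fun i _ =>
    ((integrable_inner_stdGaussian (c i)).const_mul β).abs).add (integrable_const _)

lemma mul_gaussianMax_le (c : ι → E) {β : ℝ} (hβ : 0 ≤ β) :
    β * gaussianMax c ≤ ∫ w, logSumExp (fun i => β * inner ℝ w (c i)) ∂stdGaussian E := by
  rw [gaussianMax, ← integral_const_mul]
  refine integral_mono ((integrable_ciSup_inner c).const_mul β) (integrable_logSumExp_inner c β)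
    fun w => ?_
  simp only [Real.mul_iSup_of_nonneg hβ]
  exact ciSup_le_logSumExp _

lemma integral_logSumExp_inner_le (c : ι → E) {β : ℝ} (hβ : 0 ≤ β) :
    ∫ w, logSumExp (fun i => β * inner ℝ w (c i)) ∂stdGaussian E
      ≤ β * gaussianMax c + Real.log (Fintype.card ι) := by
  have h := (integrable_ciSup_inner c).const_mul β
  calc _ ≤ ∫ w, (β * (⨆ i, inner ℝ w (c i)) + Real.log (Fintype.card ι)) ∂stdGaussian E := by
        refine integral_mono (integrable_logSumExp_inner c β) (h.add (integrable_const _))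
          fun w => ?_
        simp only [Real.mul_iSup_of_nonneg hβ]
        exact logSumExp_le_ciSup _
    _ = _ := by rw [integral_add h (integrable_const _), integral_const_mul]; simp [gaussianMax]

lemma mul_binomMax_le (hσ : 0 ≤ σ) (hβ : 0 ≤ β) (hR : 0 < R) :
    σ * β * binomMax R (Fintype.card ι)
      ≤ ∫ u, logSumExp u ∂convPow (signStep ι (σ * (β * (R : ℝ)⁻¹))) (R ^ 2) := by
  rw [integral_logSumExp_signStep, ← integral_ciSup_convPow_coin hR, ← integral_const_mul]
  refine integral_mono (integrable_pi_convPow_coin _ _) (integrable_pi_convPow_coin _ _)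
    fun J => ?_
  simp only [← signStep_ciSup hσ hβ J]
  exact ciSup_le_logSumExp _

lemma integral_logSumExp_signStep_le (hσ : 0 ≤ σ) (hβ : 0 ≤ β) (hR : 0 < R) :
    ∫ u, logSumExp u ∂convPow (signStep ι (σ * (β * (R : ℝ)⁻¹))) (R ^ 2)
      ≤ σ * β * binomMax R (Fintype.card ι) + Real.log (Fintype.card ι) := by
  rw [integral_logSumExp_signStep, ← integral_ciSup_convPow_coin hR, ← integral_const_mul]
  calc _ ≤ ∫ J, (σ * β * (⨆ i, (2 * (J i : ℝ) - (R : ℝ) ^ 2) / R)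
        + Real.log (Fintype.card ι)) ∂(Measure.pi fun _ : ι => convPow coin (R ^ 2)) := by
        refine integral_mono (integrable_pi_convPow_coin _ _) (integrable_pi_convPow_coin _ _)
          fun J => ?_
        simp only [← signStep_ciSup hσ hβ J]
        exact logSumExp_le_ciSup _
    _ = _ := by
        rw [integral_add (integrable_pi_convPow_coin _ _) (integrable_const _)]
        simp

variable {c : ι → E}

/-- The scale `σ` makes the sign walk's differences dominate those of the Gaussian walk. The two
errors come from smoothing the maximum at inverse temperature `β` and from the third moments; `β` is
later chosen to balance them. -/
lemma gaussianMax_le_mul_binomMax (hc : ∀ i, ‖c i‖ = 1) (hσ : 0 ≤ σ) (hσ2 : σ ≤ 2) (hβ : 0 < β)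
    (hR : 0 < R) (h : ∀ i j, i ≠ j → ‖c i - c j‖ ^ 2 ≤ 2 * σ ^ 2) :
    gaussianMax c ≤ σ * binomMax R (Fintype.card ι)
      + (Real.log (Fintype.card ι) / β + 1600 * Fintype.card ι * β ^ 2 / R) := by
  have hs : 0 ≤ β * (R : ℝ)⁻¹ := by positivity
  have key := integral_logSumExp_convPow_le_of_variance_le
    (ν := gaussianStep c (β * (R : ℝ)⁻¹)) (ν' := signStep ι (σ * (β * (R : ℝ)⁻¹)))
    (κ := 20 * (β * (R : ℝ)⁻¹) ^ 3) (memLp_eval_gaussianStep c _)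
    (fun i => memLp_eval_signStep _ i 3) (integral_eval_gaussianStep c _)
    (integral_eval_signStep _) (integral_abs_pow_three_gaussianStep_le hc hs)
    (signStep_pow_three_le hσ hσ2 hβ hR) (fun i j => ?_) (R ^ 2)
  · rw [integral_logSumExp_gaussianStep c hR, lindeberg_error hR] at key
    have h1 := mul_gaussianMax_le c hβ.le
    have h2 := integral_logSumExp_signStep_le (ι := ι) hσ hβ.le hR
    refine le_of_mul_le_mul_left ?_ hβ
    have e : β * (σ * binomMax R (Fintype.card ι) + (Real.log (Fintype.card ι) / β
        + 1600 * Fintype.card ι * β ^ 2 / R)) = σ * β * binomMax R (Fintype.card ι)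
        + Real.log (Fintype.card ι) + β * (1600 * Fintype.card ι * β ^ 2 / R) := by
      field_simp
      ring
    rw [e]
    linarith
  · rcases eq_or_ne i j with rfl | hij
    · simp
    · rw [integral_sq_sub_gaussianStep, integral_sq_sub_signStep _ hij]
      have := h i j hij
      nlinarith [sq_nonneg (β * (R : ℝ)⁻¹)]

lemma mul_binomMax_le_gaussianMax (hc : ∀ i, ‖c i‖ = 1) (hσ : 0 ≤ σ) (hσ2 : σ ≤ 2) (hβ : 0 < β)
    (hR : 0 < R) (h : ∀ i j, i ≠ j → 2 * σ ^ 2 ≤ ‖c i - c j‖ ^ 2) :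
    σ * binomMax R (Fintype.card ι) ≤ gaussianMax c
      + (Real.log (Fintype.card ι) / β + 1600 * Fintype.card ι * β ^ 2 / R) := by
  have hs : 0 ≤ β * (R : ℝ)⁻¹ := by positivity
  have key := integral_logSumExp_convPow_le_of_variance_le
    (ν := signStep ι (σ * (β * (R : ℝ)⁻¹))) (ν' := gaussianStep c (β * (R : ℝ)⁻¹))
    (κ := 20 * (β * (R : ℝ)⁻¹) ^ 3) (fun i => memLp_eval_signStep _ i 3)
    (memLp_eval_gaussianStep c _) (integral_eval_signStep _) (integral_eval_gaussianStep c _)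
    (signStep_pow_three_le hσ hσ2 hβ hR) (integral_abs_pow_three_gaussianStep_le hc hs)
    (fun i j => ?_) (R ^ 2)
  · rw [integral_logSumExp_gaussianStep c hR, lindeberg_error hR] at key
    have h1 := integral_logSumExp_inner_le c hβ.le
    have h2 := mul_binomMax_le (ι := ι) hσ hβ.le hR
    refine le_of_mul_le_mul_left ?_ hβ
    have e : β * (gaussianMax c + (Real.log (Fintype.card ι) / β
        + 1600 * Fintype.card ι * β ^ 2 / R)) = β * gaussianMax c
        + Real.log (Fintype.card ι) + β * (1600 * Fintype.card ι * β ^ 2 / R) := by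
      field_simp
      ring
    rw [e]
    linarith
  · rcases eq_or_ne i j with rfl | hij
    · simp
    · rw [integral_sq_sub_gaussianStep, integral_sq_sub_signStep _ hij]
      have := h i j hij
      nlinarith [sq_nonneg (β * (R : ℝ)⁻¹)]

/-- The expected maximum modulus of at most `n` Gaussian variables of variance at most `σ²`. -/
lemma integral_ciSup_abs_inner_le {n : ℕ} (hn : 2 ≤ n) (hcard : Fintype.card ι ≤ n) {v : ι → E}
    {σ : ℝ} (hσ : 0 < σ) (hv : ∀ i, ‖v i‖ ≤ σ) :
    Integrable (fun w => ⨆ i, |inner ℝ w (v i)|) (stdGaussian E) ∧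
    ∫ w, ⨆ i, |inner ℝ w (v i)| ∂stdGaussian E ≤ 2 * σ * √(Real.log n) := by
  have hn' : (2 : ℝ) ≤ n := by exact_mod_cast hn
  have hlog : 0 < Real.log n := Real.log_pos (by linarith)
  set q := √(Real.log n) with hq
  have hq0 : 0 < q := Real.sqrt_pos.2 hlog
  have hq2 : q ^ 2 = Real.log n := Real.sq_sqrt hlog.le
  -- This choice of exponent gives `ln A ≤ 2 q ^ 2 + 2 q ^ 2`, so that `ln A / t ≤ 2 σ q`.
  set t := 2 * q / σ with ht
  have ht0 : 0 < t := by positivity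
  set A := 2 * (n : ℝ) * Real.exp (σ ^ 2 * t ^ 2 / 2) with hA
  have hA0 : 0 < A := by positivity
  have hint : Integrable (fun w => ⨆ i, |inner ℝ w (v i)|) (stdGaussian E) := by
    refine (integrable_finsetSum Finset.univ fun i _ =>
      (integrable_inner_stdGaussian (v i)).abs).mono'
      (Measurable.iSup fun i => by fun_prop).aestronglyMeasurable (ae_of_all _ fun w => ?_)
    simpa using abs_ciSup_le_sum fun i => |inner ℝ w (v i)|
  refine ⟨hint, ?_⟩
  have hZi : ∀ i, Integrable (fun w => Real.exp (t * inner ℝ w (v i))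
      + Real.exp (-t * inner ℝ w (v i))) (stdGaussian E) := fun i =>
    (integrable_exp_inner_stdGaussian (v i) t).add (integrable_exp_inner_stdGaussian (v i) (-t))
  have hZ := integrable_finsetSum Finset.univ fun i _ => hZi i
  have hZint : ∫ w, ∑ i, (Real.exp (t * inner ℝ w (v i)) + Real.exp (-t * inner ℝ w (v i)))
      ∂stdGaussian E ≤ A := by
    rw [integral_finsetSum _ fun i _ => hZi i]
    calc _ ≤ ∑ _i : ι, 2 * Real.exp (σ ^ 2 * t ^ 2 / 2) := by
          refine Finset.sum_le_sum fun i _ => ?_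
          rw [integral_add (integrable_exp_inner_stdGaussian (v i) t)
            (integrable_exp_inner_stdGaussian (v i) (-t)), integral_exp_inner_stdGaussian,
            integral_exp_inner_stdGaussian, neg_sq, two_mul]
          have : ‖v i‖ ^ 2 * t ^ 2 / 2 ≤ σ ^ 2 * t ^ 2 / 2 := by
            gcongr; exact hv i
          linarith [Real.exp_le_exp.2 this]
      _ = 2 * (Fintype.card ι : ℝ) * Real.exp (σ ^ 2 * t ^ 2 / 2) := by simp; ring
      _ ≤ A := by
          rw [hA]; gcongr
  -- The tangent of the logarithm at `A`, `ln z ≤ z / A - 1 + ln A`, used pointwise in place of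
  -- Jensen's inequality.
  have hpt : ∀ w, t * ⨆ i, |inner ℝ w (v i)| ≤
      (∑ i, (Real.exp (t * inner ℝ w (v i)) + Real.exp (-t * inner ℝ w (v i)))) / A
        - 1 + Real.log A := by
    intro w
    rw [Real.mul_iSup_of_nonneg ht0.le]
    refine ciSup_le fun i => ?_
    have h1 : Real.exp (t * |inner ℝ w (v i)|) ≤
        ∑ i, (Real.exp (t * inner ℝ w (v i)) + Real.exp (-t * inner ℝ w (v i))) := by
      refine le_trans ?_ (Finset.single_le_sum
        (f := fun i => Real.exp (t * inner ℝ w (v i)) + Real.exp (-t * inner ℝ w (v i)))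
        (fun _ _ => by positivity) (Finset.mem_univ i))
      rcases abs_cases (inner ℝ w (v i)) with ⟨h, _⟩ | ⟨h, _⟩ <;> rw [h]
      · linarith [Real.exp_pos (-t * inner ℝ w (v i))]
      · rw [mul_neg, neg_mul]
        linarith [Real.exp_pos (t * inner ℝ w (v i))]
    have h2 := Real.add_one_le_exp (t * |inner ℝ w (v i)| - Real.log A)
    rw [Real.exp_sub, Real.exp_log hA0] at h2
    have h3 := div_le_div_of_nonneg_right h1 hA0.le
    linarith
  have hmain : t * ∫ w, ⨆ i, |inner ℝ w (v i)| ∂stdGaussian E ≤ Real.log A := by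
    rw [← integral_const_mul]
    calc _ ≤ ∫ w, ((∑ i, (Real.exp (t * inner ℝ w (v i)) + Real.exp (-t * inner ℝ w (v i)))) / A
          + (Real.log A - 1)) ∂stdGaussian E := by
          refine integral_mono (hint.const_mul t) ((hZ.div_const A).add (integrable_const _))
            fun w => ?_
          have := hpt w
          simp only
          linarith
      _ ≤ Real.log A := by
          rw [integral_add (hZ.div_const A) (integrable_const _), integral_div]
          have : (∫ w, ∑ i, (Real.exp (t * inner ℝ w (v i)) + Real.exp (-t * inner ℝ w (v i)))
            ∂stdGaussian E) / A ≤ 1 := (div_le_one hA0).2 hZint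
          rw [integral_const]
          simp only [probReal_univ, one_smul]
          linarith
  have hlogA : Real.log A ≤ 4 * q ^ 2 := by
    have h2 : Real.log 2 ≤ Real.log n := Real.log_le_log (by norm_num) hn'
    rw [hA, Real.log_mul (by positivity) (by positivity), Real.log_mul (by norm_num) (by positivity),
      Real.log_exp, ht, hq2]
    have : σ ^ 2 * (2 * q / σ) ^ 2 / 2 = 2 * q ^ 2 := by field_simp
    rw [this, hq2]
    linarith
  have : 4 * q ^ 2 = t * (2 * σ * q) := by rw [ht]; field_simp; norm_num
  exact le_of_mul_le_mul_left (by linarith) ht0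

end Comparison

/-! ### Gaussian concentration by rotation -/

section Concentration

/-- The uniform distribution on the angles between `0` and `π / 2`. -/
noncomputable def angleMeasure : Measure ℝ :=
  ENNReal.ofReal (2 / Real.pi) • volume.restrict (Set.Ioc 0 (Real.pi / 2))

instance : IsProbabilityMeasure angleMeasure := ⟨by
  rw [angleMeasure, Measure.smul_apply, Measure.restrict_apply_univ, Real.volume_Ioc, smul_eq_mul,
    ← ENNReal.ofReal_mul (by positivity), sub_zero]
  have : 2 / Real.pi * (Real.pi / 2) = 1 := by field_simp
  simp [this]⟩

lemma integral_angleMeasure (f : ℝ → ℝ) :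
    ∫ θ, f θ ∂angleMeasure = 2 / Real.pi * ∫ θ in (0)..(Real.pi / 2), f θ := by
  rw [angleMeasure, integral_smul_measure, ENNReal.toReal_ofReal (by positivity),
    intervalIntegral.integral_of_le (by positivity), smul_eq_mul]

lemma integrable_angleMeasure {f : ℝ → ℝ} (hf : Continuous f) : Integrable f angleMeasure :=
  ((hf.integrableOn_Icc (a := 0) (b := Real.pi / 2)).mono_set
    Set.Ioc_subset_Icc_self).smul_measure (by simp)

/-- The quarter circle `cos θ • x + sin θ • y` joins `x` to `y`, and point and velocity together
form the rotated pair. The increment is thus `π / 2` times an average of derivatives over the angle,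
and Jensen moves the exponential inside. -/
lemma exp_sub_le_integral {V : Type*} [NormedAddCommGroup V] [NormedSpace ℝ V] {F : V → ℝ}
    (hF : ContDiff ℝ 1 F) (t : ℝ) (z : V × V) :
    Real.exp (t * (F z.2 - F z.1)) ≤ ∫ θ, Real.exp (t * (Real.pi / 2)
      * fderiv ℝ F (ContinuousLinearMap.rotation θ z).1 (ContinuousLinearMap.rotation θ z).2)
        ∂angleMeasure := by
  simp only [ContinuousLinearMap.rotation_apply]
  set g : ℝ → ℝ := fun θ => fderiv ℝ F (Real.cos θ • z.1 + Real.sin θ • z.2)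
    (-Real.sin θ • z.1 + Real.cos θ • z.2) with hg
  have hgc : Continuous g :=
    ((hF.continuous_fderiv (by norm_num)).comp (by fun_prop)).clm_apply (by fun_prop)
  have hd : ∀ θ : ℝ, HasDerivAt (fun θ => F (Real.cos θ • z.1 + Real.sin θ • z.2)) (g θ) θ := by
    intro θ
    exact ((hF.differentiable (by norm_num)) _).hasFDerivAt.comp_hasDerivAt θ
      (((Real.hasDerivAt_cos θ).smul_const z.1).add ((Real.hasDerivAt_sin θ).smul_const z.2))
  have hint : F z.2 - F z.1 = ∫ θ in (0)..(Real.pi / 2), g θ := by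
    rw [intervalIntegral.integral_eq_sub_of_hasDerivAt (fun θ _ => hd θ)
      (hgc.intervalIntegrable _ _)]
    simp
  have hm : t * (F z.2 - F z.1) = ∫ θ, t * (Real.pi / 2) * g θ ∂angleMeasure := by
    rw [integral_const_mul, integral_angleMeasure, hint]
    field_simp
  rw [hm]
  exact convexOn_exp.map_integral_le Real.continuous_exp.continuousOn isClosed_univ (by simp)
    (integrable_angleMeasure (by fun_prop)) (integrable_angleMeasure (by fun_prop))

variable {E : Type*} [NormedAddCommGroup E] [InnerProductSpace ℝ E] [FiniteDimensional ℝ E]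
  [MeasurableSpace E] [BorelSpace E]

variable {F : E → ℝ}

/-- For a fixed base point, the derivative in an independent Gaussian direction is a centred
Gaussian whose variance is the squared gradient norm. -/
lemma lintegral_exp_fderiv_le (hF : ContDiff ℝ 1 F) (hL : ∀ x, ‖fderiv ℝ F x‖ ≤ 1) (t : ℝ) :
    ∫⁻ z, ENNReal.ofReal (Real.exp (t * fderiv ℝ F z.1 z.2))
      ∂((stdGaussian E).prod (stdGaussian E)) ≤ ENNReal.ofReal (Real.exp (t ^ 2 / 2)) := by
  have hc : Continuous fun z : E × E => fderiv ℝ F z.1 z.2 :=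
    ((hF.continuous_fderiv (by norm_num)).comp continuous_fst).clm_apply continuous_snd
  rw [lintegral_prod _ (by fun_prop)]
  calc _ ≤ ∫⁻ _x : E, ENNReal.ofReal (Real.exp (t ^ 2 / 2)) ∂stdGaussian E := by
        refine lintegral_mono fun x => ?_
        set v := (InnerProductSpace.toDual ℝ E).symm (fderiv ℝ F x) with hv
        have hvn : ‖v‖ ≤ 1 := by rw [hv, LinearIsometryEquiv.norm_map]; exact hL x
        have e : ∀ y, fderiv ℝ F x y = inner ℝ y v := fun y => by
          rw [real_inner_comm, hv, InnerProductSpace.toDual_symm_apply]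
        simp only [e]
        rw [← ofReal_integral_eq_lintegral_ofReal (integrable_exp_inner_stdGaussian v t)
          (ae_of_all _ fun _ => (Real.exp_pos _).le), integral_exp_inner_stdGaussian]
        refine ENNReal.ofReal_le_ofReal (Real.exp_le_exp.2 ?_)
        have : ‖v‖ ^ 2 ≤ 1 := pow_le_one₀ (norm_nonneg _) hvn
        nlinarith [sq_nonneg t]
    _ = _ := by simp

/-- The symmetrized form of Gaussian concentration (Maurey–Pisier). -/
lemma lintegral_exp_sub_le (hF : ContDiff ℝ 1 F) (hL : ∀ x, ‖fderiv ℝ F x‖ ≤ 1) (t : ℝ) :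
    ∫⁻ z, ENNReal.ofReal (Real.exp (t * (F z.2 - F z.1)))
      ∂((stdGaussian E).prod (stdGaussian E)) ≤ ENNReal.ofReal (Real.exp (5 / 4 * t ^ 2)) := by
  have hc : Continuous fun z : E × E => fderiv ℝ F z.1 z.2 :=
    ((hF.continuous_fderiv (by norm_num)).comp continuous_fst).clm_apply continuous_snd
  have hr : Continuous fun q : (E × E) × ℝ => ContinuousLinearMap.rotation q.2 q.1 := by
    simp only [ContinuousLinearMap.rotation_apply]
    fun_prop
  set G : E × E → ENNReal := fun z =>
    ENNReal.ofReal (Real.exp (t * (Real.pi / 2) * fderiv ℝ F z.1 z.2)) with hG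
  have hrot : ∀ z : E × E, Continuous fun θ : ℝ => ContinuousLinearMap.rotation θ z := fun z => by
    simp only [ContinuousLinearMap.rotation_apply]
    fun_prop
  have hGm : Measurable G := by fun_prop
  have hGr : Measurable (Function.uncurry fun (z : E × E) (θ : ℝ) =>
      G (ContinuousLinearMap.rotation θ z)) := by
    have h : Continuous fun q : (E × E) × ℝ => Real.exp (t * (Real.pi / 2)
        * fderiv ℝ F (ContinuousLinearMap.rotation q.2 q.1).1
          (ContinuousLinearMap.rotation q.2 q.1).2) :=
      Real.continuous_exp.comp (continuous_const.mul (hc.comp hr))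
    exact h.measurable.ennreal_ofReal
  calc _ ≤ ∫⁻ z, ∫⁻ θ, G (ContinuousLinearMap.rotation θ z) ∂angleMeasure
        ∂((stdGaussian E).prod (stdGaussian E)) := by
        refine lintegral_mono fun z => ?_
        simp only [hG]
        have h1 : Continuous fun θ : ℝ => Real.exp (t * (Real.pi / 2)
            * fderiv ℝ F (ContinuousLinearMap.rotation θ z).1
              (ContinuousLinearMap.rotation θ z).2) :=
          Real.continuous_exp.comp (continuous_const.mul (hc.comp (hrot z)))
        rw [← ofReal_integral_eq_lintegral_ofReal (integrable_angleMeasure h1)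
          (ae_of_all _ fun _ => (Real.exp_pos _).le)]
        exact ENNReal.ofReal_le_ofReal (exp_sub_le_integral hF t z)
    _ = ∫⁻ θ, ∫⁻ z, G (ContinuousLinearMap.rotation θ z)
        ∂((stdGaussian E).prod (stdGaussian E)) ∂angleMeasure :=
        lintegral_lintegral_swap hGr.aemeasurable
    -- A pair of independent standard Gaussian vectors is invariant under rotation, so point and
    -- velocity are again independent at each angle.
    _ = ∫⁻ _θ : ℝ, ∫⁻ z, G z ∂((stdGaussian E).prod (stdGaussian E)) ∂angleMeasure := by
        refine lintegral_congr fun θ => ?_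
        rw [← lintegral_map hGm (ContinuousLinearMap.continuous _).measurable,
          IsGaussian.map_rotation_eq_self (by simp)]
    _ ≤ ∫⁻ _θ : ℝ, ENNReal.ofReal (Real.exp ((t * (Real.pi / 2)) ^ 2 / 2)) ∂angleMeasure :=
        lintegral_mono fun _ => lintegral_exp_fderiv_le hF hL _
    _ ≤ _ := by
        rw [lintegral_const, measure_univ, mul_one]
        refine ENNReal.ofReal_le_ofReal (Real.exp_le_exp.2 ?_)
        -- Turns the exponent `π ^ 2 t ^ 2 / 8` into `5 / 4 * t ^ 2`, hence the sub-Gaussian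
        -- parameter `5 / 2`.
        have : Real.pi ^ 2 ≤ 10 := by nlinarith [Real.pi_lt_d2, Real.pi_pos]
        nlinarith [sq_nonneg t]

/-- **Gaussian concentration**: a smooth `1`-Lipschitz function of a standard Gaussian vector is
sub-Gaussian, with a parameter that does not depend on the dimension. -/
lemma hasSubgaussianMGF_stdGaussian (hF : ContDiff ℝ 1 F) (hL : ∀ x, ‖fderiv ℝ F x‖ ≤ 1) :
    HasSubgaussianMGF (fun w => F w - ∫ w', F w' ∂stdGaussian E) (5 / 2) (stdGaussian E) := by
  have hFc := hF.continuous
  have hint2 : ∀ t : ℝ, Integrable (fun z : E × E => Real.exp (t * (F z.2 - F z.1)))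
      ((stdGaussian E).prod (stdGaussian E)) := by
    intro t
    refine ⟨by fun_prop, ?_⟩
    rw [hasFiniteIntegral_iff_ofReal (ae_of_all _ fun _ => (Real.exp_pos _).le)]
    exact (lintegral_exp_sub_le hF hL t).trans_lt ENNReal.ofReal_lt_top
  have hint : ∀ t : ℝ, Integrable (fun w => Real.exp (t * F w)) (stdGaussian E) := by
    intro t
    -- Freezing one vector of the symmetrized pair yields exponential integrability of `F` itself.
    obtain ⟨x, hx⟩ := (hint2 t).prod_right_ae.exists
    have := hx.mul_const (Real.exp (t * F x))
    refine this.congr (ae_of_all _ fun w => ?_)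
    simp only
    rw [← Real.exp_add]
    ring_nf
  have hFint : Integrable F (stdGaussian E) := by
    refine ((hint 1).add (hint (-1))).mono' hFc.aestronglyMeasurable (ae_of_all _ fun w => ?_)
    simp only [Pi.add_apply, one_mul, neg_mul, Real.norm_eq_abs]
    have := Real.add_one_le_exp |F w|
    rcases abs_cases (F w) with ⟨h, _⟩ | ⟨h, _⟩ <;> rw [h] at this ⊢ <;>
      linarith [Real.exp_pos (F w), Real.exp_pos (-F w)]
  have e : ∀ (t : ℝ) w, Real.exp (t * (F w - ∫ w', F w' ∂stdGaussian E))
      = Real.exp (t * F w) * Real.exp (∫ w', -t * F w' ∂stdGaussian E) := fun t w => by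
    rw [integral_const_mul, ← Real.exp_add]; ring_nf
  refine ⟨fun t => ?_, fun t => ?_⟩
  · simp only [e]
    exact (hint t).mul_const _
  · simp only [mgf, e]
    rw [integral_mul_const]
    -- Jensen replaces the mean of `F` by an independent copy, which reduces the claim to the
    -- symmetrized bound.
    have hj : Real.exp (∫ w', -t * F w' ∂stdGaussian E)
        ≤ ∫ w', Real.exp (-t * F w') ∂stdGaussian E :=
      convexOn_exp.map_integral_le Real.continuous_exp.continuousOn isClosed_univ (by simp)
        (hFint.const_mul _) (hint (-t))
    have hprod : (∫ w, Real.exp (t * F w) ∂stdGaussian E)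
        * (∫ w, Real.exp (-t * F w) ∂stdGaussian E)
        = ∫ z : E × E, Real.exp (-t * (F z.2 - F z.1))
          ∂((stdGaussian E).prod (stdGaussian E)) := by
      rw [← integral_prod_mul]
      congr 1 with z
      rw [← Real.exp_add]
      ring_nf
    calc _ ≤ (∫ w, Real.exp (t * F w) ∂stdGaussian E)
          * (∫ w, Real.exp (-t * F w) ∂stdGaussian E) :=
          mul_le_mul_of_nonneg_left hj (integral_nonneg fun _ => (Real.exp_pos _).le)
      _ ≤ Real.exp (5 / 4 * t ^ 2) := by
          rw [hprod, integral_eq_lintegral_of_nonneg_ae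
            (ae_of_all _ fun _ => (Real.exp_pos _).le) (hint2 (-t)).1]
          refine ENNReal.toReal_le_of_le_ofReal (Real.exp_pos _).le ?_
          simpa using lintegral_exp_sub_le hF hL (-t)
      _ = _ := by congr 1; push_cast; ring

end Concentration

/-! ### Concentration of the sketch -/

section SketchConcentration

lemma logSumExp_le_logSumExp_add {ι : Type*} [Fintype ι] [Nonempty ι] {x y : ι → ℝ} {b : ℝ}
    (h : ∀ i, x i ≤ y i + b) : logSumExp x ≤ logSumExp y + b := by
  have hb : 0 < Real.exp b := Real.exp_pos b
  rw [logSumExp, logSumExp, ← Real.log_exp b, ← Real.log_mul (sum_exp_pos y).ne' hb.ne',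
    Finset.sum_mul]
  refine Real.log_le_log (sum_exp_pos x) (Finset.sum_le_sum fun i _ => ?_)
  rw [← Real.exp_add]
  exact Real.exp_le_exp.2 (by simpa using h i)

variable {n d m : ℕ} [NeZero n] {β : ℝ} {X : Seq n d}

/-- The smooth approximation of one summand of the sketch. -/
noncomputable def smoothMax (β : ℝ) (X : Seq n d) (w : EuclideanSpace ℝ (Fin d)) : ℝ :=
  β⁻¹ * logSumExp fun i => β * inner ℝ w (X i)

lemma contDiff_smoothMax (β : ℝ) (X : Seq n d) : ContDiff ℝ 1 (smoothMax β X) := by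
  unfold smoothMax logSumExp
  refine contDiff_const.mul (ContDiff.log (ContDiff.sum fun i _ => ?_) fun w =>
    (sum_exp_pos fun i => β * inner ℝ w (X i)).ne')
  exact (contDiff_const.mul (contDiff_id.inner ℝ contDiff_const)).exp

lemma smoothMax_sub_le (hβ : 0 < β) (hX : ∀ i, ‖X i‖ = 1) (w w' : EuclideanSpace ℝ (Fin d)) :
    smoothMax β X w - smoothMax β X w' ≤ ‖w - w'‖ := by
  have h := logSumExp_le_logSumExp_add (x := fun i => β * inner ℝ w (X i))
    (y := fun i => β * inner ℝ w' (X i)) (b := β * ‖w - w'‖) fun i => by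
      have h1 := real_inner_le_norm (w - w') (X i)
      rw [hX i, mul_one, inner_sub_left] at h1
      nlinarith
  have h2 := mul_le_mul_of_nonneg_left h (inv_nonneg.2 hβ.le)
  have h3 : β⁻¹ * (β * ‖w - w'‖) = ‖w - w'‖ := by field_simp
  rw [mul_add, h3] at h2
  unfold smoothMax
  linarith

lemma norm_fderiv_smoothMax_le (hβ : 0 < β) (hX : ∀ i, ‖X i‖ = 1)
    (w : EuclideanSpace ℝ (Fin d)) : ‖fderiv ℝ (smoothMax β X) w‖ ≤ 1 := by
  have : LipschitzWith 1 (smoothMax β X) := LipschitzWith.of_dist_le_mul fun w w' => by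
    rw [Real.dist_eq, dist_eq_norm, NNReal.coe_one, one_mul, abs_le]
    have h1 := smoothMax_sub_le hβ hX w w'
    have h2 := smoothMax_sub_le hβ hX w' w
    rw [norm_sub_rev] at h2
    constructor <;> linarith
  exact_mod_cast norm_fderiv_le_of_lipschitz ℝ this

lemma ciSup_le_smoothMax (hβ : 0 < β) (w : EuclideanSpace ℝ (Fin d)) :
    ⨆ i, inner ℝ w (X i) ≤ smoothMax β X w := by
  have h := ciSup_le_logSumExp fun i => β * inner ℝ w (X i)
  rw [← Real.mul_iSup_of_nonneg hβ.le] at h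
  rw [smoothMax, ← div_eq_inv_mul, le_div_iff₀ hβ]
  linarith

lemma smoothMax_le_ciSup (hβ : 0 < β) (w : EuclideanSpace ℝ (Fin d)) :
    smoothMax β X w ≤ (⨆ i, inner ℝ w (X i)) + Real.log n / β := by
  have h := logSumExp_le_ciSup fun i => β * inner ℝ w (X i)
  rw [← Real.mul_iSup_of_nonneg hβ.le, Fintype.card_fin] at h
  rw [smoothMax, ← div_eq_inv_mul, div_le_iff₀ hβ, add_mul, div_mul_cancel₀ _ hβ.ne']
  linarith

lemma integral_smoothMax_mem (hβ : 0 < β) :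
    gaussianMax X ≤ ∫ w, smoothMax β X w ∂stdGaussian (EuclideanSpace ℝ (Fin d)) ∧
    ∫ w, smoothMax β X w ∂stdGaussian (EuclideanSpace ℝ (Fin d))
      ≤ gaussianMax X + Real.log n / β := by
  have h1 := mul_gaussianMax_le X hβ.le
  have h2 := integral_logSumExp_inner_le X hβ.le
  rw [Fintype.card_fin] at h2
  simp only [smoothMax]
  rw [integral_const_mul, ← div_eq_inv_mul]
  constructor
  · rw [le_div_iff₀ hβ]; linarith
  · rw [div_le_iff₀ hβ, add_mul, div_mul_cancel₀ _ hβ.ne']; linarith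

instance : IsProbabilityMeasure (gaussianWeights m d) := by unfold gaussianWeights; infer_instance

/-- The sketch is concentrated around the expected maximum of the projections. -/
lemma gaussianWeights_sketch_le (hm : 0 < m) (hβ : 0 < β) (hX : ∀ i, ‖X i‖ = 1) {t : ℝ}
    (ht : 0 ≤ t) :
    gaussianWeights m d {w | t + Real.log n / β ≤ |sketch w X - gaussianMax X|}
      ≤ ENNReal.ofReal (2 * Real.exp (-(m * t ^ 2 / 5))) := by
  set I := ∫ w, smoothMax β X w ∂stdGaussian (EuclideanSpace ℝ (Fin d)) with hI
  have hm' : (0 : ℝ) < m := by exact_mod_cast hm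
  have hmeas : Measurable fun w => smoothMax β X w - I :=
    (contDiff_smoothMax β X).continuous.measurable.sub_const I
  have hsub := hasSubgaussianMGF_stdGaussian (contDiff_smoothMax β X)
    (norm_fderiv_smoothMax_le hβ hX)
  have hj : ∀ j : Fin m, HasSubgaussianMGF (fun w => smoothMax β X (w j) - I) (5 / 2)
      (gaussianWeights m d) := fun j => by
    refine HasSubgaussianMGF.of_map (Y := fun w : Fin m → EuclideanSpace ℝ (Fin d) => w j)
      (X := fun w => smoothMax β X w - I) (measurable_pi_apply j).aemeasurable ?_
    rw [gaussianWeights, (measurePreserving_eval _ j).map_eq]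
    exact hsub
  have hind : iIndepFun (fun (j : Fin m) w => smoothMax β X (w j) - I) (gaussianWeights m d) :=
    iIndepFun_pi (μ := fun _ : Fin m => stdGaussian (EuclideanSpace ℝ (Fin d)))
      (X := fun _ w => smoothMax β X w - I) fun _ => hmeas.aemeasurable
  have hsum := HasSubgaussianMGF.sum_of_iIndepFun hind (c := fun _ => 5 / 2) (s := Finset.univ)
    fun j _ => hj j
  have hexp : ∀ {Y : (Fin m → EuclideanSpace ℝ (Fin d)) → ℝ},
      HasSubgaussianMGF Y (∑ _j : Fin m, 5 / 2) (gaussianWeights m d) →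
      gaussianWeights m d {w | m * t ≤ Y w} ≤ ENNReal.ofReal (Real.exp (-(m * t ^ 2 / 5))) := by
    intro Y hY
    -- The variance proxy of the sum is `5 m / 2`, so the exponent is `(m t) ^ 2 / (5 m) = m t ^ 2 /
    -- 5`.
    have := hY.measure_ge_le (ε := m * t) (by positivity)
    rw [← ofReal_measureReal]
    refine ENNReal.ofReal_le_ofReal (this.trans_eq ?_)
    congr 1
    simp
    field_simp
  have h1 := hexp hsum
  have h2 := hexp hsum.neg
  rw [two_mul, ENNReal.ofReal_add (Real.exp_pos _).le (Real.exp_pos _).le]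
  refine le_trans (measure_mono fun w hw => ?_) ((measure_union_le _ _).trans (add_le_add h1 h2))
  -- Smoothing raises both the sketch and its mean, each by at most `ln n / β`. The errors have the
  -- same sign, so a single margin `ln n / β` suffices on either side.
  have hI' := integral_smoothMax_mem (X := X) hβ
  rw [← hI] at hI'
  have hlog : 0 ≤ Real.log n / β := div_nonneg (Real.log_natCast_nonneg n) hβ.le
  set D := ∑ j, (smoothMax β X (w j) - I) with hD
  have hl : m * (sketch w X - I) ≤ D := by
    rw [hD, Finset.sum_sub_distrib, sketch]
    simp only [Finset.sum_const, Finset.card_univ, Fintype.card_fin, nsmul_eq_mul]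
    rw [mul_sub, ← mul_assoc, mul_one_div_cancel hm'.ne', one_mul]
    gcongr with j
    exact ciSup_le_smoothMax hβ _
  have hu : D ≤ m * (sketch w X + Real.log n / β - I) := by
    rw [hD, Finset.sum_sub_distrib, sketch]
    simp only [Finset.sum_const, Finset.card_univ, Fintype.card_fin, nsmul_eq_mul]
    rw [mul_sub, mul_add, ← mul_assoc, mul_one_div_cancel hm'.ne', one_mul]
    gcongr
    calc _ ≤ ∑ j, ((⨆ i, inner ℝ (w j) (X i)) + Real.log n / β) :=
          Finset.sum_le_sum fun j _ => smoothMax_le_ciSup hβ _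
      _ = _ := by rw [Finset.sum_add_distrib]; simp
  simp only [Set.mem_ofPred_eq] at hw
  rcases le_abs.1 hw with h | h
  · left
    change m * t ≤ D
    exact le_trans (mul_le_mul_of_nonneg_left (by linarith) hm'.le) hl
  · right
    change m * t ≤ -D
    have : m * t ≤ m * (I - (sketch w X + Real.log n / β)) :=
      mul_le_mul_of_nonneg_left (by linarith) hm'.le
    linarith

end SketchConcentration

/-! ### The expected sketch of a clusterable sequence -/

section Clusterable

variable {E : Type*} [NormedAddCommGroup E] [InnerProductSpace ℝ E] [FiniteDimensional ℝ E]
  [MeasurableSpace E] [BorelSpace E] {ι : Type*} [Fintype ι] [Nonempty ι]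

lemma abs_ciSup_sub_ciSup_le (x y : ι → ℝ) : |(⨆ i, x i) - ⨆ i, y i| ≤ ⨆ i, |x i - y i| := by
  have h : ∀ x y : ι → ℝ, (⨆ i, x i) - ⨆ i, y i ≤ ⨆ i, |x i - y i| := fun x y => by
    rw [sub_le_iff_le_add]
    refine ciSup_le fun i => ?_
    have h1 := le_ciSup (Finite.bddAbove_range fun i => |x i - y i|) i
    have h2 := le_ciSup (Finite.bddAbove_range y) i
    linarith [le_abs_self (x i - y i)]
  rw [abs_le]
  constructor
  · have := h y x
    simp only [abs_sub_comm (y _)] at this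
    linarith
  · exact h x y

variable {n : ℕ}

lemma abs_gaussianMax_le (hn : 2 ≤ n) (hcard : Fintype.card ι ≤ n) {c : ι → E}
    (hc : ∀ i, ‖c i‖ = 1) : |gaussianMax c| ≤ 2 * √(Real.log n) := by
  obtain ⟨hi, h⟩ := integral_ciSup_abs_inner_le hn hcard one_pos fun i => (hc i).le
  rw [mul_one] at h
  refine le_trans ?_ h
  rw [gaussianMax, ← Real.norm_eq_abs]
  refine norm_integral_le_of_norm_le hi (ae_of_all _ fun w => ?_)
  simpa using abs_ciSup_sub_ciSup_le (fun i => inner ℝ w (c i)) 0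

/-- The difference of the maxima is at most the maximum of the `|⟪w, x i - c i⟫|`, Gaussian
variables of variance at most `η`. -/
lemma abs_gaussianMax_sub_le (hn : 2 ≤ n) (hcard : Fintype.card ι ≤ n) {x c : ι → E} {η : ℝ}
    (hη : 0 < η) (h : ∀ i, ‖x i - c i‖ ^ 2 ≤ η) :
    |gaussianMax x - gaussianMax c| ≤ 2 * √η * √(Real.log n) := by
  obtain ⟨hi, hle⟩ := integral_ciSup_abs_inner_le hn hcard (Real.sqrt_pos.2 hη)
    (v := fun i => x i - c i) fun i => Real.le_sqrt_of_sq_le (h i)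
  refine le_trans ?_ hle
  rw [gaussianMax, gaussianMax, ← integral_sub (integrable_ciSup_inner x)
    (integrable_ciSup_inner c), ← Real.norm_eq_abs]
  refine norm_integral_le_of_norm_le hi (ae_of_all _ fun w => ?_)
  simp only [inner_sub_right, Real.norm_eq_abs]
  exact abs_ciSup_sub_ciSup_le _ _

/-- The expected maximum of nearly uncorrelated Gaussian variables is close to that of independent
binomial variables. -/
lemma abs_gaussianMax_sub_binomMax_le (hn : 2 ≤ n) (hcard : Fintype.card ι ≤ n) {c : ι → E}
    (hc : ∀ i, ‖c i‖ = 1) {ρ : ℝ} (hρ : 0 ≤ ρ) (hρ2 : ρ ≤ 1 / 2)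
    (h : ∀ i j, i ≠ j → |inner ℝ (c i) (c j)| ≤ ρ) {β : ℝ} (hβ : 0 < β) {R : ℕ} (hR : 0 < R)
    {e : ℝ} (he : Real.log (Fintype.card ι) / β + 1600 * Fintype.card ι * β ^ 2 / R ≤ e) :
    |gaussianMax c - binomMax R (Fintype.card ι)| ≤ e + 2 * ρ * (2 * √(Real.log n) + e) := by
  have hd : ∀ i j, ‖c i - c j‖ ^ 2 = 2 - 2 * inner ℝ (c i) (c j) := fun i j => by
    rw [norm_sub_sq_real, hc, hc]; ring
  have hs1 : √(1 + ρ) ^ 2 = 1 + ρ := Real.sq_sqrt (by linarith)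
  have hs2 : √(1 - ρ) ^ 2 = 1 - ρ := Real.sq_sqrt (by linarith)
  have hs1' : √(1 + ρ) ≤ 1 + ρ :=
    Real.sqrt_le_iff.2 ⟨by linarith, by nlinarith⟩
  have hs1'' : 1 ≤ √(1 + ρ) := Real.one_le_sqrt.2 (by linarith)
  have hs2' : 1 - ρ ≤ √(1 - ρ) := Real.le_sqrt_of_sq_le (by nlinarith)
  have hs2'' : √(1 - ρ) ≤ 1 := Real.sqrt_le_one.2 (by linarith)
  -- Since `‖c i - c j‖ ^ 2` lies between `2 (1 - ρ)` and `2 (1 + ρ)`, the scales `√(1 ± ρ)` bracket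
  -- the Gaussian walk.
  have hu := gaussianMax_le_mul_binomMax hc (Real.sqrt_nonneg _) (by linarith) hβ hR
    (σ := √(1 + ρ)) fun i j hij => by
      rw [hd, hs1]; linarith [(abs_le.1 (h i j hij)).1]
  have hl := mul_binomMax_le_gaussianMax hc (Real.sqrt_nonneg _) (by linarith) hβ hR
    (σ := √(1 - ρ)) fun i j hij => by
      rw [hd, hs2]; linarith [(abs_le.1 (h i j hij)).2]
  have hg := abs_le.1 (abs_gaussianMax_le hn hcard hc)
  set a := binomMax R (Fintype.card ι)
  set g := gaussianMax c
  set q := √(Real.log n)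
  have he0 : 0 ≤ e := by
    refine le_trans ?_ he
    have := Real.log_natCast_nonneg (Fintype.card ι)
    positivity
  have hq0 : 0 ≤ q := Real.sqrt_nonneg _
  -- The sign of `a` decides how the factors `√(1 ± ρ)` act on it. For `a ≥ 0`, the lower comparison
  -- and `ρ ≤ 1 / 2` bound `a` itself, hence the scaling error `ρ * a`.
  rcases le_total 0 a with ha | ha
  · have h1 : √(1 + ρ) * a ≤ (1 + ρ) * a := mul_le_mul_of_nonneg_right hs1' ha
    have h2 : (1 - ρ) * a ≤ √(1 - ρ) * a := mul_le_mul_of_nonneg_right hs2' ha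
    have h3 : a ≤ 2 * (2 * q + e) := by nlinarith
    have h4 : ρ * a ≤ ρ * (2 * (2 * q + e)) := mul_le_mul_of_nonneg_left h3 hρ
    rw [abs_le]; constructor <;> linarith
  · have h1 : √(1 + ρ) * a ≤ a := by nlinarith
    have h2 : a ≤ √(1 - ρ) * a := by nlinarith
    have h4 : 0 ≤ 2 * ρ * (2 * q + e) := by positivity
    rw [abs_le]; constructor <;> linarith

lemma abs_gaussianMax_sub_binomMax_le_of_clusterable {d k : ℕ} (hn : 2 ≤ n) {η ρ : ℝ} (hη : 0 < η)
    (hρ : 0 ≤ ρ) (hρ2 : ρ ≤ 1 / 2) {X : Seq n d} (hX : Clusterable η ρ k X) {β : ℝ} (hβ : 0 < β)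
    {R : ℕ} (hR : 0 < R) {e : ℝ} (he : Real.log n / β + 1600 * n * β ^ 2 / R ≤ e) :
    k ≤ n ∧ |gaussianMax X - binomMax R k|
      ≤ 2 * √η * √(Real.log n) + (e + 2 * ρ * (2 * √(Real.log n) + e)) := by
  obtain ⟨hX1, c, r, -, hc, hr, hXc, hcc⟩ := hX
  have hk : k ≤ n := by simpa using Fintype.card_le_of_surjective r hr
  have : Nonempty (Fin n) := ⟨⟨0, by omega⟩⟩
  have hne : Nonempty (Fin k) := this.map r
  have hk0 : 0 < k := Fin.pos_iff_nonempty.2 hne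
  refine ⟨hk, ?_⟩
  have h1 := abs_gaussianMax_sub_le hn (by simp) (x := X) (c := c ∘ r) hη fun i => by
    have := hXc i
    rw [norm_sub_sq_real, hX1, Function.comp_apply, hc]
    linarith
  -- Repeated centers do not change a maximum, and surjectivity of `r` ensures that none is missing.
  have h2 : gaussianMax (c ∘ r) = gaussianMax c := by
    unfold gaussianMax
    congr 1 with w
    exact hr.iSup_comp fun s => inner ℝ w (c s)
  have h3 := abs_gaussianMax_sub_binomMax_le hn (by simpa) hc hρ hρ2 hcc hβ hR (e := e) (by
    refine le_trans ?_ he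
    rw [Fintype.card_fin]
    have : (0 : ℝ) < k := by exact_mod_cast hk0
    gcongr)
  rw [Fintype.card_fin] at h3
  rw [h2] at h1
  exact (abs_sub_le _ (gaussianMax c) _).trans (add_le_add h1 h3)

end Clusterable

/-! ### Normal quantiles and growth of the Gaussian maximum -/

section Gap

/-- The distribution function of the standard normal distribution. -/
noncomputable def normalCdf (x : ℝ) : ℝ := (gaussianReal 0 1).real (Set.Iic x)

lemma normalCdf_nonneg (x : ℝ) : 0 ≤ normalCdf x := measureReal_nonneg

lemma normalCdf_le_one (x : ℝ) : normalCdf x ≤ 1 := measureReal_le_one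

lemma gaussianPDFReal_anti {x y : ℝ} (hx : 0 ≤ x) (hxy : x ≤ y) :
    gaussianPDFReal 0 1 y ≤ gaussianPDFReal 0 1 x := by
  simp only [gaussianPDFReal, NNReal.coe_one]
  gcongr

lemma gaussianPDFReal_le_one (x : ℝ) : gaussianPDFReal 0 1 x ≤ 1 := by
  simp only [gaussianPDFReal, NNReal.coe_one]
  have h1 : (√(2 * Real.pi * 1))⁻¹ ≤ 1 :=
    inv_le_one_of_one_le₀ (Real.one_le_sqrt.2 (by nlinarith [Real.pi_gt_three]))
  have h2 : Real.exp (-(x - 0) ^ 2 / (2 * 1)) ≤ 1 := Real.exp_le_one_iff.2 (by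
    have := sq_nonneg (x - 0); linarith)
  exact mul_le_one₀ h1 (Real.exp_pos _).le h2

lemma normalCdf_sub_eq {x y : ℝ} (hxy : x ≤ y) :
    normalCdf y - normalCdf x = ∫ t in Set.Ioc x y, gaussianPDFReal 0 1 t := by
  have h : (gaussianReal 0 1).real (Set.Ioc x y) = normalCdf y - normalCdf x := by
    rw [← Set.Iic_sdiff_Iic, measureReal_sdiff (Set.Iic_subset_Iic.2 hxy) measurableSet_Iic]
    rfl
  rw [← h, measureReal_def, gaussianReal_apply_eq_integral 0 one_ne_zero,
    ENNReal.toReal_ofReal (integral_nonneg fun _ => gaussianPDFReal_nonneg _ _ _)]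

lemma normalCdf_sub_le {x y c : ℝ} (hxy : x ≤ y)
    (h : ∀ t ∈ Set.Ioc x y, gaussianPDFReal 0 1 t ≤ c) :
    normalCdf y - normalCdf x ≤ (y - x) * c := by
  rw [normalCdf_sub_eq hxy]
  calc _ ≤ ∫ _t in Set.Ioc x y, c :=
        setIntegral_mono_on (integrable_gaussianPDFReal 0 1).integrableOn
          (by simp) measurableSet_Ioc h
    _ = _ := by simp [hxy]

lemma le_normalCdf_sub {x y : ℝ} (hx : 0 ≤ x) (hxy : x ≤ y) :
    (y - x) * gaussianPDFReal 0 1 y ≤ normalCdf y - normalCdf x := by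
  rw [normalCdf_sub_eq hxy]
  calc _ = ∫ _t in Set.Ioc x y, gaussianPDFReal 0 1 y := by simp [hxy]
    _ ≤ _ := setIntegral_mono_on (by simp) (integrable_gaussianPDFReal 0 1).integrableOn
          measurableSet_Ioc fun t ht => gaussianPDFReal_anti (hx.trans ht.1.le) ht.2

lemma continuous_normalCdf : Continuous normalCdf := by
  have h : ∀ x y, x ≤ y → |normalCdf y - normalCdf x| ≤ y - x := fun x y hxy => by
    have h1 := normalCdf_sub_le hxy fun t _ => gaussianPDFReal_le_one t
    have h2 : normalCdf x ≤ normalCdf y := measureReal_mono (Set.Iic_subset_Iic.2 hxy)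
    rw [abs_of_nonneg (by linarith)]
    linarith
  have : LipschitzWith 1 normalCdf := LipschitzWith.of_dist_le_mul fun x y => by
    rw [Real.dist_eq, Real.dist_eq, NNReal.coe_one, one_mul]
    rcases le_total x y with hxy | hxy
    · rw [abs_sub_comm, abs_sub_comm x, abs_of_nonneg (sub_nonneg.2 hxy)]
      exact h x y hxy
    · rw [abs_of_nonneg (sub_nonneg.2 hxy)]
      exact h y x hxy
  exact this.continuous

lemma normalCdf_zero : normalCdf 0 = 1 / 2 := by
  have hna : NullSingletonClass (gaussianReal 0 1) := nullSingletonClass_gaussianReal one_ne_zero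
  have h1 : (gaussianReal 0 1).real (Set.Ici 0) = normalCdf 0 := by
    have h := gaussianReal_map_neg (μ := 0) (v := 1)
    rw [neg_zero] at h
    conv_lhs => rw [← h]
    rw [map_measureReal_apply (by fun_prop) measurableSet_Ici, normalCdf]
    congr 1
    ext x; simp
  have h2 : (gaussianReal 0 1).real (Set.Ioi 0) = 1 - normalCdf 0 := by
    rw [← Set.compl_Iic, probReal_compl_eq_one_sub measurableSet_Iic, normalCdf]
  have h3 : (gaussianReal 0 1).real (Set.Ioi 0) = (gaussianReal 0 1).real (Set.Ici 0) := by
    rw [measureReal_def, measureReal_def, measure_congr Ioi_ae_eq_Ici]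
  linarith

lemma one_sub_normalCdf_le {x : ℝ} (hx : 0 ≤ x) :
    1 - normalCdf x ≤ Real.exp (-(x ^ 2) / 2) := by
  have h := measure_ge_le_exp_mul_mgf (X := id) (μ := gaussianReal 0 1) x hx
    (integrable_exp_mul_gaussianReal x)
  rw [mgf_id_gaussianReal] at h
  have h2 : 1 - normalCdf x ≤ (gaussianReal 0 1).real {t | x ≤ id t} := by
    rw [normalCdf, ← probReal_compl_eq_one_sub measurableSet_Iic]
    exact measureReal_mono fun t ht => (not_le.1 (Set.mem_Iic.not.1 ht)).le
  refine h2.trans (h.trans_eq ?_)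
  rw [← Real.exp_add]
  congr 1
  simp
  ring

/-- A bound for the hazard rate of the standard normal distribution. -/
lemma gaussianPDFReal_le_one_sub_normalCdf {x : ℝ} (hx : 0 ≤ x) :
    gaussianPDFReal 0 1 x ≤ 9 / 2 * (x + 1) * (1 - normalCdf x) := by
  -- Over this length the density drops by a factor of at most `exp (3 / 2) ≤ 9 / 2`, so the tail
  -- contains a rectangle of comparable height.
  set h := 1 / (x + 1) with hh
  have hx1 : 0 < x + 1 := by linarith
  have h0 : 0 < h := by positivity
  have h1 : h ≤ 1 := by rw [hh, div_le_one hx1]; linarith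
  have hxh : x * h ≤ 1 := by rw [hh, mul_one_div, div_le_one hx1]; linarith
  have hp : gaussianPDFReal 0 1 x ≤ 9 / 2 * gaussianPDFReal 0 1 (x + h) := by
    simp only [gaussianPDFReal, NNReal.coe_one]
    rw [mul_left_comm]
    gcongr
    have e : -(x - 0) ^ 2 / (2 * 1) = (x * h + h ^ 2 / 2) + -(x + h - 0) ^ 2 / (2 * 1) := by ring
    rw [e, Real.exp_add]
    gcongr
    calc Real.exp (x * h + h ^ 2 / 2) ≤ Real.exp (3 / 2) := by gcongr; nlinarith
      _ ≤ 9 / 2 := by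
          have h3 : Real.exp (3 / 2) ^ 2 = Real.exp 1 ^ 3 := by
            rw [← Real.exp_nat_mul, ← Real.exp_nat_mul]; norm_num
          have h4 : Real.exp 1 ^ 3 ≤ 2.72 ^ 3 :=
            pow_le_pow_left₀ (Real.exp_pos _).le (by linarith [Real.exp_one_lt_d9]) 3
          nlinarith [Real.exp_pos (3 / 2)]
  have hl := le_normalCdf_sub hx (y := x + h) (by linarith)
  rw [add_sub_cancel_left] at hl
  have h2 := normalCdf_le_one (x + h)
  have h3 : gaussianPDFReal 0 1 (x + h) ≤ (x + 1) * (1 - normalCdf x) := by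
    have : gaussianPDFReal 0 1 (x + h) = (x + 1) * (h * gaussianPDFReal 0 1 (x + h)) := by
      rw [hh]; field_simp
    rw [this]
    gcongr
    linarith
  linarith

/-- A quantile of the normal distribution, past which the tail does not drop too quickly. -/
lemma exists_normalCdf_quantile {k : ℕ} (hk : 2 ≤ k) :
    ∃ b, 0 ≤ b ∧ b ≤ √(2 * Real.log k) ∧ normalCdf b = 1 - 1 / k ∧
      1 / (2 * k) ≤ 1 - normalCdf (b + 1 / (9 * (b + 1))) := by
  have hk' : (2 : ℝ) ≤ k := by exact_mod_cast hk
  have hlog : 0 ≤ 2 * Real.log k := by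
    have := Real.log_nonneg (by linarith : (1 : ℝ) ≤ k); linarith
  have h1 : normalCdf 0 ≤ 1 - 1 / k := by
    rw [normalCdf_zero]
    have : 1 / (k : ℝ) ≤ 1 / 2 := one_div_le_one_div_of_le (by norm_num) hk'
    linarith
  have h2 : 1 - 1 / (k : ℝ) ≤ normalCdf √(2 * Real.log k) := by
    have := one_sub_normalCdf_le (Real.sqrt_nonneg (2 * Real.log k))
    rw [Real.sq_sqrt hlog, neg_div, mul_div_cancel_left₀ _ (by norm_num), Real.exp_neg,
      Real.exp_log (by linarith), ← one_div] at this
    linarith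
  obtain ⟨b, ⟨hb0, hb1⟩, hb⟩ := intermediate_value_Icc (Real.sqrt_nonneg (2 * Real.log k))
    continuous_normalCdf.continuousOn ⟨h1, h2⟩
  refine ⟨b, hb0, hb1, hb, ?_⟩
  -- Chosen so that the hazard rate bound `9 / 2 * (b + 1)` times `u` is `1 / 2`: at most half of
  -- the tail is lost.
  set u := 1 / (9 * (b + 1)) with hu
  have hb' : 0 < b + 1 := by linarith
  have hu0 : 0 < u := by positivity
  have h3 := normalCdf_sub_le (x := b) (y := b + u) (by linarith) fun t ht =>
    gaussianPDFReal_anti hb0 ht.1.le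
  rw [add_sub_cancel_left] at h3
  have h4 := mul_le_mul_of_nonneg_left (gaussianPDFReal_le_one_sub_normalCdf hb0) hu0.le
  have h5 : u * (9 / 2 * (b + 1) * (1 - normalCdf b)) = 1 / 2 * (1 - normalCdf b) := by
    rw [hu]; field_simp
  rw [h5, hb] at h4
  rw [hb] at h3
  have : 1 / (2 * (k : ℝ)) = 1 / 2 * (1 / k) := by field_simp
  rw [this]
  linarith

/-- Here `1 - 1 / k ≥ exp (-1 / (k - 1))` and `k / (k - 1) ≤ 2`, so the power is at least `exp
(-2)`. -/
lemma one_sub_inv_pow_ge {k : ℕ} (hk : 2 ≤ k) : 1 / 8 ≤ (1 - 1 / (k : ℝ)) ^ k := by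
  have hk' : (2 : ℝ) ≤ k := by exact_mod_cast hk
  have hk1 : 0 < (k : ℝ) - 1 := by linarith
  have h1 : Real.exp (-(1 / ((k : ℝ) - 1))) ≤ 1 - 1 / k := by
    have h := Real.add_one_le_exp (1 / ((k : ℝ) - 1))
    rw [Real.exp_neg]
    have e : 1 - 1 / (k : ℝ) = (1 / ((k : ℝ) - 1) + 1)⁻¹ := by field_simp; ring
    rw [e]
    exact inv_anti₀ (by positivity) h
  calc (1 : ℝ) / 8 ≤ Real.exp (-2) := by
        rw [Real.exp_neg, one_div]
        refine inv_anti₀ (Real.exp_pos _) ?_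
        have : Real.exp 2 = Real.exp 1 ^ 2 := by rw [← Real.exp_nat_mul]; norm_num
        rw [this]
        nlinarith [Real.exp_one_lt_d9, Real.exp_pos 1]
    _ ≤ Real.exp (k * -(1 / ((k : ℝ) - 1))) := by
        refine Real.exp_le_exp.2 ?_
        rw [mul_neg, neg_le_neg_iff, mul_one_div, div_le_iff₀ hk1]
        linarith
    _ = Real.exp (-(1 / ((k : ℝ) - 1))) ^ k := by rw [Real.exp_nat_mul]
    _ ≤ _ := pow_le_pow_left₀ (Real.exp_pos _).le h1 k

variable {n : ℕ}

/-- The first `k` vectors of the standard basis of `ℝ^n`. -/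
noncomputable def firstBasis (n k : ℕ) (hk : k ≤ n) (i : Fin k) : EuclideanSpace ℝ (Fin n) :=
  EuclideanSpace.single (Fin.castLE hk i) 1

lemma norm_firstBasis {k : ℕ} (hk : k ≤ n) (i : Fin k) : ‖firstBasis n k hk i‖ = 1 := by
  simp [firstBasis]

lemma inner_firstBasis_of_ne {k : ℕ} (hk : k ≤ n) {i j : Fin k} (hij : i ≠ j) :
    inner ℝ (firstBasis n k hk i) (firstBasis n k hk j) = (0 : ℝ) := by
  have : Fin.castLE hk j ≠ Fin.castLE hk i := fun h => hij (Fin.castLE_injective hk h).symm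
  simp [firstBasis, EuclideanSpace.inner_single_left, this]

lemma inner_firstBasis {k : ℕ} (hk : k ≤ n) (w : EuclideanSpace ℝ (Fin n)) (i : Fin k) :
    inner ℝ w (firstBasis n k hk i) = w (Fin.castLE hk i) := by
  simp [firstBasis, EuclideanSpace.inner_single_right]

lemma gaussianMax_firstBasis_mono {k K : ℕ} (hk0 : 0 < k) (hkK : k ≤ K) (hK : K ≤ n) :
    gaussianMax (firstBasis n k (hkK.trans hK)) ≤ gaussianMax (firstBasis n K hK) := by
  have : Nonempty (Fin k) := ⟨⟨0, hk0⟩⟩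
  have : Nonempty (Fin K) := ⟨⟨0, by omega⟩⟩
  refine integral_mono (integrable_ciSup_inner _) (integrable_ciSup_inner _) fun w => ?_
  exact ciSup_le fun i => le_ciSup (f := fun i => inner ℝ w (firstBasis n K hK i))
    (Finite.bddAbove_range _) (Fin.castLE hkK i)

/-- The probability that `x i ≤ f i` for all `i`, for independent standard normal `x i`. -/
lemma stdGaussian_real_forall_le (s : Fin n → Set ℝ) (hs : ∀ i, MeasurableSet (s i)) :
    (stdGaussian (EuclideanSpace ℝ (Fin n))).real {w | ∀ i, w i ∈ s i}
      = ∏ i, (gaussianReal 0 1).real (s i) := by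
  have hm : MeasurableSet {w : EuclideanSpace ℝ (Fin n) | ∀ i, w i ∈ s i} := by
    rw [Set.ofPred_forall]
    exact .iInter fun i => (by fun_prop : Measurable fun w : EuclideanSpace ℝ (Fin n) => w i) (hs i)
  rw [← map_pi_eq_stdGaussian, map_measureReal_apply (by fun_prop) hm]
  have : (WithLp.toLp 2 : (Fin n → ℝ) → EuclideanSpace ℝ (Fin n)) ⁻¹' {w | ∀ i, w i ∈ s i}
      = Set.univ.pi s := by ext; simp
  rw [this, measureReal_def, Measure.pi_pi, ENNReal.toReal_prod]
  rfl

lemma prod_ite_lt_le {k K : ℕ} (hkK : k ≤ K) (hK : K ≤ n) (p q : ℝ) :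
    ∏ i : Fin n, (if (i : ℕ) < k then p else if (i : ℕ) < K then q else 1) = p ^ k * q ^ (K - k) := by
  rw [Fin.prod_univ_eq_prod_range (fun i => if i < k then p else if i < K then q else 1) n,
    ← Finset.prod_range_mul_prod_Ico _ (hkK.trans hK), ← Finset.prod_Ico_consecutive _ hkK hK]
  have h1 : ∏ i ∈ Finset.range k, (if i < k then p else if i < K then q else 1) = p ^ k := by
    rw [Finset.prod_congr rfl fun i hi => if_pos (Finset.mem_range.1 hi)]; simp
  have h2 : ∏ i ∈ Finset.Ico k K, (if i < k then p else if i < K then q else 1) = q ^ (K - k) := by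
    rw [Finset.prod_congr rfl (g := fun _ => q) fun i hi => by
      rw [Finset.mem_Ico] at hi
      rw [if_neg (by omega), if_pos hi.2]]
    simp
  have h3 : ∏ i ∈ Finset.Ico K n, (if i < k then p else if i < K then q else 1) = 1 :=
    Finset.prod_eq_one fun i hi => by
      rw [Finset.mem_Ico] at hi
      rw [if_neg (by omega), if_neg (by omega)]
  rw [h1, h2, h3, mul_one]

/-- If the first `k` coordinates are at most `b` and one of the next `K - k` exceeds `b + u`, the
maximum grows by at least `u`; it never decreases. Independence gives the probability of this event.
-/
lemma gaussianMax_firstBasis_gap_aux {k K : ℕ} (hk0 : 0 < k) (hkK : k ≤ K) (hK : K ≤ n) (b : ℝ)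
    (u : ℝ) :
    u * (normalCdf b ^ k * (1 - normalCdf (b + u) ^ (K - k)))
      ≤ gaussianMax (firstBasis n K hK) - gaussianMax (firstBasis n k (hkK.trans hK)) := by
  have : Nonempty (Fin k) := ⟨⟨0, hk0⟩⟩
  have : Nonempty (Fin K) := ⟨⟨0, by omega⟩⟩
  let f1 : Fin n → Set ℝ := fun i => if (i : ℕ) < k then Set.Iic b else Set.univ
  let f2 : Fin n → Set ℝ := fun i =>
    if (i : ℕ) < k then Set.Iic b else if (i : ℕ) < K then Set.Iic (b + u) else Set.univ
  have hf1 : ∀ i, MeasurableSet (f1 i) := fun i => by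
    simp only [f1]; split_ifs <;> measurability
  have hf2 : ∀ i, MeasurableSet (f2 i) := fun i => by
    simp only [f2]; split_ifs <;> measurability
  let S1 : Set (EuclideanSpace ℝ (Fin n)) := {w | ∀ i, w i ∈ f1 i}
  let S2 : Set (EuclideanSpace ℝ (Fin n)) := {w | ∀ i, w i ∈ f2 i}
  have hm : ∀ s : Fin n → Set ℝ, (∀ i, MeasurableSet (s i)) →
      MeasurableSet {w : EuclideanSpace ℝ (Fin n) | ∀ i, w i ∈ s i} := fun s hs => by
    rw [Set.ofPred_forall]
    exact .iInter fun i => (by fun_prop : Measurable fun w : EuclideanSpace ℝ (Fin n) => w i) (hs i)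
  have hsub : S2 ⊆ S1 := fun w hw i => by
    have := hw i
    simp only [f1, f2] at this ⊢
    split_ifs at this ⊢ <;> trivial
  have hP1 : (stdGaussian (EuclideanSpace ℝ (Fin n))).real S1 = normalCdf b ^ k := by
    rw [stdGaussian_real_forall_le f1 hf1]
    have h := prod_ite_lt_le hkK hK (normalCdf b) 1
    rw [one_pow, mul_one] at h
    rw [← h]
    refine Finset.prod_congr rfl fun i _ => ?_
    simp only [f1]
    split_ifs <;> simp [normalCdf]
  have hP2 : (stdGaussian (EuclideanSpace ℝ (Fin n))).real S2
      = normalCdf b ^ k * normalCdf (b + u) ^ (K - k) := by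
    rw [stdGaussian_real_forall_le f2 hf2, ← prod_ite_lt_le hkK hK]
    refine Finset.prod_congr rfl fun i _ => ?_
    simp only [f2]
    split_ifs <;> simp [normalCdf]
  have hS : MeasurableSet (S1 \ S2) := (hm f1 hf1).diff (hm f2 hf2)
  have hPS : (stdGaussian (EuclideanSpace ℝ (Fin n))).real (S1 \ S2)
      = normalCdf b ^ k * (1 - normalCdf (b + u) ^ (K - k)) := by
    rw [measureReal_sdiff hsub (hm f2 hf2), hP1, hP2]; ring
  rw [← hPS, gaussianMax, gaussianMax,
    ← integral_sub (integrable_ciSup_inner _) (integrable_ciSup_inner _)]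
  calc u * (stdGaussian (EuclideanSpace ℝ (Fin n))).real (S1 \ S2)
      = ∫ w, (S1 \ S2).indicator (fun _ => u) w ∂stdGaussian (EuclideanSpace ℝ (Fin n)) := by
        rw [integral_indicator_const _ hS, smul_eq_mul, mul_comm]
    _ ≤ _ := by
        refine integral_mono ((integrable_const u).indicator hS)
          ((integrable_ciSup_inner _).sub (integrable_ciSup_inner _)) fun w => ?_
        simp only [inner_firstBasis]
        have hmono : ⨆ i : Fin k, w (Fin.castLE (hkK.trans hK) i) ≤ ⨆ i : Fin K, w (Fin.castLE hK i) :=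
          ciSup_le fun i => le_ciSup (f := fun i => w (Fin.castLE hK i))
            (Finite.bddAbove_range _) (Fin.castLE hkK i)
        by_cases hw : w ∈ S1 \ S2
        · rw [Set.indicator_of_mem hw]
          have h1 : ⨆ i : Fin k, w (Fin.castLE (hkK.trans hK) i) ≤ b := ciSup_le fun i => by
            have := hw.1 (Fin.castLE (hkK.trans hK) i)
            simpa [f1] using this
          obtain ⟨i, hi⟩ := not_forall.1 hw.2
          have hi1 := hw.1 i
          simp only [f1, f2] at hi hi1
          have hiK : (i : ℕ) < K := by
            by_contra hcon
            rw [if_neg (by omega), if_neg hcon] at hi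
            exact hi (Set.mem_univ _)
          have hik : ¬ (i : ℕ) < k := fun hcon => by
            rw [if_pos hcon] at hi hi1
            exact hi hi1
          rw [if_neg hik, if_pos hiK, Set.mem_Iic, not_le] at hi
          have h2 := le_ciSup (f := fun i => w (Fin.castLE hK i)) (Finite.bddAbove_range _) ⟨i, hiK⟩
          have h3 : w (Fin.castLE hK ⟨i, hiK⟩) = w i := rfl
          rw [h3] at h2
          linarith
        · rw [Set.indicator_of_notMem hw]
          linarith

/-- The expected maximum of independent normal variables grows with their number. -/
lemma gaussianMax_firstBasis_gap {k K : ℕ} (hn : 2 ≤ n) (hk : 2 ≤ k) (hK : K ≤ n) {ε : ℝ}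
    (hε : 0 < ε) (hε1 : ε ≤ 1) (hkK : (1 + ε) * k ≤ K) (hle : k ≤ K) :
    ε / (700 * √(Real.log n))
      ≤ gaussianMax (firstBasis n K hK) - gaussianMax (firstBasis n k (hle.trans hK)) := by
  obtain ⟨b, hb0, hb1, hb, hbu⟩ := exists_normalCdf_quantile hk
  set u := 1 / (9 * (b + 1)) with hu
  have hk' : (2 : ℝ) ≤ k := by exact_mod_cast hk
  have hu0 : 0 < u := by positivity
  refine le_trans ?_ (gaussianMax_firstBasis_gap_aux (by omega) hle hK b u)
  set q := √(Real.log n) with hq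
  have hn' : (2 : ℝ) ≤ n := by exact_mod_cast hn
  have hq1 : 83 / 100 ≤ q := Real.le_sqrt_of_sq_le (by
    have h2 : Real.log 2 ≤ Real.log n := Real.log_le_log (by norm_num) hn'
    have := Real.log_two_gt_d9
    norm_num
    linarith)
  have hbq : b + 1 ≤ 27 / 10 * q := by
    have h1 : √(2 * Real.log k) ≤ √2 * q := by
      rw [Real.sqrt_mul (by norm_num)]
      gcongr
      exact Real.sqrt_le_sqrt (Real.log_le_log (by linarith) (by exact_mod_cast hle.trans hK))
    have h2 : √2 ≤ 142 / 100 := Real.sqrt_le_iff.2 ⟨by norm_num, by norm_num⟩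
    nlinarith
  have h8 := one_sub_inv_pow_ge hk
  -- There are at least `ε k` extra variables and each exceeds `b + u` with probability at least `1
  -- / (2 k)`, so none does with probability at most `exp (-ε / 2)`.
  have hpow : normalCdf (b + u) ^ (K - k) ≤ 1 - ε / 3 := by
    set v := 1 - normalCdf (b + u) with hv
    have e : normalCdf (b + u) = 1 - v := by rw [hv]; ring
    have hvj : ε / 2 ≤ v * (K - k : ℕ) := by
      rw [Nat.cast_sub hle]
      have h1 : ε * k ≤ (K : ℝ) - k := by linarith
      have h2 : ε / 2 = 1 / (2 * k) * (ε * k) := by field_simp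
      rw [h2]
      exact mul_le_mul hbu h1 (by positivity) (by linarith [show 0 < 1 / (2 * (k : ℝ)) by positivity])
    calc normalCdf (b + u) ^ (K - k) ≤ Real.exp (-v) ^ (K - k) := by
          refine pow_le_pow_left₀ (normalCdf_nonneg _) ?_ _
          rw [e]
          linarith [Real.add_one_le_exp (-v)]
      _ = Real.exp (-(v * (K - k : ℕ))) := by rw [← Real.exp_nat_mul]; congr 1; ring
      _ ≤ Real.exp (-(ε / 2)) := Real.exp_le_exp.2 (by linarith)
      _ ≤ 1 - ε / 3 := by
          have h1 := Real.add_one_le_exp (ε / 2)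
          rw [Real.exp_neg]
          refine inv_le_of_inv_le₀ (by linarith) (le_trans ?_ h1)
          rw [inv_le_comm₀ (by linarith) (by positivity), inv_le_iff_one_le_mul₀ (by positivity)]
          nlinarith
  rw [hb]
  -- The product of the constants is `9 * 2.7 * 24 = 583.2`, rounded up to `700`.
  calc ε / (700 * q) ≤ 1 / (9 * (27 / 10 * q)) * (1 / 8 * (ε / 3)) := by
        have : 1 / (9 * (27 / 10 * q)) * (1 / 8 * (ε / 3)) = ε / (9 * 27 / 10 * 24 * q) := by
          field_simp; norm_num
        rw [this]
        gcongr
        norm_num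
    _ ≤ u * ((1 - 1 / (k : ℝ)) ^ k * (1 - normalCdf (b + u) ^ (K - k))) := by
        rw [hu]
        gcongr
        linarith

end Gap

/-! ### Step-counting rules for the machine -/

section Machine

/-- The command `p` transforms the state `σ` into `σ'` in at most `B` steps. -/
def Runs (I : Input) (p : Com) (σ σ' : State) (B : ℕ) : Prop :=
  ∃ t ≤ B, ∀ K, (step I)^[t] (p :: K, σ) = (K, σ')

variable {I : Input}

lemma Runs.mono {p : Com} {σ σ' : State} {B B' : ℕ} (h : Runs I p σ σ' B) (hB : B ≤ B') :
    Runs I p σ σ' B' :=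
  let ⟨t, ht, hr⟩ := h
  ⟨t, ht.trans hB, hr⟩

lemma Runs.seq {p q : Com} {σ σ' σ'' : State} {B B' : ℕ} (hp : Runs I p σ σ' B)
    (hq : Runs I q σ' σ'' B') : Runs I (.seq p q) σ σ'' (B + B' + 1) := by
  obtain ⟨t, ht, hp⟩ := hp
  obtain ⟨t', ht', hq⟩ := hq
  refine ⟨t' + (t + 1), by omega, fun K => ?_⟩
  rw [Function.iterate_add_apply, Function.iterate_succ_apply]
  simp only [step]
  rw [hp, hq]

/-- The invariant is the explicit sequence `s` of states; each round pays one step for the test, and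
the failing test pays the final one. -/
lemma Runs.whileLoop {b : Test} {p : Com} {s : ℕ → State} {B : ℕ} {l : ℕ}
    (hb : ∀ i < l, b.Holds I (s i)) (hl : ¬ b.Holds I (s l))
    (hp : ∀ i < l, Runs I p (s i) (s (i + 1)) B) :
    Runs I (.while b p) (s 0) (s l) (l * (B + 1) + 1) := by
  induction l generalizing s with
  | zero => exact ⟨1, by omega, fun K => by simp [step, hl]⟩
  | succ l ih =>
    obtain ⟨t', ht', hr'⟩ := ih (s := fun i => s (i + 1)) (fun i hi => hb _ (by omega)) hl
      fun i hi => hp _ (by omega)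
    obtain ⟨t, ht, hr⟩ := hp 0 (by omega)
    refine ⟨t' + (t + 1), by rw [add_mul]; omega, fun K => ?_⟩
    rw [Function.iterate_add_apply, Function.iterate_succ_apply]
    have : step I (.while b p :: K, s 0) = (p :: .while b p :: K, s 0) := by
      simp [step, hb 0 (by omega)]
    rw [this, hr, hr']

/-- The state with real registers `L` and output `o`. -/
def regs (L o : List ℝ) : State where
  ints := fun _ => 0
  reals := fun a => L.getD a 0
  out := o

/-- A sequence of assignments to real registers. -/
def assigns : List (ℕ × RExp) → Com
  | [] => .skip
  | (i, e) :: A => .seq (.setReal (.const i) e) (assigns A)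

/-- The effect of a sequence of assignments on the registers. -/
noncomputable def execAssigns (I : Input) (o : List ℝ) : List (ℕ × RExp) → List ℝ → List ℝ
  | [], L => L
  | (i, e) :: A, L => execAssigns I o A (L.set i (e.eval I (regs L o)))

/-- The bound on `i` matters because `List.set` does nothing out of range, whereas the machine would
store the value. -/
lemma runs_setReal {L o : List ℝ} {i : ℕ} (hi : i < L.length) (e : RExp) :
    Runs I (.setReal (.const i) e) (regs L o) (regs (L.set i (e.eval I (regs L o))) o) 1 := by
  refine ⟨1, le_rfl, fun K => ?_⟩
  simp only [Function.iterate_one, step, NExp.eval]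
  congr 1
  simp only [regs, State.mk.injEq, true_and, and_true]
  funext a
  rcases eq_or_ne a i with rfl | h
  · simp [hi]
  · simp [Function.update_of_ne h, List.getElem?_set_ne h.symm]

lemma runs_assigns {L o : List ℝ} {A : List (ℕ × RExp)} (h : ∀ a ∈ A, a.1 < L.length) :
    Runs I (assigns A) (regs L o) (regs (execAssigns I o A L) o) (2 * A.length + 1) := by
  induction A generalizing L with
  | nil => exact ⟨1, by simp, fun K => rfl⟩
  | cons a A ih =>
    refine ((runs_setReal (h a (by simp)) a.2).seq (ih fun b hb => ?_)).mono (by simp; omega)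
    simpa using h b (by simp [hb])

lemma runs_emit (L o : List ℝ) (e : RExp) :
    Runs I (.emit e) (regs L o) (regs L (o ++ [e.eval I (regs L o)])) 1 :=
  ⟨1, le_rfl, fun _ => rfl⟩

/-- A halted configuration is a fixed point of `step`, so surplus time is harmless. -/
lemma Runs.run_eq {p : Com} {σ : State} {B t : ℕ}
    (h : Runs I p { ints := fun _ => 0, reals := fun _ => 0, out := [] } σ B) (ht : B ≤ t) :
    run p I t = ([], σ) := by
  obtain ⟨t₀, ht₀, hr⟩ := h
  obtain ⟨r, rfl⟩ := Nat.exists_eq_add_of_le' (ht₀.trans ht)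
  rw [run, Function.iterate_add_apply, hr]
  exact Function.iterate_fixed rfl r

end Machine

/-! ### Evaluating step functions -/

section Readout

/-- The step function that jumps to the value `k` at the breakpoint `τ k`, for the `l` consecutive
integers from `a` on. -/
def stepList (τ : ℕ → ℝ) (a l : ℕ) : List ℝ := (List.range' a l).flatMap fun k => [τ k, (k : ℝ)]

variable {τ : ℕ → ℝ} {s : ℝ}

lemma stepValue_stepList_zero (v : ℝ) (a : ℕ) : stepValue s v (stepList τ a 0) = v := by
  simp [stepList, stepValue]

lemma stepValue_stepList_succ (v : ℝ) (a l : ℕ) : stepValue s v (stepList τ a (l + 1))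
    = if τ a ≤ s then stepValue s a (stepList τ (a + 1) l) else v := by
  simp [stepList, List.range'_succ, stepValue]

lemma le_stepValue_stepList {v : ℝ} {a : ℕ} (hv : v ≤ a) (l : ℕ) :
    v ≤ stepValue s v (stepList τ a l) := by
  induction l generalizing v a with
  | zero => rw [stepValue_stepList_zero]
  | succ l ih =>
    rw [stepValue_stepList_succ]
    split_ifs
    · exact hv.trans (ih (by push_cast; linarith))
    · exact le_rfl

/-- The values increase along the list and evaluation stops at the first breakpoint not reached, so
no order among the breakpoints is required. -/
lemma monotone_stepValue_stepList {v : ℝ} {a : ℕ} (hv : v ≤ a) (l : ℕ) :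
    Monotone fun s => stepValue s v (stepList τ a l) := by
  induction l generalizing v a with
  | zero => intro s s' _; simp [stepValue_stepList_zero]
  | succ l ih =>
    intro s s' hs
    have ha : (a : ℝ) ≤ (a + 1 : ℕ) := by push_cast; linarith
    simp only [stepValue_stepList_succ]
    split_ifs with h1 h2
    · exact ih ha hs
    · exact absurd (h1.trans hs) h2
    · exact hv.trans (le_stepValue_stepList ha l)
    · exact le_rfl

lemma natCast_le_stepValue_stepList {v : ℝ} {a l k : ℕ} (hak : a ≤ k) (hk : k < a + l)
    (h : ∀ j, a ≤ j → j ≤ k → τ j ≤ s) : (k : ℝ) ≤ stepValue s v (stepList τ a l) := by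
  induction l generalizing v a with
  | zero => omega
  | succ l ih =>
    rw [stepValue_stepList_succ, if_pos (h a le_rfl hak)]
    rcases eq_or_lt_of_le hak with rfl | hlt
    · exact le_stepValue_stepList (by push_cast; linarith) l
    · exact ih hlt (by omega) fun j hj => h j (by omega)

/-- The upper bound on the readout needs only that the value taken belongs to a breakpoint that was
passed. -/
lemma stepValue_stepList_cases (v : ℝ) (a l : ℕ) : stepValue s v (stepList τ a l) = v ∨
    ∃ K, a ≤ K ∧ K < a + l ∧ τ K ≤ s ∧ stepValue s v (stepList τ a l) = K := by
  induction l generalizing v a with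
  | zero => left; rw [stepValue_stepList_zero]
  | succ l ih =>
    rw [stepValue_stepList_succ]
    split_ifs with h
    · right
      rcases ih a (a + 1) with h1 | ⟨K, h1, h2, h3, h4⟩
      · exact ⟨a, le_rfl, by omega, h, h1⟩
      · exact ⟨K, by omega, by omega, h3, h4⟩
    · left; rfl

lemma stepList_succ (τ : ℕ → ℝ) (a l : ℕ) :
    stepList τ a (l + 1) = stepList τ a l ++ [τ (a + l), ((a + l : ℕ) : ℝ)] := by
  simp [stepList, List.range'_concat]

end Readout

/-! ### The program and its loop invariants -/

section Program

/-- The real register `i`. -/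
def reg (i : ℕ) : RExp := .mem (.const i)

/-- Raises register `8` to the power in register `5`. -/
def powerLoop : Com :=
  .while (.realLt (reg 10) (reg 5)) (assigns [(9, .mul (reg 9) (reg 8)),
    (10, .add (reg 10) (.const 1))])

/-- Sums the powers of the binomial distribution function. -/
def cdfLoop : Com :=
  .while (.realLt (reg 6) (reg 2))
    (.seq (assigns [(8, .add (reg 8) (reg 7)), (9, .const 1)])
      (.seq powerLoop
        (assigns [(11, .add (reg 11) (reg 9)),
          (7, .div (.mul (reg 7) (.sub (reg 2) (reg 6))) (.add (reg 6) (.const 1))),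
          (6, .add (reg 6) (.const 1)), (9, .const 0), (10, .const 0)])))

/-- Emits the breakpoints and the values of the readout. -/
def emitLoop : Com :=
  .while (.realLt (reg 5) (.add (reg 0) (.const 1)))
    (.seq (assigns [(7, reg 4)])
      (.seq cdfLoop
        (.seq (.emit (.sub (.sub (reg 1) (.mul (.div (.const 2) (reg 1)) (reg 11))) (reg 3)))
          (.seq (.emit (reg 5))
            (assigns [(5, .add (reg 5) (.const 1)), (6, .const 0), (7, .const 0), (8, .const 0),
              (11, .const 0)])))))

/-- Finds the least `q` with `n ≤ 2 ^ q ^ 2`. -/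
def sqrtLogLoop : Com :=
  .while (.realLt (reg 13) (reg 0)) (assigns [(13, .mul (reg 13) (reg 14)),
    (14, .mul (.const 4) (reg 14)), (12, .add (reg 12) (.const 1))])

/-- Computes the probability that all coins show zero. -/
def halvingLoop : Com :=
  .while (.realLt (reg 10) (reg 2)) (assigns [(4, .div (reg 4) (.const 2)),
    (10, .add (reg 10) (.const 1))])

/-- The learning algorithm. Classes of probability about `δ` are typically absent from a training
sample whose size is polynomial in `ln (1 / δ)`, so that the readout cannot be fitted to the labels:
the algorithm instead computes the expected sketch of `k` objects for each `k`, through random walks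
whose length is polynomial in `n` and `N`. -/
def sketchLearner : Com :=
  .seq (assigns [(0, .ofInt (.input (.const 0))), (3, .ofInt (.input (.const 3))),
      (1, .mul (.mul (.mul (reg 0) (reg 3)) (reg 3)) (reg 3)), (2, .mul (reg 1) (reg 1)),
      (13, .const 1), (14, .const 2)])
    (.seq sqrtLogLoop
      (.seq (assigns [(3, .div (.input (.const 0)) (.mul (.const 8000) (reg 12))), (4, .const 1)])
        (.seq halvingLoop
          (.seq (assigns [(5, .const 2), (10, .const 0)])
            (.seq (.emit (.const 1)) emitLoop)))))

variable {I : Input}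

lemma runs_assigns_of_eq {L L' o : List ℝ} {A : List (ℕ × RExp)} (h : ∀ a ∈ A, a.1 < L.length)
    (e : execAssigns I o A L = L') :
    Runs I (assigns A) (regs L o) (regs L' o) (2 * A.length + 1) :=
  e ▸ runs_assigns h

lemma runs_emit_of_eq {L o : List ℝ} {e : RExp} {x : ℝ} (h : e.eval I (regs L o) = x) :
    Runs I (.emit e) (regs L o) (regs L (o ++ [x])) 1 :=
  h ▸ runs_emit L o e

/-- In the main loops, registers `0` to `14` hold in order: `n`, `R`, `M = R ^ 2`, the margin `t`,
`2⁻¹ ^ M`, `k`, `j`, the binomial weight at `j`, the distribution function, its power, the power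
counter, the sum of powers, `sqrtLog n`, and two auxiliary powers of two. -/
lemma runs_powerLoop (n R M t c₀ j c F S q p r : ℝ) (k : ℕ) (o : List ℝ) :
    Runs I powerLoop (regs [n, R, M, t, c₀, k, j, c, F, 1, 0, S, q, p, r] o)
      (regs [n, R, M, t, c₀, k, j, c, F, F ^ k, k, S, q, p, r] o) (6 * k + 1) := by
  have h := Runs.whileLoop (I := I) (b := .realLt (reg 10) (reg 5))
    (p := assigns [(9, .mul (reg 9) (reg 8)), (10, .add (reg 10) (.const 1))])
    (s := fun i => regs [n, R, M, t, c₀, k, j, c, F, F ^ i, i, S, q, p, r] o) (B := 5) (l := k)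
    (fun i hi => by simpa [Test.Holds, RExp.eval, NExp.eval, regs, reg] using hi)
    (by simp [Test.Holds, RExp.eval, NExp.eval, regs, reg])
    (fun i _ => runs_assigns_of_eq (by simp) (by
      simp [execAssigns, RExp.eval, NExp.eval, regs, reg, pow_succ]))
  simp only [pow_zero, Nat.cast_zero] at h
  exact h.mono (by omega)

/-- The ratio of consecutive binomial weights, by which the program updates them with field
operations only. -/
lemma choose_div_mul_sub_div (M j : ℕ) (hj : j < M) :
    (M.choose j : ℝ) / 2 ^ M * (M - j) / (j + 1) = (M.choose (j + 1) : ℝ) / 2 ^ M := by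
  have h : ((M.choose (j + 1) : ℕ) : ℝ) * (j + 1) = M.choose j * (M - j) := by
    have := Nat.choose_succ_right_eq M j
    rw [← Nat.cast_sub hj.le]
    exact_mod_cast this
  have hj' : (j : ℝ) + 1 ≠ 0 := by positivity
  field_simp
  linarith

lemma runs_cdfLoop (n R t q p r : ℝ) (M k : ℕ) (o : List ℝ) :
    Runs I cdfLoop (regs [n, R, M, t, 1 / 2 ^ M, k, 0, 1 / 2 ^ M, 0, 0, 0, 0, q, p, r] o)
      (regs [n, R, M, t, 1 / 2 ^ M, k, M, (M.choose M : ℝ) / 2 ^ M,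
        ∑ i ∈ Finset.range M, (M.choose i : ℝ) / 2 ^ M, 0, 0,
        ∑ j ∈ Finset.range M, binomCdf M j ^ k, q, p, r] o) (M * (6 * k + 21) + 1) := by
  have h := Runs.whileLoop (I := I) (b := .realLt (reg 6) (reg 2))
    (p := .seq (assigns [(8, .add (reg 8) (reg 7)), (9, .const 1)])
      (.seq powerLoop
        (assigns [(11, .add (reg 11) (reg 9)),
          (7, .div (.mul (reg 7) (.sub (reg 2) (reg 6))) (.add (reg 6) (.const 1))),
          (6, .add (reg 6) (.const 1)), (9, .const 0), (10, .const 0)])))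
    (s := fun j => regs [n, R, M, t, 1 / 2 ^ M, k, j, (M.choose j : ℝ) / 2 ^ M,
        ∑ i ∈ Finset.range j, (M.choose i : ℝ) / 2 ^ M, 0, 0,
        ∑ j ∈ Finset.range j, binomCdf M j ^ k, q, p, r] o) (B := 6 * k + 20) (l := M)
    (fun i hi => by simpa [Test.Holds, RExp.eval, NExp.eval, regs, reg] using hi)
    (by simp [Test.Holds, RExp.eval, NExp.eval, regs, reg])
    (fun j hj => by
      refine Runs.mono (Runs.seq (runs_assigns_of_eq
        (L' := [n, R, M, t, 1 / 2 ^ M, k, j, (M.choose j : ℝ) / 2 ^ M, binomCdf M j, 1, 0,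
          ∑ j ∈ Finset.range j, binomCdf M j ^ k, q, p, r]) (by simp) ?_)
        (Runs.seq (runs_powerLoop _ _ _ _ _ _ _ _ _ _ _ _ k o) (runs_assigns_of_eq (by simp) ?_)))
        (by simp; omega)
      · simp [execAssigns, RExp.eval, NExp.eval, regs, reg, binomCdf, Finset.sum_range_succ]
      · have := choose_div_mul_sub_div M j hj
        simp [execAssigns, RExp.eval, NExp.eval, regs, reg, Finset.sum_range_succ, this, binomCdf])
  simp only [Finset.range_zero, Finset.sum_empty, Nat.choose_zero_right, Nat.cast_zero,
    Nat.cast_one] at h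
  exact h

/-- The breakpoints of the readout. -/
noncomputable def breakpoint (R : ℕ) (t : ℝ) (k : ℕ) : ℝ := binomMax R k - t

lemma runs_emitLoop (n R : ℕ) (hn : 1 ≤ n) (t q p r : ℝ) :
    ∃ L, Runs I emitLoop (regs [n, R, (R ^ 2 : ℕ), t, 1 / 2 ^ (R ^ 2), 2, 0, 0, 0, 0, 0, 0, q, p, r]
        [1]) (regs L (1 :: stepList (breakpoint R t) 2 (n - 1)))
      (n * (R ^ 2 * (6 * n + 21) + 30) + 1) := by
  set M := R ^ 2 with hM
  refine ⟨[n, R, M, t, 1 / 2 ^ M, (n - 1 + 2 : ℕ), 0, 0, 0, 0, 0, 0, q, p, r], ?_⟩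
  have h := Runs.whileLoop (I := I) (b := .realLt (reg 5) (.add (reg 0) (.const 1)))
    (p := .seq (assigns [(7, reg 4)])
      (.seq cdfLoop
        (.seq (.emit (.sub (.sub (reg 1) (.mul (.div (.const 2) (reg 1)) (reg 11))) (reg 3)))
          (.seq (.emit (reg 5))
            (assigns [(5, .add (reg 5) (.const 1)), (6, .const 0), (7, .const 0), (8, .const 0),
              (11, .const 0)])))))
    (s := fun i => regs [n, R, M, t, 1 / 2 ^ M, (i + 2 : ℕ), 0, 0, 0, 0, 0, 0, q, p, r]
      (1 :: stepList (breakpoint R t) 2 i)) (B := M * (6 * n + 21) + 29) (l := n - 1)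
    (fun i hi => by
      have : i + 2 < n + 1 := by omega
      have : ((i : ℝ) + 2) < n + 1 := by exact_mod_cast this
      simpa [Test.Holds, RExp.eval, NExp.eval, regs, reg] using this)
    (by
      have : n + 1 ≤ (n - 1) + 2 := by omega
      have : (n : ℝ) + 1 ≤ ((n - 1 : ℕ) : ℝ) + 2 := by exact_mod_cast this
      simpa [Test.Holds, RExp.eval, NExp.eval, regs, reg, -Nat.cast_sub] using this)
    (fun i hi => by
      have hB : M * (6 * (i + 2) + 21) ≤ M * (6 * n + 21) := Nat.mul_le_mul_left _ (by omega)
      set o := 1 :: stepList (breakpoint R t) 2 i with ho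
      have ho' : 1 :: stepList (breakpoint R t) 2 (i + 1)
          = (o ++ [breakpoint R t (i + 2)]) ++ [((i + 2 : ℕ) : ℝ)] := by
        rw [stepList_succ, ho, add_comm 2 i]; simp
      rw [ho']
      have h1 : Runs I (assigns [(7, reg 4)])
          (regs [n, R, M, t, 1 / 2 ^ M, (i + 2 : ℕ), 0, 0, 0, 0, 0, 0, q, p, r] o)
          (regs [n, R, M, t, 1 / 2 ^ M, (i + 2 : ℕ), 0, 1 / 2 ^ M, 0, 0, 0, 0, q, p, r] o) 3 :=
        runs_assigns_of_eq (by simp) (by simp [execAssigns, RExp.eval, NExp.eval, regs, reg])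
      have h2 := runs_cdfLoop (I := I) n R t q p r M (i + 2) o
      have h3 := runs_emit_of_eq (I := I) (o := o) (x := breakpoint R t (i + 2))
        (L := [n, R, M, t, 1 / 2 ^ M, (i + 2 : ℕ), M, (M.choose M : ℝ) / 2 ^ M,
          ∑ i ∈ Finset.range M, (M.choose i : ℝ) / 2 ^ M, 0, 0,
          ∑ j ∈ Finset.range M, binomCdf M j ^ (i + 2), q, p, r])
        (e := .sub (.sub (reg 1) (.mul (.div (.const 2) (reg 1)) (reg 11))) (reg 3))
        (by simp [RExp.eval, NExp.eval, regs, reg, breakpoint, binomMax, ← hM])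
      have h4 := runs_emit_of_eq (I := I) (o := o ++ [breakpoint R t (i + 2)])
        (x := ((i + 2 : ℕ) : ℝ)) (e := reg 5)
        (L := [n, R, M, t, 1 / 2 ^ M, (i + 2 : ℕ), M, (M.choose M : ℝ) / 2 ^ M,
          ∑ i ∈ Finset.range M, (M.choose i : ℝ) / 2 ^ M, 0, 0,
          ∑ j ∈ Finset.range M, binomCdf M j ^ (i + 2), q, p, r])
        (by simp [RExp.eval, NExp.eval, regs, reg])
      have h5 := runs_assigns_of_eq (I := I)
        (o := o ++ [breakpoint R t (i + 2)] ++ [((i + 2 : ℕ) : ℝ)])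
        (A := [(5, .add (reg 5) (.const 1)), (6, .const 0), (7, .const 0), (8, .const 0),
          (11, .const 0)])
        (L := [n, R, M, t, 1 / 2 ^ M, (i + 2 : ℕ), M, (M.choose M : ℝ) / 2 ^ M,
          ∑ i ∈ Finset.range M, (M.choose i : ℝ) / 2 ^ M, 0, 0,
          ∑ j ∈ Finset.range M, binomCdf M j ^ (i + 2), q, p, r])
        (L' := [n, R, M, t, 1 / 2 ^ M, (i + 1 + 2 : ℕ), 0, 0, 0, 0, 0, 0, q, p, r])
        (by simp) (by
          simp [execAssigns, RExp.eval, NExp.eval, regs, reg]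
          ring)
      refine (h1.seq (h2.seq (h3.seq (h4.seq h5)))).mono ?_
      simp only [List.length_cons, List.length_nil]
      omega)
  simp only [Nat.zero_add, Nat.cast_ofNat] at h
  have h0 : stepList (breakpoint R t) 2 0 = [] := by simp [stepList]
  rw [h0] at h
  exact h.mono (by gcongr; omega)

lemma exists_le_two_pow_sq (n : ℕ) : ∃ q : ℕ, n ≤ 2 ^ q ^ 2 :=
  ⟨n, (Nat.lt_two_pow_self).le.trans (Nat.pow_le_pow_right (by norm_num) (Nat.le_self_pow two_ne_zero n))⟩

/-- The least `q` with `n ≤ 2 ^ q ^ 2`. -/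
def sqrtLog (n : ℕ) : ℕ := Nat.find (exists_le_two_pow_sq n)

lemma le_two_pow_sqrtLog_sq (n : ℕ) : n ≤ 2 ^ sqrtLog n ^ 2 := Nat.find_spec (exists_le_two_pow_sq n)

lemma two_pow_sq_lt {n i : ℕ} (hi : i < sqrtLog n) : 2 ^ i ^ 2 < n :=
  not_le.1 (Nat.find_min (exists_le_two_pow_sq n) hi)

lemma sqrtLog_le (n : ℕ) : sqrtLog n ≤ n :=
  Nat.find_min' (exists_le_two_pow_sq n) ((Nat.lt_two_pow_self).le.trans
    (Nat.pow_le_pow_right (by norm_num) (Nat.le_self_pow two_ne_zero n)))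

/-- The machine has no logarithm or root, so `√(ln n)` is replaced by `sqrtLog n`. The invariant
keeps `2 ^ i ^ 2` and `2 ^ (2 * i + 1)`, whose product is `2 ^ (i + 1) ^ 2`. -/
lemma runs_sqrtLogLoop (n : ℕ) (R M t c₀ k j c F a b S : ℝ) (o : List ℝ) :
    ∃ p r, Runs I sqrtLogLoop (regs [n, R, M, t, c₀, k, j, c, F, a, b, S, 0, 1, 2] o)
      (regs [n, R, M, t, c₀, k, j, c, F, a, b, S, sqrtLog n, p, r] o) (8 * n + 1) := by
  have h := Runs.whileLoop (I := I) (b := .realLt (reg 13) (reg 0))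
    (p := assigns [(13, .mul (reg 13) (reg 14)),
      (14, .mul (.const 4) (reg 14)), (12, .add (reg 12) (.const 1))])
    (s := fun i => regs [n, R, M, t, c₀, k, j, c, F, a, b, S, i, 2 ^ i ^ 2, 2 ^ (2 * i + 1)] o)
    (B := 7) (l := sqrtLog n)
    (fun i hi => by
      have : (2 : ℝ) ^ i ^ 2 < n := by exact_mod_cast two_pow_sq_lt hi
      simpa [Test.Holds, RExp.eval, NExp.eval, regs, reg] using this)
    (by
      have : (n : ℝ) ≤ 2 ^ sqrtLog n ^ 2 := by exact_mod_cast le_two_pow_sqrtLog_sq n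
      simpa [Test.Holds, RExp.eval, NExp.eval, regs, reg] using this)
    (fun i _ => runs_assigns_of_eq (by simp) (by
      have h1 : (2 : ℝ) ^ i ^ 2 * 2 ^ (2 * i + 1) = 2 ^ (i + 1) ^ 2 := by
        rw [← pow_add]; congr 1; ring
      have h2 : (4 : ℝ) * 2 ^ (2 * i + 1) = 2 ^ (2 * (i + 1) + 1) := by
        rw [show (4 : ℝ) = 2 ^ 2 by norm_num, ← pow_add]; congr 1; ring
      simp [execAssigns, RExp.eval, NExp.eval, regs, reg, h1, h2]))
  simp only [Nat.cast_zero] at h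
  norm_num at h
  exact ⟨_, _, h.mono (by have := sqrtLog_le n; omega)⟩

lemma runs_halvingLoop (n R t k j c F a S q p r : ℝ) (M : ℕ) (o : List ℝ) :
    Runs I halvingLoop (regs [n, R, M, t, 1, k, j, c, F, a, 0, S, q, p, r] o)
      (regs [n, R, M, t, 1 / 2 ^ M, k, j, c, F, a, M, S, q, p, r] o) (6 * M + 1) := by
  have h := Runs.whileLoop (I := I) (b := .realLt (reg 10) (reg 2))
    (p := assigns [(4, .div (reg 4) (.const 2)), (10, .add (reg 10) (.const 1))])
    (s := fun i => regs [n, R, M, t, 1 / 2 ^ i, k, j, c, F, a, i, S, q, p, r] o)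
    (B := 5) (l := M)
    (fun i hi => by simpa [Test.Holds, RExp.eval, NExp.eval, regs, reg] using hi)
    (by simp [Test.Holds, RExp.eval, NExp.eval, regs, reg])
    (fun i _ => runs_assigns_of_eq (by simp) (by
      have h1 : ((2 : ℝ) ^ i)⁻¹ / 2 = (2 ^ (i + 1))⁻¹ := by rw [pow_succ]; field_simp
      simp [execAssigns, RExp.eval, NExp.eval, regs, reg, h1]))
  simp only [Nat.cast_zero, pow_zero, div_one] at h
  exact h.mono (by omega)

/-- The output of the algorithm. -/
noncomputable def learnerOutput (n N : ℕ) (ε : ℝ) : List ℝ :=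
  1 :: stepList (breakpoint (n * N ^ 3) (ε / (8000 * sqrtLog n))) 2 (n - 1)

lemma runs_sketchLearner {n N : ℕ} {ε : ℝ} (hn : 1 ≤ n) (h0 : I.ints.getD 0 0 = n)
    (h3 : I.ints.getD 3 0 = N) (hε : I.reals.getD 0 0 = ε) :
    ∃ L, Runs I sketchLearner { ints := fun _ => 0, reals := fun _ => 0, out := [] }
      (regs L (learnerOutput n N ε))
      (n * ((n * N ^ 3) ^ 2 * (6 * n + 21) + 30) + 6 * (n * N ^ 3) ^ 2 + 8 * n + 50) := by
  set R := n * N ^ 3 with hR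
  have hinit : ({ ints := fun _ => 0, reals := fun _ => 0, out := [] } : State)
      = regs [0, 0, 0, 0, 0, 0, 0, 0, 0, 0, 0, 0, 0, 0, 0] [] := by
    simp only [regs, State.mk.injEq, true_and, and_true]
    funext a
    rcases lt_or_ge a 15 with h | h
    · interval_cases a <;> rfl
    · rw [List.getD_eq_default]; simpa using h
  obtain ⟨p, r, hq⟩ := runs_sqrtLogLoop (I := I) n R (R ^ 2 : ℕ) N 0 0 0 0 0 0 0 0 []
  obtain ⟨L, hL⟩ := runs_emitLoop (I := I) n R hn (ε / (8000 * sqrtLog n)) (sqrtLog n) p r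
  refine ⟨L, ?_⟩
  rw [hinit]
  refine Runs.mono (Runs.seq (runs_assigns_of_eq (by simp) ?_) (Runs.seq hq
    (Runs.seq (runs_assigns_of_eq (by simp) ?_)
      (Runs.seq (runs_halvingLoop n R (ε / (8000 * sqrtLog n)) 0 0 0 0 0 0 (sqrtLog n) p r (R ^ 2) [])
        (Runs.seq (runs_assigns_of_eq (by simp) ?_) (Runs.seq (runs_emit_of_eq (by simp [RExp.eval])) hL)))))) ?_
  · simp only [List.getD_eq_getElem?_getD] at h0 h3
    simp [execAssigns, RExp.eval, NExp.eval, regs, reg, h0, h3, hR]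
    ring_nf
    simp
  · simp only [List.getD_eq_getElem?_getD] at hε
    simp [execAssigns, RExp.eval, NExp.eval, regs, reg, hε]
  · simp [execAssigns, RExp.eval]
  · simp
    omega

end Program

/-! ### Input size and running time -/

section Input

variable {n d m N : ℕ}

lemma learnerInput_ints_zero (ε δ : ℝ) (w : Fin m → EuclideanSpace ℝ (Fin d))
    (train : Fin N → Seq n d × ℕ) : (learnerInput ε δ w train).ints.getD 0 0 = n := rfl

lemma learnerInput_ints_three (ε δ : ℝ) (w : Fin m → EuclideanSpace ℝ (Fin d))
    (train : Fin N → Seq n d × ℕ) : (learnerInput ε δ w train).ints.getD 3 0 = N := rfl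

lemma learnerInput_reals_zero (ε δ : ℝ) (w : Fin m → EuclideanSpace ℝ (Fin d))
    (train : Fin N → Seq n d × ℕ) : (learnerInput ε δ w train).reals.getD 0 0 = ε := rfl

lemma size_learnerInput (ε δ : ℝ) (w : Fin m → EuclideanSpace ℝ (Fin d))
    (train : Fin N → Seq n d × ℕ) :
    (learnerInput ε δ w train).size = 6 + N + m * d + N * (n * d) := by
  simp [learnerInput, Input.size, List.length_flatten, List.map_ofFn, Function.comp_def]
  ring

/-- The time bound of `sketchLearner`. -/
noncomputable def timeBound : Polynomial ℕ := .C 200 * .X ^ 10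

lemma runs_sketchLearner_learnerInput (hn : 1 ≤ n) (hd : 1 ≤ d) (hN : 1 ≤ N) (ε δ : ℝ)
    (w : Fin m → EuclideanSpace ℝ (Fin d)) (train : Fin N → Seq n d × ℕ) :
    ∃ L, run sketchLearner (learnerInput ε δ w train) (allowedTime timeBound ε δ w train)
      = ([], regs L (learnerOutput n N ε)) := by
  obtain ⟨L, hL⟩ := runs_sketchLearner hn (learnerInput_ints_zero ε δ w train)
    (learnerInput_ints_three ε δ w train) (learnerInput_reals_zero ε δ w train)
  refine ⟨L, hL.run_eq ?_⟩
  rw [allowedTime, timeBound, Polynomial.eval_C_mul, Polynomial.eval_pow, Polynomial.eval_X]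
  set s := (learnerInput ε δ w train).size with hs
  have hsize := size_learnerInput ε δ w train
  have hs1 : 1 ≤ s := by omega
  have hNs : N ≤ s := by omega
  -- The `N` sequences alone contribute `N n d` numbers, and `d ≥ 1`. This makes the walk length `R
  -- ^ 2 = (n N) ^ 2 N ^ 4` at most `s ^ 6`.
  have hnN : n * N ≤ s := by
    have : n * N ≤ N * (n * d) := by nlinarith [Nat.mul_le_mul_left (n * N) hd]
    omega
  have hns : n ≤ s := by nlinarith [Nat.mul_le_mul_left n hN]
  have hR : (n * N ^ 3) ^ 2 ≤ s ^ 6 :=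
    calc (n * N ^ 3) ^ 2 = (n * N) ^ 2 * N ^ 4 := by ring
      _ ≤ s ^ 2 * s ^ 4 := by gcongr
      _ = s ^ 6 := by ring
  have h1 : ∀ i ≤ 10, s ^ i ≤ s ^ 10 := fun i hi => Nat.pow_le_pow_right hs1 hi
  have h6 := h1 6 (by norm_num)
  have h7 := h1 7 (by norm_num)
  have h8 := h1 8 (by norm_num)
  have h0 := h1 0 (by norm_num)
  have h2 := h1 1 (by norm_num)
  rw [pow_zero] at h0
  rw [pow_one] at h2
  calc n * ((n * N ^ 3) ^ 2 * (6 * n + 21) + 30) + 6 * (n * N ^ 3) ^ 2 + 8 * n + 50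
      ≤ s * (s ^ 6 * (6 * s + 21) + 30) + 6 * s ^ 6 + 8 * s + 50 := by gcongr
    _ = 6 * s ^ 8 + 21 * s ^ 7 + 6 * s ^ 6 + 38 * s + 50 := by ring
    _ ≤ 200 * s ^ 10 := by omega

lemma learned_eq (hn : 1 ≤ n) (hd : 1 ≤ d) (hN : 1 ≤ N) (ε δ : ℝ)
    (w : Fin m → EuclideanSpace ℝ (Fin d)) (train : Fin N → Seq n d × ℕ) :
    learned sketchLearner timeBound ε δ w train = readout (learnerOutput n N ε) := by
  obtain ⟨L, hL⟩ := runs_sketchLearner_learnerInput hn hd hN ε δ w train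
  rw [learned, hL]
  rfl

lemma monotone_readout_learnerOutput (n N : ℕ) (ε : ℝ) :
    Monotone (readout (learnerOutput n N ε)) :=
  monotone_stepValue_stepList (by norm_num) _

end Input

/-! ### Constants and correctness of the readout -/

section Correctness

variable {n d m N : ℕ}

lemma sqrt_log_le_sqrtLog (hn : 2 ≤ n) : √(Real.log n) ≤ sqrtLog n := by
  rw [Real.sqrt_le_left (by positivity)]
  have h : (n : ℝ) ≤ 2 ^ sqrtLog n ^ 2 := by exact_mod_cast le_two_pow_sqrtLog_sq n
  calc Real.log n ≤ Real.log (2 ^ sqrtLog n ^ 2) := Real.log_le_log (by positivity) h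
    _ = (sqrtLog n : ℝ) ^ 2 * Real.log 2 := by rw [Real.log_pow]; push_cast; ring
    _ ≤ (sqrtLog n : ℝ) ^ 2 * 1 := by
      gcongr
      exact Real.log_two_lt_d9.le.trans (by norm_num)
    _ = _ := mul_one _

lemma log_natCast_ge (hn : 2 ≤ n) : 0.69 ≤ Real.log n := by
  have : Real.log 2 ≤ Real.log n := Real.log_le_log (by norm_num) (by exact_mod_cast hn)
  linarith [Real.log_two_gt_d9]

/-- Minimality at `sqrtLog n - 1` gives `sqrtLog n ≤ 1.25 √(ln n) + 1`, and `n ≥ 2` lets the factor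
`3` absorb the `1`. -/
lemma sqrtLog_le_three_mul (hn : 2 ≤ n) : (sqrtLog n : ℝ) ≤ 3 * √(Real.log n) := by
  have hlog := log_natCast_ge hn
  have hsq := Real.sq_sqrt (show 0 ≤ Real.log n by linarith)
  have h0 := Real.sqrt_nonneg (Real.log n)
  rcases Nat.eq_zero_or_pos (sqrtLog n) with hq | hq
  · rw [hq]; simp
  obtain ⟨i, hi⟩ := Nat.exists_eq_add_of_le' hq
  have h : (2 : ℝ) ^ i ^ 2 ≤ n := by exact_mod_cast (two_pow_sq_lt (by omega)).le
  have h2 : (i : ℝ) ^ 2 * Real.log 2 ≤ Real.log n := by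
    have := Real.log_le_log (by positivity) h
    rw [Real.log_pow] at this
    exact_mod_cast this
  have h3 : (i : ℝ) ^ 2 * 0.69 ≤ Real.log n := by nlinarith [Real.log_two_gt_d9, sq_nonneg (i : ℝ)]
  have h4 : 0.8 ≤ √(Real.log n) := Real.le_sqrt_of_sq_le (by norm_num; linarith)
  have h5 : (i : ℝ) ≤ 1.25 * √(Real.log n) := by
    refine (sq_le_sq₀ (by positivity) (by positivity)).1 ?_
    nlinarith
  rw [hi]; push_cast; linarith

lemma abs_gaussianMax_firstBasis_sub_binomMax_le (hn : 2 ≤ n) {k : ℕ} (hk : 1 ≤ k) (hkn : k ≤ n)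
    {R : ℕ} (hR : 0 < R) {β e : ℝ} (hβ : 0 < β) (he : Real.log n / β + 1600 * n * β ^ 2 / R ≤ e) :
    |gaussianMax (firstBasis n k hkn) - binomMax R k| ≤ e := by
  have : Nonempty (Fin k) := ⟨⟨0, hk⟩⟩
  have hk0 : (0 : ℝ) < k := by exact_mod_cast hk
  have hkn' : (k : ℝ) ≤ n := by exact_mod_cast hkn
  have h := abs_gaussianMax_sub_binomMax_le (c := firstBasis n k hkn) hn (by simpa using hkn)
    (norm_firstBasis hkn) le_rfl (by norm_num) (fun i j hij => by
      rw [inner_firstBasis_of_ne hkn hij]; simp) hβ hR (e := e) (le_trans (by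
        rw [Fintype.card_fin]
        gcongr) he)
  simpa using h

/-- The readout of the learner is correct where the sketch is close to its ideal value. -/
lemma correct_learnerOutput (hn : 2 ≤ n) {ε : ℝ} (hε : 0 < ε) (hε1 : ε ≤ 1) (hN : 0 < N) {k : ℕ}
    (hk : 2 ≤ k) (hkn : k ≤ n)
    (hNε : Real.log n / N + 1600 / N ≤ ε / (8000 * sqrtLog n) / 100) {s : ℝ}
    (hs : |s - binomMax (n * N ^ 3) k| ≤ ε / (8000 * sqrtLog n) / 2) :
    (k : ℝ) ≤ readout (learnerOutput n N ε) s ∧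
      readout (learnerOutput n N ε) s ≤ (1 + ε) * k := by
  set t := ε / (8000 * sqrtLog n) with ht
  have hn0 : (0 : ℝ) < n := by positivity
  have hN0 : (0 : ℝ) < N := by positivity
  have hlog := log_natCast_ge hn
  have hL : 0 < √(Real.log n) := Real.sqrt_pos.2 (by linarith)
  have hq := sqrt_log_le_sqrtLog hn
  have htpos : 0 < t := div_pos hε (by linarith)
  have htle : t ≤ ε / (8000 * √(Real.log n)) := by rw [ht]; gcongr
  -- With `β = N` and `R = n N ^ 3` the Lindeberg error `1600 n β ^ 2 / R` becomes `1600 / N`.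
  have hclose : ∀ j (_ : 1 ≤ j) (hj : j ≤ n),
      |gaussianMax (firstBasis n j hj) - binomMax (n * N ^ 3) j| ≤ t / 100 := fun j hj1 hj =>
    abs_gaussianMax_firstBasis_sub_binomMax_le hn hj1 hj (by positivity) hN0 (le_trans (le_of_eq (by
      push_cast; field_simp)) hNε)
  have hck := abs_le.1 (hclose k (by omega) hkn)
  have hs' := abs_le.1 hs
  have heq : readout (learnerOutput n N ε) s
      = stepValue s 1 (stepList (breakpoint (n * N ^ 3) t) 2 (n - 1)) := rfl
  rw [heq]
  constructor
  · refine natCast_le_stepValue_stepList hk (by omega) fun j hj hjk => ?_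
    have hcj := abs_le.1 (hclose j (by omega) (hjk.trans hkn))
    have := gaussianMax_firstBasis_mono (by omega) hjk hkn
    rw [breakpoint]
    linarith
  · have hk0 : (2 : ℝ) ≤ k := by exact_mod_cast hk
    rcases stepValue_stepList_cases (τ := breakpoint (n * N ^ 3) t) (s := s) 1 2 (n - 1) with
      h | ⟨K, h2K, hKn, hτ, h⟩
    · rw [h]; nlinarith
    · rw [h]
      -- A passed breakpoint beyond `(1 + ε) k` would force a gap of at most `t + t / 2 + 2 t /
      -- 100`, but the gap is at least `4 t`.
      by_contra! hlt
      have hK : K ≤ n := by omega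
      have hkK : k ≤ K := by
        have : (k : ℝ) ≤ K := by nlinarith
        exact_mod_cast this
      have hgap := gaussianMax_firstBasis_gap hn hk hK hε hε1 hlt.le hkK
      have hcK := abs_le.1 (hclose K (by omega) hK)
      rw [breakpoint] at hτ
      have h8 : ε / (8000 * √(Real.log n)) * 4 ≤ ε / (700 * √(Real.log n)) := by
        rw [div_mul_eq_mul_div, div_le_div_iff₀ (by positivity) (by positivity)]
        nlinarith [mul_pos hε hL]
      linarith

/-- The bounds on `ρ` and `η` make `ρ √(ln n)` and `√η √(ln n)` at most `1e-6 * ε / √(ln n) ≤ 0.024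
t`, where `t` is the breakpoint margin; with the walk error `t / 100` the total stays below `t / 5`.
-/
lemma abs_gaussianMax_sub_binomMax_le_tolerance (hn : 2 ≤ n) {ε η ρ : ℝ} (hε : 0 < ε)
    (hε1 : ε ≤ 1 / 2) (hη0 : 0 < η) (hρ0 : 0 ≤ ρ)
    (hρ : ρ ≤ 1e-6 * (ε / Real.log n)) (hη : η ≤ 1e-12 * (ε ^ 2 / Real.log n ^ 2)) (hN : 0 < N)
    (hNε : Real.log n / N + 1600 / N ≤ ε / (8000 * sqrtLog n) / 100) {k : ℕ} {X : Seq n d}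
    (hX : Clusterable η ρ k X) :
    k ≤ n ∧ |gaussianMax X - binomMax (n * N ^ 3) k| ≤ ε / (8000 * sqrtLog n) / 5 := by
  set t := ε / (8000 * sqrtLog n) with ht
  have hn0 : (0 : ℝ) < n := by positivity
  have hN0 : (0 : ℝ) < N := by positivity
  have hlog := log_natCast_ge hn
  set L := √(Real.log n) with hLdef
  have hL : 0 < L := Real.sqrt_pos.2 (by linarith)
  have hLsq : L ^ 2 = Real.log n := Real.sq_sqrt (by linarith)
  have hq := sqrt_log_le_sqrtLog hn
  have hq3 := sqrtLog_le_three_mul hn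
  have htpos : 0 < t := div_pos hε (by linarith)
  have htle : ε / L ≤ 24000 * t := by
    rw [ht, ← mul_div_assoc, div_le_div_iff₀ hL (by linarith)]
    nlinarith
  have hρL : ρ * L ≤ 1e-6 * (ε / L) := by
    calc ρ * L ≤ 1e-6 * (ε / Real.log n) * L := by gcongr
      _ = 1e-6 * (ε / L) := by rw [← hLsq]; field_simp
  have hρ2 : ρ ≤ 1 / 2 := by
    have : ε / Real.log n ≤ 1 := by rw [div_le_one (by linarith)]; linarith
    linarith
  have hηL : √η * L ≤ 1e-6 * (ε / L) := by
    have : √η ≤ 1e-6 * (ε / L ^ 2) := by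
      rw [Real.sqrt_le_left (by positivity)]
      refine hη.trans (le_of_eq ?_)
      rw [← hLsq]; ring
    calc √η * L ≤ 1e-6 * (ε / L ^ 2) * L := by gcongr
      _ = 1e-6 * (ε / L) := by field_simp
  obtain ⟨hkn, h⟩ := abs_gaussianMax_sub_binomMax_le_of_clusterable (R := n * N ^ 3) hn hη0 hρ0 hρ2 hX
    hN0 (by positivity) (e := t / 100) (le_trans (le_of_eq (by push_cast; field_simp)) hNε)
  refine ⟨hkn, h.trans ?_⟩
  nlinarith

/-- The target is `δ ^ 2`, since Markov's inequality later spends one factor `δ`. With `x = ln n /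
(ε δ) ≥ 1.38 / δ`, the bound on `m` makes the exponent at least `5 ln x`. -/
lemma ofReal_deviation_le (hn : 2 ≤ n) {ε δ : ℝ} (hε : 0 < ε)
    (hε1 : ε ≤ 1 / 2) (hδ : 0 < δ) (hδ1 : δ < 1)
    (hm : 1e12 * (Real.log n * Real.log (Real.log n / (ε * δ)) / ε ^ 2) ≤ m) :
    0 < m ∧ 2 * Real.exp (-(m * (ε / (8000 * sqrtLog n) / 8) ^ 2 / 5)) ≤ δ ^ 2 := by
  have hlog := log_natCast_ge hn
  set x := Real.log n / (ε * δ) with hx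
  have hx1 : 1.38 / δ ≤ x := by
    rw [hx, div_le_div_iff₀ hδ (by positivity)]
    nlinarith
  have hδx : 1 / x ≤ δ / 1.38 := by
    rw [← one_div_div 1.38 δ]
    exact one_div_le_one_div_of_le (by positivity) hx1
  have hx0 : 1 < x := lt_of_lt_of_le (by rw [lt_div_iff₀ hδ]; linarith) hx1
  have hlx : 0 < Real.log x := Real.log_pos hx0
  have hm0 : (0 : ℝ) < m := lt_of_lt_of_le (by positivity) hm
  refine ⟨by exact_mod_cast hm0, ?_⟩
  set L := √(Real.log n) with hLdef
  have hL : 0 < L := Real.sqrt_pos.2 (by linarith)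
  have hLsq : L ^ 2 = Real.log n := Real.sq_sqrt (by linarith)
  have hq := sqrt_log_le_sqrtLog hn
  have hq3 := sqrtLog_le_three_mul hn
  have ht : ε / (192000 * L) ≤ ε / (8000 * sqrtLog n) / 8 := by
    rw [div_div]
    gcongr ε / ?_
    · linarith
    · linarith
  have hexp : 5 * Real.log x ≤ m * (ε / (8000 * sqrtLog n) / 8) ^ 2 / 5 :=
    calc 5 * Real.log x ≤ 1e12 / 192000 ^ 2 / 5 * Real.log x := by
          gcongr; norm_num
      _ = 1e12 * (L ^ 2 * Real.log x / ε ^ 2) * (ε / (192000 * L)) ^ 2 / 5 := by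
          field_simp
      _ ≤ m * (ε / (8000 * sqrtLog n) / 8) ^ 2 / 5 := by
          rw [hLsq]; gcongr
  calc 2 * Real.exp (-(m * (ε / (8000 * sqrtLog n) / 8) ^ 2 / 5))
      ≤ 2 * Real.exp (-(5 * Real.log x)) := by gcongr
    _ = 2 * (1 / x) ^ 5 := by
        rw [show 5 * Real.log x = Real.log (x ^ 5) by rw [Real.log_pow]; norm_num, Real.exp_neg,
          Real.exp_log (by positivity), one_div, inv_pow]
    _ ≤ 2 * (δ / 1.38) ^ 5 := by gcongr
    _ = 2 / 1.38 ^ 5 * δ ^ 3 * δ ^ 2 := by ring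
    _ ≤ 1 * 1 ^ 3 * δ ^ 2 := by gcongr; norm_num
    _ = δ ^ 2 := by ring

/-- The number of samples in terms of `ln n`, `1 / ε` and `ln (1 / δ)`. -/
noncomputable def sampleBound : MvPolynomial (Fin 3) ℝ :=
  .C 1e10 * (.X 0 + 1) ^ 2 * .X 1

/-- The sample size is needed only to make the error of the tabulated maxima small against the
margin; the constants multiply to `1600 * 8000 * 3 * 100 = 3.84e9`. -/
lemma pos_and_div_le_of_sampleBound_le (hn : 2 ≤ n) {ε x : ℝ} (hε : 0 < ε)
    (hN : MvPolynomial.eval ![Real.log n, 1 / ε, x] sampleBound ≤ N) :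
    0 < N ∧ Real.log n / N + 1600 / N ≤ ε / (8000 * sqrtLog n) / 100 := by
  have hlog := log_natCast_ge hn
  have hN' : 1e10 * (Real.log n + 1) ^ 2 * (1 / ε) ≤ N := by
    simpa [sampleBound] using hN
  have hN0 : (0 : ℝ) < N := lt_of_lt_of_le (by positivity) hN'
  refine ⟨by exact_mod_cast hN0, ?_⟩
  set L := √(Real.log n) with hLdef
  have hL : 0 < L := Real.sqrt_pos.2 (by linarith)
  have hLsq : L ^ 2 = Real.log n := Real.sq_sqrt (by linarith)
  have hq := sqrt_log_le_sqrtLog hn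
  have hq3 := sqrtLog_le_three_mul hn
  have hL1 : L ≤ Real.log n + 1 := by nlinarith [sq_nonneg (L - 1)]
  have hN2 : 1e10 * (Real.log n + 1) ^ 2 ≤ ε * N := by
    rw [mul_one_div, div_le_iff₀ hε] at hN'
    linarith
  rw [← add_div, div_div, div_le_div_iff₀ hN0 (by linarith)]
  calc (Real.log n + 1600) * (8000 * sqrtLog n * 100)
      ≤ (1600 * (Real.log n + 1)) * (8000 * (3 * (Real.log n + 1)) * 100) := by
        gcongr
        · linarith
        · linarith
    _ = 3.84e9 * (Real.log n + 1) ^ 2 := by ring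
    _ ≤ 1e10 * (Real.log n + 1) ^ 2 := by gcongr; norm_num
    _ ≤ ε * N := hN2

end Correctness

/-! ### Failure probabilities -/

section Failure

lemma measurable_sketch {n d m : ℕ} :
    Measurable fun x : (Fin m → EuclideanSpace ℝ (Fin d)) × Seq n d => sketch x.1 x.2 := by
  unfold sketch
  refine measurable_const.mul (Finset.measurable_sum _ fun j _ => Measurable.iSup fun i => ?_)
  fun_prop

lemma measurableSet_lt_abs_sketch_sub {n d m : ℕ} (a : ℕ → ℝ) (b : ℝ) :
    MeasurableSet {x : (Fin m → EuclideanSpace ℝ (Fin d)) × (Seq n d × ℕ) |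
      b < |sketch x.1 x.2.1 - a x.2.2|} := by
  have h1 : Measurable fun x : (Fin m → EuclideanSpace ℝ (Fin d)) × (Seq n d × ℕ) =>
      sketch x.1 x.2.1 :=
    measurable_sketch.comp (f := fun x : (Fin m → EuclideanSpace ℝ (Fin d)) × (Seq n d × ℕ) =>
      (x.1, x.2.1)) (by fun_prop)
  have h2 : Measurable fun x : (Fin m → EuclideanSpace ℝ (Fin d)) × (Seq n d × ℕ) => a x.2.2 :=
    (Measurable.of_discrete (f := a)).comp (by fun_prop)
  exact measurableSet_lt measurable_const (h1.sub h2).norm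

/-- If `bad y z` depends on the first component of `y` and on `z` only, up to a measurable set all
of whose sections are small, then it has small probability, jointly and in the sense of Markov's
inequality. -/
lemma measure_bad_le {W T Z : Type*} [MeasurableSpace W] [MeasurableSpace T] [MeasurableSpace Z]
    (μ : Measure W) (ν : Measure T) (D : Measure Z) [IsProbabilityMeasure μ]
    [IsProbabilityMeasure ν] [IsProbabilityMeasure D] {B : Set (W × Z)} (hB : MeasurableSet B)
    {δ : ℝ} (hδ : 0 < δ) (hδ1 : δ ≤ 1)
    (hsmall : ∀ᵐ z ∂D, μ {w | (w, z) ∈ B} ≤ ENNReal.ofReal (δ ^ 2))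
    {bad : W × T → Z → Prop} (hbad : ∀ᵐ z ∂D, ∀ y, bad y z → (y.1, z) ∈ B) :
    ((μ.prod ν).prod D) {x | bad x.1 x.2} ≤ ENNReal.ofReal δ ∧
      (μ.prod ν) {y | ENNReal.ofReal δ < D {z | bad y z}} ≤ ENNReal.ofReal δ := by
  set B' : Set ((W × T) × Z) := (fun x => (x.1.1, x.2)) ⁻¹' B with hB'
  have hmB' : MeasurableSet B' := hB.preimage (by fun_prop)
  have hjoint : ((μ.prod ν).prod D) B' ≤ ENNReal.ofReal (δ ^ 2) := by
    rw [Measure.prod_apply_symm hmB']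
    calc ∫⁻ z, (μ.prod ν) ((fun y => (y, z)) ⁻¹' B') ∂D
        ≤ ∫⁻ _, ENNReal.ofReal (δ ^ 2) ∂D := by
          refine lintegral_mono_ae ?_
          filter_upwards [hsmall] with z hz
          have hz' : MeasurableSet {w | (w, z) ∈ B} :=
            hB.preimage (measurable_id.prodMk measurable_const)
          exact (measurePreserving_fst.measure_preimage hz'.nullMeasurableSet).trans_le hz
      _ = ENNReal.ofReal (δ ^ 2) := by simp
  constructor
  -- The failure event itself need not be measurable; it is only contained, almost everywhere, in
  -- the measurable set `B'`.
  · refine (measure_mono_ae ?_).trans (hjoint.trans (ENNReal.ofReal_le_ofReal (by nlinarith)))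
    filter_upwards [Measure.quasiMeasurePreserving_snd.ae hbad] with x hx hbx
    exact hx _ hbx
  · have hle : ∀ y, D {z | bad y z} ≤ D (Prod.mk y ⁻¹' B') := fun y => measure_mono_ae (by
      filter_upwards [hbad] with z hz hbz
      exact hz _ hbz)
    have hδ0 : ENNReal.ofReal δ ≠ 0 := (ENNReal.ofReal_pos.2 hδ).ne'
    calc (μ.prod ν) {y | ENNReal.ofReal δ < D {z | bad y z}}
        ≤ (μ.prod ν) {y | ENNReal.ofReal δ ≤ D (Prod.mk y ⁻¹' B')} :=
          measure_mono fun y hy => (le_of_lt hy).trans (hle y)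
      _ ≤ (∫⁻ y, D (Prod.mk y ⁻¹' B') ∂(μ.prod ν)) / ENNReal.ofReal δ :=
          meas_ge_le_lintegral_div (measurable_measure_prodMk_left hmB').aemeasurable hδ0
            ENNReal.ofReal_ne_top
      _ ≤ ENNReal.ofReal (δ ^ 2) / ENNReal.ofReal δ := by
          rw [← Measure.prod_apply hmB']
          gcongr
      _ = ENNReal.ofReal δ := by
          rw [← ENNReal.ofReal_div_of_pos hδ]
          congr 1
          field_simp

/-- The sketch of a clusterable sequence is rarely far from its ideal value. -/
lemma gaussianWeights_lt_abs_sketch_sub_binomMax_le {n d m : ℕ} [NeZero n] (hm : 0 < m)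
    {X : Seq n d} (hX : ∀ i, ‖X i‖ = 1) {β t a : ℝ} (hβ : 0 < β) (ht : 0 < t)
    (hβt : Real.log n / β ≤ t / 100) (ha : |gaussianMax X - a| ≤ t / 5) :
    gaussianWeights m d {w | t / 2 < |sketch w X - a|}
      ≤ ENNReal.ofReal (2 * Real.exp (-(m * (t / 8) ^ 2 / 5))) := by
  refine (measure_mono fun w hw => ?_).trans
    (gaussianWeights_sketch_le (d := d) hm hβ hX (t := t / 8) (by positivity))
  -- Budget: `t / 2 - t / 5` exceeds `t / 8 + t / 100`.
  have h3 := abs_sub_le (sketch w X) (gaussianMax X) a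
  have hw' : t / 2 < |sketch w X - a| := hw
  change t / 8 + Real.log n / β ≤ |sketch w X - gaussianMax X|
  linarith

end Failure

end MaxSketch

theorem theorem2 :
    ∃ cρ > (0 : ℝ), ∃ cη > (0 : ℝ), ∃ C > (0 : ℝ),
    -- the algorithm, its time bound (a polynomial in the input size), and the sample size
    ∃ (p : MaxSketch.Com) (T : Polynomial ℕ) (P : MvPolynomial (Fin 3) ℝ),
    ∀ (n d m N : ℕ) (ε δ : ℝ), 2 ≤ n → 1 ≤ d → 0 < ε → ε ≤ 1 / 2 → 0 < δ → δ < 1 →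
    C * (Real.log n * Real.log (Real.log n / (ε * δ)) / ε ^ 2) ≤ m →
    MvPolynomial.eval ![Real.log n, 1 / ε, Real.log (1 / δ)] P ≤ N →
      -- on all inputs, the algorithm halts in time and outputs a monotone function
      (∀ (w : Fin m → EuclideanSpace ℝ (Fin d)) (train : Fin N → MaxSketch.Seq n d × ℕ),
        MaxSketch.HaltsWithin p (MaxSketch.learnerInput ε δ w train)
          (MaxSketch.allowedTime T ε δ w train) ∧
        Monotone (MaxSketch.learned p T ε δ w train)) ∧
      ∀ (η ρ : ℝ), 0 < η → η < 1 → 0 ≤ ρ → ρ < 1 →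
      ρ ≤ cρ * (ε / Real.log n) → η ≤ cη * (ε ^ 2 / Real.log n ^ 2) →
      ∀ (D : MeasureTheory.Measure (MaxSketch.Seq n d × ℕ))
        [MeasureTheory.IsProbabilityMeasure D],
      (∀ᵐ z ∂D, 2 ≤ z.2 ∧ MaxSketch.Clusterable η ρ z.2 z.1) →
        -- jointly over weights, training samples and test sample, failure has probability ≤ δ
        (((MaxSketch.gaussianWeights m d).prod
            (MeasureTheory.Measure.pi fun _ : Fin N => D)).prod D)
          {x | ¬ MaxSketch.Correct ε x.1.1 (MaxSketch.learned p T ε δ x.1.1 x.1.2) x.2}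
            ≤ ENNReal.ofReal δ ∧
        -- and, except with probability ≤ δ over weights and training samples, the learned
        -- function fails on a fresh test sample with probability ≤ δ
        ((MaxSketch.gaussianWeights m d).prod (MeasureTheory.Measure.pi fun _ : Fin N => D))
          {y | ENNReal.ofReal δ <
            D {z | ¬ MaxSketch.Correct ε y.1 (MaxSketch.learned p T ε δ y.1 y.2) z}}
            ≤ ENNReal.ofReal δ := by

  refine ⟨1e-6, by norm_num, 1e-12, by norm_num, 1e12, by norm_num, MaxSketch.sketchLearner,
    MaxSketch.timeBound, MaxSketch.sampleBound, ?_⟩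
  intro n d m N ε δ hn hd hε hε1 hδ hδ1 hm hN
  obtain ⟨hN0, hNε⟩ := MaxSketch.pos_and_div_le_of_sampleBound_le hn hε hN
  obtain ⟨hm0, hdev⟩ := MaxSketch.ofReal_deviation_le hn hε hε1 hδ hδ1 hm
  have : NeZero n := ⟨by omega⟩
  refine ⟨fun w train => ⟨?_, ?_⟩, ?_⟩
  · obtain ⟨L, hL⟩ := MaxSketch.runs_sketchLearner_learnerInput (by omega) hd hN0 ε δ w train
    rw [MaxSketch.HaltsWithin, hL]
  · rw [MaxSketch.learned_eq (by omega) hd hN0]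
    exact MaxSketch.monotone_readout_learnerOutput n N ε
  intro η ρ hη0 _ hρ0 _ hρ hη D _ hD
  -- The learned function is now a fixed one, so failure depends on the weights and the test sample
  -- alone.
  simp only [MaxSketch.learned_eq (show 1 ≤ n by omega) hd hN0]
  set t := ε / (8000 * MaxSketch.sqrtLog n) with ht
  have htpos : 0 < t :=
    div_pos hε (mul_pos (by norm_num) (lt_of_lt_of_le (Real.sqrt_pos.2
      (by linarith [MaxSketch.log_natCast_ge hn])) (MaxSketch.sqrt_log_le_sqrtLog hn)))
  have hN0' : (0 : ℝ) < N := by exact_mod_cast hN0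
  have hlogN : Real.log n / N ≤ t / 100 := by
    have : (0 : ℝ) ≤ 1600 / N := by positivity
    linarith
  refine MaxSketch.measure_bad_le
    (B := {x | t / 2 < |MaxSketch.sketch x.1 x.2.1 - MaxSketch.binomMax (n * N ^ 3) x.2.2|})
    (bad := fun y z => ¬ MaxSketch.Correct ε y.1
      (MaxSketch.readout (MaxSketch.learnerOutput n N ε)) z) _ _ D ?_ hδ hδ1.le ?_ ?_
  · exact MaxSketch.measurableSet_lt_abs_sketch_sub _ _
  · filter_upwards [hD] with z hz
    have h := (MaxSketch.abs_gaussianMax_sub_binomMax_le_tolerance hn hε hε1 hη0 hρ0 hρ hη hN0 hNε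
      hz.2).2
    exact (MaxSketch.gaussianWeights_lt_abs_sketch_sub_binomMax_le hm0 hz.2.1 hN0' htpos hlogN
      h).trans (ENNReal.ofReal_le_ofReal hdev)
  · filter_upwards [hD] with z hz y hbad
    by_contra hgood
    exact hbad (MaxSketch.correct_learnerOutput hn hε (by linarith) hN0 hz.1
      (MaxSketch.abs_gaussianMax_sub_binomMax_le_tolerance hn hε hε1 hη0 hρ0 hρ hη hN0 hNε hz.2).1
      hNε (not_lt.1 hgood))
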